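/- **Setting.** Let $L>0$, $\Omega=[0,L]^3$ with periodic boundary conditions, $\lambda_1=4\pi^2/L^2$. For $s\ge 0$ let $\dot H^s(\Omega)$ be the space of real $L$-periodic vector fields $u=\sum_{K\in\mathbb Z^3\setminus\{0\}}\hat u_K e^{2\pi i K\cdot x/L}$ in $L^2(\Omega)^3$ of zero mean with $\sum_K|K/L|^{2s}|\hat u_K|^2<\infty$, let $\dot L^2=\dot H^0$, and let $\dot V_s$ be the subspace of its divergence free elements; $H=\dot V_0$, $V=\dot V_1$, $D(A)=\dot V_2$, and $\dot V_{-2}=D(A)'$. Write $A=-\Delta$, $|u|=\|u\|_{L^2}$, $\|u\|=\|\nabla u\|_{L^2}$, $\mathcal P$ for the Helmholtz–Leray projection, and $B(v,u)=\mathcal P[(v\cdot\nabla)u]$. Let $\nu,\alpha,\beta,\eta,h,c_1,c_2>0$, $f\in L^\infty([0,\infty);H)$ and $u_0,w_0\in V$. Let $I_h:\dot H^2(\Omega)\to\dot L^2(\Omega)$ be linear with $$\|I_hg-g\|_{L^2}^2\le c_1^2h^2\|\nabla g\|_{L^2}^2+c_2^2h^4\|\Delta g\|_{L^2}^2\qquad\text{for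 all } g\in\dot H^2(\Omega).$$ Let $u$ and $w$ be global regular solutions of $$\frac{dv}{dt}+\nu Av+B(v,u)=f,\quad v=u+\alpha^2Au,\quad u(0)=u_0,$$ $$\frac{dz}{dt}+\nu Az+B(z,w)=f-\eta(I+\beta^2A)\mathcal P(I_hw-I_hu),\quad z=w+\beta^2Aw,\quad w(0)=w_0,$$ that is, for every $T>0$, $u,w\in C([0,T];V)\cap L^2([0,T];D(A))$ with $\frac{du}{dt},\frac{dw}{dt}\in L^2([0,T];H)$, and the equations hold in $D(A)'$ for almost every $t\ge0$. Put $S=\sup_{s\ge0}|f(s)|^2$ (essential supremum) and $$M_1=|u_0|^2+\alpha^2\|u_0\|^2+\frac{S}{\lambda_1^2\nu^2}.$$ **Theorem.** There is an absolute (dimensionless) constant $c>0$ such that, on every such box, the Gagliardo–Nirenberg inequalities $$\|g\|_{L^6}\le c\|g\|,\quad \|g\|_{L^3}\le c|g|^{1/2}\|g\|^{1/2}\quad(g\in V),\qquad \|g\|_{L^\infty}\le c\|g\|^{1/2}|Ag|^{1/2}\quad(g\in D(A))$$ hold, and such that the following is true for all data as above. Assume 1. $\displaystyle \frac{3\eta}{4}-\frac{15^3M_1^2c^4}{2^{11}\nu^3\alpha^4}>0$,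 2. $\displaystyle \eta c_1^2h^2+\frac{5\eta^2\beta^2}{2\nu}c_1^2h^2+\frac{30^3c^4M_1^2}{4^4\nu^3\alpha^4}-\eta\beta^2<\frac{\nu}{4}$, 3. $\displaystyle \eta c_2^2h^4+\frac{5c_2^2\eta^2\beta^2h^4}{2\nu}<\frac{\nu\beta^2}{4}$. Then $g(t)=w(t)-u(t)$ satisfies, for all $t\ge0$, $$|g(t)|^2+\beta^2\|g(t)\|^2\le e^{-\lambda_1\nu t/2}\left(|g(0)|^2+\beta^2\|g(0)\|^2\right)+M_\alpha\,\frac{e}{e^{1/2}-1},$$ where $$\begin{aligned}M_\alpha=\frac{5|\beta^2-\alpha^2|^2}{\beta}\Bigg[&\frac1{\nu\beta}\left(\frac{6M_1}{\nu\alpha^2}+\frac{6S}{\nu^3\lambda_1^2\alpha^2}\right)\left(\nu^2+\frac{c^2M_1}{16\pi^4\lambda_1^{1/2}\alpha^2}\right)+\frac{3c^2M_1^2}{16\nu^2\beta\pi^4\alpha^6\lambda_1^{3/2}}+\frac{3S}{\nu^2\lambda_1\beta}\\&+\frac{\nu}{\beta}\left(\frac{M_1}{\nu\alpha^2}+\frac{S}{\nu^3\alpha^2\lambda_1^2}\right)+\frac{c^2M_1}{2\nu\alpha^2}\left(\frac{M_1}{\nu\alpha^2}+\frac{S}{\lambda_1^2\nu^3\alpha^2}\right)\Bigg].\end{aligned}$$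 -/

import Mathlib

open MeasureTheory Filter Topology
open scoped ENNReal ComplexConjugate

noncomputable section

namespace MLAlpha

/-! ### Periodic vector fields on the box of side `L` -/

/-- The three-dimensional periodic box `Ω = [0,L]³`, with opposite faces identified.  Its
`volume` is Lebesgue measure, of total mass `L³`. -/
abbrev Torus (L : ℝ) : Type := Fin 3 → AddCircle L

/-- `ℝ³` with its Euclidean norm: the values of the vector fields. -/
abbrev R3 : Type := EuclideanSpace ℝ (Fin 3)

/-- `ℂ³` with its Hermitian norm: the values of the Fourier coefficients. -/
abbrev C3 : Type := EuclideanSpace ℂ (Fin 3)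

/-- Wave vectors `K ∈ ℤ³`. -/
abbrev Wave : Type := Fin 3 → ℤ

/-- `|K|²`. -/
def waveSq (K : Wave) : ℝ := ∑ i, (K i : ℝ) ^ 2

/-- The character `x ↦ e^{2πi K·x/L}` of the periodic box. -/
def character (L : ℝ) (K : Wave) (x : Torus L) : ℂ := ∏ i, fourier (K i) (x i)

variable (L : ℝ) [Fact (0 < L)]

/-- Real vector fields in `L²(Ω)³`; its norm is `|u| = ‖u‖_{L²}`. -/
abbrev L2 : Type := Lp R3 2 (volume : Measure (Torus L))

variable {L}

/-- The Fourier coefficient `F̂_K = L⁻³ ∫_Ω F(x) e^{-2πi K·x/L} dx` of a vector field. -/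
def coeff (F : Torus L → R3) (K : Wave) : C3 :=
  WithLp.toLp 2 fun i =>
    ((L : ℂ) ^ 3)⁻¹ * ∫ x, conj (character L K x) * ((F x i : ℝ) : ℂ)

open Classical in
/-- The square integrable vector field with Fourier coefficients `a_K` (and `0` if there is no
such field). -/
def ofCoeff (a : Wave → C3) : L2 L :=
  if h : ∃ u : L2 L, ∀ K, coeff u K = a K then h.choose else 0

variable (L) in
/-- `λ_K = 4π²|K|²/L²`. -/
def eigen (K : Wave) : ℝ := 4 * Real.pi ^ 2 * waveSq K / L ^ 2

variable (L) in
/-- The first eigenvalue `λ₁ = 4π²/L²`. -/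
def lam1 : ℝ := 4 * Real.pi ^ 2 / L ^ 2

/-- The operator `A = -Δ`, as the Fourier multiplier `λ_K`. -/
def stokes (u : L2 L) : L2 L := ofCoeff fun K => (eigen L K : ℂ) • coeff u K

/-- The partial derivative `∂_j`, as the Fourier multiplier `2πi K_j/L`. -/
def pderiv (j : Fin 3) (u : L2 L) : L2 L :=
  ofCoeff fun K => (2 * Real.pi * Complex.I * (K j : ℂ) / (L : ℂ)) • coeff u K

/-- `‖u‖ = ‖∇u‖_{L²}`. -/
def gradNorm (u : L2 L) : ℝ := √(∑ j, ‖pderiv j u‖ ^ 2)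

/-- The unfiltered field `(I + α²A)u`. -/
def helmholtz (α : ℝ) (u : L2 L) : L2 L := u + α ^ 2 • stokes u

/-! ### Linearity of the Fourier coefficients, and the spaces -/

theorem continuous_character (K : Wave) : Continuous (character L K) := by
  unfold character
  exact continuous_finsetProd _ fun i _ => (map_continuous (fourier (K i))).comp
    (continuous_apply i)

theorem norm_character (K : Wave) (x : Torus L) : ‖character L K x‖ = 1 := by
  simp only [character, norm_prod, fourier_apply, Circle.norm_coe, Finset.prod_const_one]

theorem integrable_coeff (u : L2 L) (K : Wave) (i : Fin 3) :
    Integrable fun x => conj (character L K x) * ((u x i : ℝ) : ℂ) := by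
  have hu : Integrable (u : Torus L → R3) := (Lp.memLp u).integrable (by norm_num)
  have hi : Integrable fun x => ((u x i : ℝ) : ℂ) :=
    (ContinuousLinearMap.integrable_comp (EuclideanSpace.proj i : R3 →L[ℝ] ℝ) hu).ofReal
  refine hi.bdd_mul (c := 1) ?_ ?_
  · exact (Complex.continuous_conj.comp (continuous_character K)).aestronglyMeasurable
  · exact ae_of_all _ fun x => by simp [norm_character]

theorem coeff_add (u v : L2 L) (K : Wave) : coeff (u + v : L2 L) K = coeff u K + coeff v K := by
  ext i
  simp only [coeff, PiLp.add_apply]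
  rw [← mul_add, ← integral_add (integrable_coeff u K i) (integrable_coeff v K i)]
  congr 1
  refine integral_congr_ae ?_
  filter_upwards [Lp.coeFn_add u v] with x hx
  rw [hx]
  simp [mul_add]

theorem coeff_smul (r : ℝ) (u : L2 L) (K : Wave) :
    coeff (r • u : L2 L) K = (r : ℂ) • coeff u K := by
  ext i
  simp only [coeff, PiLp.smul_apply, smul_eq_mul]
  rw [mul_left_comm, ← integral_const_mul (r : ℂ)]
  congr 1
  refine integral_congr_ae ?_
  filter_upwards [Lp.coeFn_smul r u] with x hx
  rw [hx]
  simp only [Pi.smul_apply, PiLp.smul_apply, smul_eq_mul, Complex.ofReal_mul]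
  ring

theorem coeff_zero (K : Wave) : coeff ((0 : L2 L) : Torus L → R3) K = 0 := by
  have h := coeff_smul (0 : ℝ) (0 : L2 L) K
  simpa using h

theorem waveSq_nonneg (K : Wave) : 0 ≤ waveSq K := Finset.sum_nonneg fun _ _ => sq_nonneg _

variable (L) in
/-- The periodic Sobolev space `Ḣ^s(Ω)` of real vector fields of zero mean; `Ḣ⁰ = L̇²`. -/
def Hdot (s : ℕ) : Submodule ℝ (L2 L) where
  carrier := {u | coeff u 0 = 0 ∧ Summable fun K => (waveSq K / L ^ 2) ^ s * ‖coeff u K‖ ^ 2}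
  zero_mem' := ⟨coeff_zero 0, by
    have h : ∀ K, ‖coeff ((0 : L2 L) : Torus L → R3) K‖ = 0 := fun K => by
      rw [coeff_zero, norm_zero]
    simp only [h, ne_eq, OfNat.ofNat_ne_zero, not_false_eq_true, zero_pow, mul_zero]
    exact summable_zero⟩
  add_mem' := by
    rintro u v ⟨hu, hus⟩ ⟨hv, hvs⟩
    refine ⟨by rw [coeff_add, hu, hv, add_zero], ?_⟩
    refine Summable.of_nonneg_of_le (fun K => ?_) (fun K => ?_) ((hus.add hvs).mul_left 2)
    · have := waveSq_nonneg K; positivity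
    · have h0 : 0 ≤ (waveSq K / L ^ 2) ^ s := by have := waveSq_nonneg K; positivity
      rw [coeff_add]
      have h1 : ‖coeff u K + coeff v K‖ ^ 2 ≤ 2 * (‖coeff u K‖ ^ 2 + ‖coeff v K‖ ^ 2) := by
        have h2 := norm_add_le (coeff u K) (coeff v K)
        nlinarith [norm_nonneg (coeff u K + coeff v K), sq_nonneg (‖coeff u K‖ - ‖coeff v K‖)]
      nlinarith [mul_le_mul_of_nonneg_left h1 h0]
  smul_mem' := by
    rintro r u ⟨hu, hus⟩
    refine ⟨by rw [coeff_smul, hu, smul_zero], ?_⟩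
    refine (hus.mul_left (r ^ 2)).congr fun K => ?_
    rw [coeff_smul, norm_smul, mul_pow, Complex.norm_real, Real.norm_eq_abs, sq_abs]
    ring

variable (L) in
/-- The space `V̇_s` of divergence free fields in `Ḣ^s(Ω)`: `H = V̇₀`, `V = V̇₁`, `D(A) = V̇₂`. -/
def Vdot (s : ℕ) : Submodule ℝ (L2 L) where
  carrier := {u | u ∈ Hdot L s ∧ ∀ K, ∑ i, (K i : ℂ) * coeff u K i = 0}
  zero_mem' := ⟨zero_mem _, fun K => by
    rw [coeff_zero]
    simp⟩
  add_mem' := by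
    rintro u v ⟨hu, hud⟩ ⟨hv, hvd⟩
    refine ⟨add_mem hu hv, fun K => ?_⟩
    simp only [coeff_add, PiLp.add_apply, mul_add, Finset.sum_add_distrib, hud K, hvd K, add_zero]
  smul_mem' := by
    rintro r u ⟨hu, hud⟩
    refine ⟨Submodule.smul_mem _ r hu, fun K => ?_⟩
    simp only [coeff_smul, PiLp.smul_apply, smul_eq_mul, mul_left_comm _ (r : ℂ),
      ← Finset.mul_sum, hud K, mul_zero]

/-! ### The nonlinearity -/

/-- The Helmholtz-Leray projection `𝒫`, on Fourier coefficients: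
`a_K ↦ a_K - K (a_K · K)/|K|²` for `K ≠ 0`, and `a_0 ↦ 0`. -/
def leray (a : Wave → C3) (K : Wave) : C3 :=
  if K = 0 then 0
  else WithLp.toLp 2 fun i => a K i - (K i : ℂ) * (∑ j, a K j * (K j : ℂ)) / (waveSq K : ℂ)

/-- The vector field `(v·∇)u`. -/
def advect (v u : L2 L) (x : Torus L) : R3 := ∑ j, v x j • pderiv j u x

/-- `B(v,u) = 𝒫[(v·∇)u]`, as an element of `D(A)' = V̇₋₂`, that is, by its Fourier
coefficients. -/
def bilin (v u : L2 L) : Wave → C3 := leray (coeff (advect v u))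

/-! ### Solutions -/

/-- `u ∈ C([0,∞);V) ∩ L²_loc([0,∞);D(A))`, and `u' ∈ L²_loc([0,∞);H)` is its time
derivative. -/
structure IsRegular (u u' : ℝ → L2 L) : Prop where
  mem_V : ∀ t, 0 ≤ t → u t ∈ Vdot L 1
  continuous_V : ∀ t, 0 ≤ t → Tendsto (fun s => gradNorm (u s - u t)) (𝓝[Set.Ici 0] t) (𝓝 0)
  mem_DA : ∀ᵐ t ∂(volume.restrict (Set.Ici (0 : ℝ))), u t ∈ Vdot L 2
  memLp_stokes : ∀ T : ℝ, 0 < T →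
    MemLp (fun t => stokes (u t)) 2 (volume.restrict (Set.Icc 0 T))
  deriv_mem_H : ∀ᵐ t ∂(volume.restrict (Set.Ici (0 : ℝ))), u' t ∈ Vdot L 0
  memLp_deriv : ∀ T : ℝ, 0 < T → MemLp u' 2 (volume.restrict (Set.Icc 0 T))
  eq_integral : ∀ t, 0 ≤ t → u t = u 0 + ∫ s in (0 : ℝ)..t, u' s

/-- `u` is the global regular solution, with initial value `u₀`, of the modified Leray-`α` system
`dv/dt + νAv + B(v,u) = f`, `v = u + α²Au`.  This is an identity in `V̇₋₂` for almost every
`t ≥ 0`, that is, an identity of all Fourier coefficients; those of `dv/dt = (I + α²A) du/dt` are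
`(1 + α²λ_K)` times those of `du/dt`. -/
def IsMLSolution (ν α : ℝ) (f : ℝ → L2 L) (u₀ : L2 L) (u : ℝ → L2 L) : Prop :=
  u 0 = u₀ ∧ ∃ u' : ℝ → L2 L, IsRegular u u' ∧
    ∀ᵐ t ∂(volume.restrict (Set.Ici (0 : ℝ))), ∀ K,
      ((1 + α ^ 2 * eigen L K : ℝ) : ℂ) • coeff (u' t) K
        + ((ν * eigen L K : ℝ) : ℂ) • coeff (helmholtz α (u t)) K
        + bilin (helmholtz α (u t)) (u t) K
      = coeff (f t) K

/-- `w` is the global regular solution, with initial value `w₀`, of the data assimilation system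
`dz/dt + νAz + B(z,w) = f - η(I + β²A)𝒫(I_h w - I_h u)`, `z = w + β²Aw`, again as an identity in
`V̇₋₂` for almost every `t ≥ 0`. -/
def IsCDASolution (ν β η : ℝ) (Ih : Hdot L 2 →ₗ[ℝ] Hdot L 0) (f u : ℝ → L2 L) (w₀ : L2 L)
    (w : ℝ → L2 L) : Prop :=
  w 0 = w₀ ∧ ∃ w' : ℝ → L2 L, IsRegular w w' ∧
    ∀ᵐ t ∂(volume.restrict (Set.Ici (0 : ℝ))),
      ∃ (hw : w t ∈ Hdot L 2) (hu : u t ∈ Hdot L 2), ∀ K,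
        ((1 + β ^ 2 * eigen L K : ℝ) : ℂ) • coeff (w' t) K
          + ((ν * eigen L K : ℝ) : ℂ) • coeff (helmholtz β (w t)) K
          + bilin (helmholtz β (w t)) (w t) K
        = coeff (f t) K
          - ((η * (1 + β ^ 2 * eigen L K) : ℝ) : ℂ) •
            leray (coeff ((Ih ⟨w t, hw⟩ : L2 L) - (Ih ⟨u t, hu⟩ : L2 L) : L2 L)) K

/-- The approximation property
`|I_h g - g|² ≤ c₁²h²‖∇g‖²_{L²} + c₂²h⁴‖Δg‖²_{L²}` for all `g ∈ Ḣ²(Ω)`. -/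
def IsInterpolant (h c₁ c₂ : ℝ) (Ih : Hdot L 2 →ₗ[ℝ] Hdot L 0) : Prop :=
  ∀ g : Hdot L 2, ‖(Ih g : L2 L) - (g : L2 L)‖ ^ 2 ≤
    c₁ ^ 2 * h ^ 2 * gradNorm (g : L2 L) ^ 2 + c₂ ^ 2 * h ^ 4 * ‖stokes (g : L2 L)‖ ^ 2

/-! ### Constants -/

variable (L) in
/-- The three Gagliardo-Nirenberg inequalities with the constant `c` on the box of side `L`. -/
def GagliardoNirenberg (c : ℝ) : Prop :=
  (∀ g ∈ Vdot L 1, eLpNorm g 6 volume ≤ ENNReal.ofReal (c * gradNorm g)) ∧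
  (∀ g ∈ Vdot L 1, eLpNorm g 3 volume ≤ ENNReal.ofReal (c * √‖g‖ * √(gradNorm g))) ∧
  (∀ g ∈ Vdot L 2, eLpNorm g ∞ volume ≤ ENNReal.ofReal (c * √(gradNorm g) * √‖stokes g‖))

/-- `sup_{s ≥ 0} |f(s)|²`, the supremum being the essential one. -/
def supSq (f : ℝ → L2 L) : ℝ := (eLpNorm f ∞ (volume.restrict (Set.Ici (0 : ℝ)))).toReal ^ 2

/-- `M₁ = |u₀|² + α²‖u₀‖² + (λ₁²ν²)⁻¹ sup_{s ≥ 0} |f(s)|²`. -/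
def M1 (ν α : ℝ) (f : ℝ → L2 L) (u₀ : L2 L) : ℝ :=
  ‖u₀‖ ^ 2 + α ^ 2 * gradNorm u₀ ^ 2 + 1 / (lam1 L ^ 2 * ν ^ 2) * supSq f

/-- The constant `M_α`, as a function of `λ₁`, `M₁` and `S = sup_{s ≥ 0} |f(s)|²`. -/
def Malpha (c ν α β lam M S : ℝ) : ℝ :=
  5 * |β ^ 2 - α ^ 2| ^ 2 / β *
    (1 / (ν * β) * (6 * M / (ν * α ^ 2) + 6 / (ν ^ 3 * lam ^ 2 * α ^ 2) * S) *
        (ν ^ 2 + c ^ 2 * M / (16 * Real.pi ^ 4 * √lam * α ^ 2))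
      + 3 * c ^ 2 * M ^ 2 / (16 * ν ^ 2 * β * Real.pi ^ 4 * α ^ 6 * (lam * √lam))
      + 3 / (ν ^ 2 * lam * β) * S
      + ν / β * (M / (ν * α ^ 2) + 1 / (ν ^ 3 * α ^ 2 * lam ^ 2) * S)
      + c ^ 2 * M / (2 * ν * α ^ 2) *
        (M / (ν * α ^ 2) + 1 / (lam ^ 2 * ν ^ 3 * α ^ 2) * S))

end MLAlpha

end

open MLAlpha

noncomputable section

namespace MLAlpha

set_option linter.unusedSectionVars false

variable {L : ℝ} [Fact (0 < L)]

/-! ### Fourier series on the box -/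

/-! Write g = w - u, v = u + α²Au, z = w + β²Aw, and test both momentum equations with g. The part
B(z, g) contributes nothing, since ((z·∇)g, g) = 0 for divergence free z (`triForm_self_eq_zero`).
Since z - v = g + β²Ag + (β² - α²)Au, what remains is the viscosity ν(‖g‖² + β²|Ag|²), two trilinear
terms quadratic in g, the nudging, and three source terms that carry the factor β² - α² and
otherwise involve only u', Au and ∇u (`difference_balance`). Up to the interpolation error, the
nudging supplies -η(|g|² + β²‖g‖²). By the Sobolev, Agmon and Young inequalities, everything
containing g is absorbed into this and three quarters of the viscosity (`perturbation_le`); the last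
quarter and Poincaré's inequality give decay at rate νλ₁/2, with a forcing quadratic in |u'| and
|Au| (`difference_inequality`).

That forcing is controlled on time windows of length 1/(νλ₁) only. The energy of u bounds ∫|Au|²
there, and testing the equation of u with (I + α²A)⁻¹u' then bounds ∫|u'|²
(`leray_integral_sq_stokes_le`, `leray_integral_sq_deriv_le`). `gronwall_window` sums the
contributions of the windows as a geometric series of ratio e^{-1/2}, which produces e/(e^{1/2} -
1).

The analysis in space is carried out on Fourier coefficients. Sobolev's and Agmon's inequalities
rest on one lattice sum, `sum_lattice_le`. The cancellation is an antisymmetry of the triad sum,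
which tolerates z merely in L². The energy identity is summed from scalar identities for single
coefficients, which tolerates u' merely in H.

The constant c only has to be large: increasing it weakens the Gagliardo-Nirenberg inequalities,
strengthens hypotheses 1 and 2, and increases M_α. The value 1000 leaves ample room. -/

theorem side_pos : 0 < L := Fact.out

theorem character_neg (K : Wave) (x : Torus L) :
    character L (-K) x = conj (character L K x) := by
  simp only [character, Pi.neg_apply, fourier_neg, map_prod]

theorem character_add (K M : Wave) (x : Torus L) :
    character L (K + M) x = character L K x * character L M x := by
  simp only [character, Pi.add_apply, fourier_add, ← Finset.prod_mul_distrib]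

theorem character_zero (x : Torus L) : character L 0 x = 1 := by
  simp [character]

theorem integral_fourier_addCircle (n : ℤ) :
    ∫ x : AddCircle L, fourier n x = if n = 0 then (L : ℂ) else 0 := by
  split_ifs with h
  · subst h
    simp only [fourier_zero, integral_const]
    simp [Measure.real, AddCircle.measure_univ, (side_pos (L := L)).le]
  · have h1 := (orthonormal_iff_ite.mp (orthonormal_fourier (T := L))) 0 n
    rw [if_neg (Ne.symm h), ContinuousMap.inner_toLp] at h1
    have h2 : (volume : Measure (AddCircle L)) = ENNReal.ofReal L • AddCircle.haarAddCircle :=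
      AddCircle.volume_eq_smul_haarAddCircle
    rw [h2, integral_smul_measure]
    simp only [fourier_zero, map_one] at h1
    have h3 : ∫ x : AddCircle L, fourier n x ∂AddCircle.haarAddCircle = 0 := by
      simpa using h1
    rw [h3, smul_zero]

theorem integral_character (K : Wave) :
    ∫ x : Torus L, character L K x = if K = 0 then (L : ℂ) ^ 3 else 0 := by
  simp only [character]
  rw [integral_fintype_prod_volume_eq_prod (fun i (x : AddCircle L) => (fourier (K i) x : ℂ))]
  simp only [integral_fourier_addCircle]
  split_ifs with h
  · subst h
    simp
  · obtain ⟨i, hi⟩ := Function.ne_iff.mp h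
    exact Finset.prod_eq_zero (Finset.mem_univ i) (if_neg hi)

variable (L) in
/-- The characters as bundled continuous functions. -/
def characterMap (K : Wave) : C(Torus L, ℂ) := ⟨character L K, continuous_character K⟩

variable (L) in
/-- The star subalgebra of `C(Ω, ℂ)` generated by the characters. -/
def characterSubalgebra : StarSubalgebra ℂ C(Torus L, ℂ) where
  toSubalgebra := Algebra.adjoin ℂ (Set.range (characterMap L))
  star_mem' := by
    change Algebra.adjoin ℂ (Set.range (characterMap L)) ≤
      star (Algebra.adjoin ℂ (Set.range (characterMap L)))
    refine Algebra.adjoin_le ?_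
    rintro _ ⟨n, rfl⟩
    refine Algebra.subset_adjoin ⟨-n, ?_⟩
    ext1 x
    simp only [characterMap, ContinuousMap.coe_mk, character_neg, starRingEnd_apply,
      ContinuousMap.star_apply]

theorem characterSubalgebra_coe : (characterSubalgebra L).toSubalgebra.toSubmodule =
    Submodule.span ℂ (Set.range (characterMap L)) := by
  apply Algebra.adjoin_eq_span_of_subset
  refine .trans (fun x ↦ Submonoid.closure_induction (fun _ ↦ id) ⟨0, ?_⟩ ?_) Submodule.subset_span
  · ext z
    simp [characterMap, character_zero]
  · rintro _ _ _ _ ⟨m, rfl⟩ ⟨n, rfl⟩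
    refine ⟨m + n, ?_⟩
    ext z
    simp [characterMap, character_add]

theorem character_single (i : Fin 3) (x : Torus L) :
    character L (Pi.single i 1) x = fourier 1 (x i) := by
  rw [character, Finset.prod_eq_single i]
  · simp
  · intro j _ hj
    simp [Pi.single_eq_of_ne hj]
  · simp

theorem characterSubalgebra_separatesPoints : (characterSubalgebra L).SeparatesPoints := by
  intro x y hxy
  obtain ⟨i, hi⟩ := Function.ne_iff.mp hxy
  refine ⟨_, ⟨characterMap L (Pi.single i 1), Algebra.subset_adjoin ⟨Pi.single i 1, rfl⟩, rfl⟩, ?_⟩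
  change character L _ x ≠ character L _ y
  rw [character_single, character_single, fourier_one, fourier_one]
  exact fun h => hi (AddCircle.injective_toCircle side_pos.ne' (Circle.ext h))

/-- Stone-Weierstrass: the span of the characters is closed under products and conjugation and
separates points. -/
theorem span_character_closure_eq_top :
    (Submodule.span ℂ (Set.range (characterMap L))).topologicalClosure = ⊤ := by
  rw [← characterSubalgebra_coe]
  exact congr_arg (Subalgebra.toSubmodule <| StarSubalgebra.toSubalgebra ·)
    (ContinuousMap.starSubalgebra_topologicalClosure_eq_top_of_separatesPoints
      (characterSubalgebra L) characterSubalgebra_separatesPoints)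

variable (L) in
/-- The normalized characters in `L²(Ω; ℂ)`. -/
def characterLp (K : Wave) : Lp ℂ 2 (volume : Measure (Torus L)) :=
  ((√(L ^ 3))⁻¹ : ℂ) • ContinuousMap.toLp (E := ℂ) 2 volume ℂ (characterMap L K)

theorem sqrt_side_ne_zero : ((√(L ^ 3) : ℝ) : ℂ) ≠ 0 := by
  have : 0 < L := side_pos
  exact_mod_cast (by positivity : √(L ^ 3) ≠ 0)

theorem sqrt_side_sq : ((√(L ^ 3) : ℝ) : ℂ) * (√(L ^ 3) : ℝ) = (L : ℂ) ^ 3 := by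
  have : 0 < L := side_pos
  have h : √(L ^ 3) * √(L ^ 3) = L ^ 3 := Real.mul_self_sqrt (by positivity)
  exact_mod_cast h

theorem orthonormal_characterLp : Orthonormal ℂ (characterLp L) := by
  rw [orthonormal_iff_ite]
  intro m n
  simp only [characterLp, inner_smul_left, inner_smul_right, ContinuousMap.inner_toLp]
  have h : ∀ x : Torus L, characterMap L n x * conj (characterMap L m x) =
      character L (n - m) x := fun x => by
    simp only [characterMap, ContinuousMap.coe_mk]
    rw [← character_neg, ← character_add, sub_eq_add_neg]
  simp only [h, integral_character, sub_eq_zero]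
  have h0 := sqrt_side_ne_zero (L := L)
  have h1 := sqrt_side_sq (L := L)
  simp only [map_inv₀, Complex.conj_ofReal, eq_comm (a := n)]
  split_ifs
  · rw [← h1]; field_simp
  · simp

theorem span_characterLp_closure_eq_top :
    (Submodule.span ℂ (Set.range (characterLp L))).topologicalClosure = ⊤ := by
  have h1 : Submodule.span ℂ (Set.range (characterLp L)) = Submodule.span ℂ (Set.range fun K =>
      ContinuousMap.toLp (E := ℂ) 2 (volume : Measure (Torus L)) ℂ (characterMap L K)) := by
    have h0 := sqrt_side_ne_zero (L := L)
    apply le_antisymm <;> rw [Submodule.span_le] <;> rintro _ ⟨K, rfl⟩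
    · exact Submodule.smul_mem _ _ (Submodule.subset_span ⟨K, rfl⟩)
    · have : ContinuousMap.toLp (E := ℂ) 2 (volume : Measure (Torus L)) ℂ (characterMap L K) =
          ((√(L ^ 3) : ℝ) : ℂ) • characterLp L K := by
        rw [characterLp, smul_smul, mul_inv_cancel₀ h0, one_smul]
      simp only [SetLike.mem_coe]
      rw [this]
      exact Submodule.smul_mem _ _ (Submodule.subset_span ⟨K, rfl⟩)
  rw [h1]
  simpa only [Submodule.map_span, ContinuousLinearMap.coe_coe, ← Set.range_comp,
    Function.comp_def] using
    (ContinuousMap.toLp_denseRange ℂ (volume : Measure (Torus L)) ℂ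
      (by norm_num : (2 : ℝ≥0∞) ≠ ∞)).topologicalClosure_map_submodule
      span_character_closure_eq_top

variable (L) in
/-- The Fourier basis of `L²(Ω; ℂ)`. -/
def characterBasis : HilbertBasis Wave ℂ (Lp ℂ 2 (volume : Measure (Torus L))) :=
  HilbertBasis.mk orthonormal_characterLp span_characterLp_closure_eq_top.ge

/-- The Fourier coefficients of a scalar function. -/
def scalarCoeff (f : Torus L → ℂ) (K : Wave) : ℂ :=
  ((L : ℂ) ^ 3)⁻¹ * ∫ x, conj (character L K x) * f x

theorem scalarCoeff_congr {f g : Torus L → ℂ} (h : f =ᵐ[volume] g) (K : Wave) :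
    scalarCoeff f K = scalarCoeff g K := by
  unfold scalarCoeff
  congr 1
  refine integral_congr_ae ?_
  filter_upwards [h] with x hx
  rw [hx]

/-- The basis is normalized by L^{-3/2} and the Fourier coefficient by L⁻³, because the box has mass
L³ instead of 1; the factor √(L³) is the discrepancy. -/
theorem characterBasis_repr (f : Lp ℂ 2 (volume : Measure (Torus L))) (K : Wave) :
    (characterBasis L).repr f K = ((√(L ^ 3) : ℝ) : ℂ) * scalarCoeff f K := by
  rw [HilbertBasis.repr_apply_apply, characterBasis, HilbertBasis.coe_mk, characterLp,
    inner_smul_left, MeasureTheory.L2.inner_def, scalarCoeff, ← mul_assoc]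
  have h0 := sqrt_side_ne_zero (L := L)
  have h1 := sqrt_side_sq (L := L)
  congr 1
  · simp only [map_inv₀, Complex.conj_ofReal]
    rw [← h1]; field_simp
  · refine integral_congr_ae ?_
    filter_upwards [ContinuousMap.coeFn_toLp (p := 2) (𝕜 := ℂ) (volume : Measure (Torus L))
      (characterMap L K)] with x hx
    rw [hx, RCLike.inner_apply, mul_comm]
    rfl

theorem side_cube_ne_zero : (L : ℂ) ^ 3 ≠ 0 := by
  have : L ≠ 0 := side_pos.ne'
  exact pow_ne_zero _ (by exact_mod_cast this)

/-- **Parseval's identity** for scalar functions. -/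
theorem hasSum_scalarCoeff {f g : Torus L → ℂ} (hf : MemLp f 2 volume) (hg : MemLp g 2 volume) :
    HasSum (fun K => conj (scalarCoeff f K) * scalarCoeff g K)
      (((L : ℂ) ^ 3)⁻¹ * ∫ x, conj (f x) * g x) := by
  have h := (characterBasis L).hasSum_inner_mul_inner (hf.toLp f) (hg.toLp g)
  have h0 := sqrt_side_ne_zero (L := L)
  have h1 := sqrt_side_sq (L := L)
  have h2 := side_cube_ne_zero (L := L)
  have e1 : inner ℂ (hf.toLp f) (hg.toLp g) = ∫ x, conj (f x) * g x := by
    rw [MeasureTheory.L2.inner_def]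
    refine integral_congr_ae ?_
    filter_upwards [hf.coeFn_toLp, hg.coeFn_toLp] with x hx hx'
    rw [hx, hx', RCLike.inner_apply, mul_comm]
  rw [e1] at h
  refine (h.mul_left ((L : ℂ) ^ 3)⁻¹).congr_fun fun K => ?_
  rw [← inner_conj_symm, ← HilbertBasis.repr_apply_apply, ← HilbertBasis.repr_apply_apply,
    characterBasis_repr, characterBasis_repr, scalarCoeff_congr hf.coeFn_toLp,
    scalarCoeff_congr hg.coeFn_toLp, map_mul, Complex.conj_ofReal]
  rw [eq_comm, inv_mul_eq_iff_eq_mul₀ h2, ← h1]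
  ring

/-- The **Riesz-Fischer theorem** for scalar functions. -/
theorem exists_scalarCoeff_eq {a : Wave → ℂ} (ha : Summable fun K => ‖a K‖ ^ 2) :
    ∃ f : Torus L → ℂ, MemLp f 2 volume ∧ ∀ K, scalarCoeff f K = a K := by
  have h0 := sqrt_side_ne_zero (L := L)
  have hm : Memℓp (fun K => ((√(L ^ 3) : ℝ) : ℂ) * a K) 2 := by
    refine memℓp_gen ?_
    simp only [norm_mul, ENNReal.toReal_ofNat, Real.rpow_ofNat, mul_pow]
    exact ha.mul_left _
  let f := (characterBasis L).repr.symm ⟨_, hm⟩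
  refine ⟨f, Lp.memLp f, fun K => ?_⟩
  have h := characterBasis_repr f K
  simp only [f, LinearIsometryEquiv.apply_symm_apply] at h
  exact (mul_left_cancel₀ h0 h).symm

/-! ### Fourier coefficients of real vector fields -/

theorem coeff_apply (F : Torus L → R3) (K : Wave) (i : Fin 3) :
    coeff F K i = scalarCoeff (fun x => ((F x i : ℝ) : ℂ)) K := rfl

theorem coeff_congr {F G : Torus L → R3} (h : F =ᵐ[volume] G) (K : Wave) :
    coeff F K = coeff G K := by
  ext i
  rw [coeff_apply, coeff_apply]
  refine scalarCoeff_congr ?_ K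
  filter_upwards [h] with x hx
  rw [hx]

theorem memLp_component (u : L2 L) (i : Fin 3) :
    MemLp (fun x => ((u x i : ℝ) : ℂ)) 2 volume :=
  (ContinuousLinearMap.comp_memLp' (EuclideanSpace.proj i : R3 →L[ℝ] ℝ) (Lp.memLp u)).ofReal

/-- **Parseval's identity** for vector fields. -/
theorem hasSum_inner_coeff (u v : L2 L) :
    HasSum (fun K => inner ℂ (coeff u K) (coeff v K))
      (((L ^ 3)⁻¹ * inner ℝ u v : ℝ) : ℂ) := by
  have h := hasSum_sum fun i (_ : i ∈ Finset.univ) =>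
    hasSum_scalarCoeff (memLp_component u i) (memLp_component v i)
  have e : ∑ i, ((L : ℂ) ^ 3)⁻¹ * ∫ x, conj ((u x i : ℝ) : ℂ) * ((v x i : ℝ) : ℂ) =
      (((L ^ 3)⁻¹ * inner ℝ u v : ℝ) : ℂ) := by
    rw [← Finset.mul_sum, ← integral_finsetSum]
    · rw [MeasureTheory.L2.inner_def, Complex.ofReal_mul, ← integral_complex_ofReal]
      push_cast
      congr 1
      refine integral_congr_ae (ae_of_all _ fun x => ?_)
      simp only [PiLp.inner_apply, Complex.conj_ofReal]
      push_cast
      refine Finset.sum_congr rfl fun i _ => ?_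
      simp [mul_comm]
    · intro i _
      exact (memLp_component u i).star.integrable_mul (memLp_component v i)
  rw [e] at h
  refine h.congr_fun fun K => ?_
  simp only [PiLp.inner_apply, RCLike.inner_apply, coeff_apply]
  exact Finset.sum_congr rfl fun i _ => mul_comm _ _

theorem hasSum_re_inner_coeff (u v : L2 L) :
    HasSum (fun K => (inner ℂ (coeff u K) (coeff v K)).re) ((L ^ 3)⁻¹ * inner ℝ u v) := by
  have h := Complex.hasSum_re (hasSum_inner_coeff u v)
  rwa [Complex.ofReal_re] at h

theorem hasSum_norm_coeff (u : L2 L) :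
    HasSum (fun K => ‖coeff u K‖ ^ 2) ((L ^ 3)⁻¹ * ‖u‖ ^ 2) := by
  have h := hasSum_re_inner_coeff u u
  rw [real_inner_self_eq_norm_sq] at h
  refine h.congr_fun fun K => ?_
  rw [inner_self_eq_norm_sq_to_K]
  norm_cast

theorem cube_pos : 0 < L ^ 3 := by
  have : 0 < L := side_pos
  positivity

theorem coeff_neg_apply (F : Torus L → R3) (K : Wave) (i : Fin 3) :
    coeff F (-K) i = conj (coeff F K i) := by
  simp only [coeff_apply, scalarCoeff, map_mul, map_inv₀, map_pow, Complex.conj_ofReal]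
  congr 1
  rw [← integral_conj]
  refine integral_congr_ae (ae_of_all _ fun x => ?_)
  simp [character_neg]

theorem coeff_sub (u v : L2 L) (K : Wave) : coeff (u - v : L2 L) K = coeff u K - coeff v K := by
  rw [sub_eq_add_neg, coeff_add, ← neg_one_smul ℝ v, coeff_smul]
  simp [sub_eq_add_neg]

theorem eq_of_coeff_eq {u v : L2 L} (h : ∀ K, coeff u K = coeff v K) : u = v := by
  have h1 := hasSum_norm_coeff (u - v)
  have h2 : ∀ K, ‖coeff (u - v : L2 L) K‖ ^ 2 = 0 := fun K => by
    rw [coeff_sub, h, sub_self, norm_zero, zero_pow two_ne_zero]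
  simp only [h2] at h1
  have h3 := h1.unique hasSum_zero
  have h4 := (cube_pos (L := L)).ne'
  rcases mul_eq_zero.mp h3 with h5 | h5
  · exact absurd (inv_eq_zero.mp h5) h4
  · exact sub_eq_zero.mp (norm_eq_zero.mp (pow_eq_zero_iff two_ne_zero |>.mp h5))

/-- Used to make real fields out of complex ones: if the coefficients already satisfy the reality
condition, the average on the right changes nothing, so the real part can replace the function. -/
theorem scalarCoeff_ofReal_re {f : Torus L → ℂ} (hf : MemLp f 2 volume) (K : Wave) :
    scalarCoeff (fun x => (((f x).re : ℝ) : ℂ)) K =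
      (scalarCoeff f K + conj (scalarCoeff f (-K))) / 2 := by
  have hb : ∀ g : Torus L → ℂ, MemLp g 2 volume →
      Integrable fun x => conj (character L K x) * g x := by
    intro g hg
    refine (hg.integrable (by norm_num)).bdd_mul (c := 1) ?_ ?_
    · exact (Complex.continuous_conj.comp (continuous_character K)).aestronglyMeasurable
    · exact ae_of_all _ fun x => by simp [norm_character]
  have e : conj (scalarCoeff f (-K)) =
      ((L : ℂ) ^ 3)⁻¹ * ∫ x, conj (character L K x) * conj (f x) := by
    simp only [scalarCoeff, map_mul, map_inv₀, map_pow, Complex.conj_ofReal]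
    congr 1
    rw [← integral_conj]
    refine integral_congr_ae (ae_of_all _ fun x => ?_)
    simp [character_neg]
  rw [e]
  simp only [scalarCoeff]
  rw [← mul_add, ← integral_add (hb f hf)
    (show Integrable (fun x => conj (character L K x) * conj (f x)) volume from hb _ hf.star), mul_div_assoc, ← integral_div]
  congr 1
  refine integral_congr_ae (ae_of_all _ fun x => ?_)
  simp only [Complex.re_eq_add_conj]
  ring

/-- The **Riesz-Fischer theorem** for real vector fields. -/
theorem exists_coeff_eq {a : Wave → C3} (hs : Summable fun K => ‖a K‖ ^ 2)
    (ha : ∀ K i, a (-K) i = conj (a K i)) : ∃ u : L2 L, ∀ K, coeff u K = a K := by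
  have hsi : ∀ i, Summable fun K => ‖a K i‖ ^ 2 := fun i =>
    Summable.of_nonneg_of_le (fun K => by positivity)
      (fun K => by gcongr; exact PiLp.norm_apply_le (a K) i) hs
  choose f hf hfa using fun i => exists_scalarCoeff_eq (L := L) (hsi i)
  let F : Torus L → R3 := fun x => WithLp.toLp 2 fun i => (f i x).re
  have hF : MemLp F 2 volume := by
    refine MemLp.of_eval_piLp fun i => ?_
    simpa [F] using (hf i).re
  refine ⟨hF.toLp F, fun K => ?_⟩
  rw [coeff_congr hF.coeFn_toLp]
  ext i
  rw [coeff_apply]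
  simp only [F]
  rw [scalarCoeff_ofReal_re (hf i), hfa, hfa, ha]
  simp

/-- Square summability together with the reality condition keeps `ofCoeff` away from its default
value 0. All later identities for `stokes` and `pderiv` need this, hence their Sobolev hypotheses.
-/
theorem coeff_ofCoeff {a : Wave → C3} (hs : Summable fun K => ‖a K‖ ^ 2)
    (ha : ∀ K i, a (-K) i = conj (a K i)) (K : Wave) : coeff (ofCoeff a : L2 L) K = a K := by
  have h := exists_coeff_eq (L := L) hs ha
  rw [ofCoeff, dif_pos h]
  exact h.choose_spec K

theorem coeff_multiplier {m : Wave → ℂ} {u : L2 L} (hm : ∀ K, m (-K) = conj (m K))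
    (hs : Summable fun K => ‖m K‖ ^ 2 * ‖coeff u K‖ ^ 2) (K : Wave) :
    coeff (ofCoeff fun K => m K • coeff u K : L2 L) K = m K • coeff u K := by
  refine coeff_ofCoeff ?_ ?_ K
  · simpa only [norm_smul, mul_pow] using hs
  · intro K i
    simp only [PiLp.smul_apply, smul_eq_mul, map_mul, coeff_neg_apply, hm]

/-! ### Eigenvalues, the Sobolev scale and Poincaré inequalities. -/

theorem waveSq_neg (K : Wave) : waveSq (-K) = waveSq K := by
  simp [waveSq]

theorem one_le_waveSq {K : Wave} (h : K ≠ 0) : 1 ≤ waveSq K := by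
  obtain ⟨i, hi⟩ := Function.ne_iff.mp h
  have h1 : (K i : ℝ) ^ 2 ≤ waveSq K :=
    Finset.single_le_sum (f := fun i => (K i : ℝ) ^ 2) (fun _ _ => sq_nonneg _)
      (Finset.mem_univ i)
  have h2 : (1 : ℤ) ≤ K i ^ 2 := by
    have hi' : K i ≠ 0 := hi
    have h : 0 < K i ^ 2 := by positivity
    omega
  have h3 : (1 : ℝ) ≤ (K i : ℝ) ^ 2 := by exact_mod_cast h2
  exact h3.trans h1

theorem lam1_pos : 0 < lam1 L := by
  have : 0 < L := side_pos
  have := Real.pi_pos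
  unfold lam1
  positivity

theorem eigen_eq (K : Wave) : eigen L K = lam1 L * waveSq K := by
  unfold eigen lam1
  ring

theorem eigen_nonneg (K : Wave) : 0 ≤ eigen L K := by
  rw [eigen_eq]
  exact mul_nonneg lam1_pos.le (waveSq_nonneg K)

theorem eigen_neg (K : Wave) : eigen L (-K) = eigen L K := by
  rw [eigen_eq, eigen_eq, waveSq_neg]

theorem lam1_le_eigen {K : Wave} (h : K ≠ 0) : lam1 L ≤ eigen L K := by
  rw [eigen_eq]
  nlinarith [one_le_waveSq h, lam1_pos (L := L)]

theorem summable_eigen {s : ℕ} {u : L2 L} (hu : u ∈ Hdot L s) :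
    Summable fun K => eigen L K ^ s * ‖coeff u K‖ ^ 2 := by
  refine (hu.2.mul_left ((4 * Real.pi ^ 2) ^ s)).congr fun K => ?_
  rw [← mul_assoc, ← mul_pow]
  congr 2
  unfold eigen
  ring

theorem mem_Hdot_of_summable {s : ℕ} {u : L2 L} (h0 : coeff u 0 = 0)
    (h : Summable fun K => eigen L K ^ s * ‖coeff u K‖ ^ 2) : u ∈ Hdot L s := by
  refine ⟨h0, (h.mul_left (((4 * Real.pi ^ 2)⁻¹) ^ s)).congr fun K => ?_⟩
  rw [← mul_assoc, ← mul_pow]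
  congr 2
  have := Real.pi_pos
  unfold eigen
  field_simp

theorem Hdot_mono {s t : ℕ} (hst : s ≤ t) {u : L2 L} (hu : u ∈ Hdot L t) : u ∈ Hdot L s := by
  refine mem_Hdot_of_summable hu.1 ?_
  refine Summable.of_nonneg_of_le (fun K => ?_) (fun K => ?_)
    ((summable_eigen hu).mul_left ((lam1 L ^ (t - s))⁻¹))
  · have := eigen_nonneg (L := L) K
    positivity
  · by_cases hK : K = 0
    · subst hK
      simp [hu.1]
    · have h1 := lam1_le_eigen (L := L) hK
      have h2 := lam1_pos (L := L)
      rw [← mul_assoc]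
      gcongr
      rw [← Nat.sub_add_cancel hst, pow_add, Nat.add_sub_cancel, ← mul_assoc]
      have h3 : 0 ≤ eigen L K := eigen_nonneg K
      refine le_mul_of_one_le_left (by positivity) ?_
      rw [inv_mul_eq_div, one_le_div (by positivity)]
      gcongr

theorem Vdot_mono {s t : ℕ} (hst : s ≤ t) {u : L2 L} (hu : u ∈ Vdot L t) : u ∈ Vdot L s :=
  ⟨Hdot_mono hst hu.1, hu.2⟩

theorem coeff_stokes {u : L2 L} (hu : u ∈ Hdot L 2) (K : Wave) :
    coeff (stokes u) K = (eigen L K : ℂ) • coeff u K := by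
  refine coeff_multiplier (fun K => ?_) ?_ K
  · rw [eigen_neg, Complex.conj_ofReal]
  · refine (summable_eigen hu).congr fun K => ?_
    rw [Complex.norm_real, Real.norm_eq_abs, sq_abs]

theorem norm_wave_symbol_sq (j : Fin 3) (K : Wave) :
    ‖2 * Real.pi * Complex.I * (K j : ℂ) / (L : ℂ)‖ ^ 2 =
      4 * Real.pi ^ 2 * (K j : ℝ) ^ 2 / L ^ 2 := by
  have h : (K j : ℂ) = ((K j : ℝ) : ℂ) := by simp
  rw [h]
  simp only [norm_div, norm_mul, Complex.norm_real, Complex.norm_I, Complex.norm_ofNat,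
    Real.norm_eq_abs, div_pow, mul_pow, sq_abs]
  ring

theorem sum_norm_wave_symbol_sq (K : Wave) :
    ∑ j, ‖2 * Real.pi * Complex.I * (K j : ℂ) / (L : ℂ)‖ ^ 2 = eigen L K := by
  simp only [norm_wave_symbol_sq, eigen, waveSq, Finset.mul_sum, Finset.sum_div]

theorem coeff_pderiv {u : L2 L} (hu : u ∈ Hdot L 1) (j : Fin 3) (K : Wave) :
    coeff (pderiv j u) K = (2 * Real.pi * Complex.I * (K j : ℂ) / (L : ℂ)) • coeff u K := by
  refine coeff_multiplier (fun K => ?_) ?_ K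
  · simp only [Pi.neg_apply, map_div₀, map_mul, Complex.conj_ofReal, Complex.conj_I,
      Complex.conj_ofNat, map_intCast]
    push_cast
    ring
  · refine Summable.of_nonneg_of_le (fun K => by positivity) (fun K => ?_) (summable_eigen hu)
    rw [pow_one, ← sum_norm_wave_symbol_sq]
    gcongr
    exact Finset.single_le_sum
      (f := fun j => ‖2 * Real.pi * Complex.I * (K j : ℂ) / (L : ℂ)‖ ^ 2)
      (fun _ _ => sq_nonneg _) (Finset.mem_univ j)

theorem gradNorm_nonneg (u : L2 L) : 0 ≤ gradNorm u := Real.sqrt_nonneg _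

theorem gradNorm_sq (u : L2 L) : gradNorm u ^ 2 = ∑ j, ‖pderiv j u‖ ^ 2 :=
  Real.sq_sqrt (Finset.sum_nonneg fun _ _ => sq_nonneg _)

theorem hasSum_gradNorm {u : L2 L} (hu : u ∈ Hdot L 1) :
    HasSum (fun K => eigen L K * ‖coeff u K‖ ^ 2) ((L ^ 3)⁻¹ * gradNorm u ^ 2) := by
  rw [gradNorm_sq, Finset.mul_sum]
  refine (hasSum_sum fun j (_ : j ∈ Finset.univ) => hasSum_norm_coeff (pderiv j u)).congr_fun
    fun K => ?_
  simp only [coeff_pderiv hu, norm_smul, mul_pow, ← Finset.sum_mul, sum_norm_wave_symbol_sq]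

theorem hasSum_stokes {u : L2 L} (hu : u ∈ Hdot L 2) :
    HasSum (fun K => eigen L K ^ 2 * ‖coeff u K‖ ^ 2) ((L ^ 3)⁻¹ * ‖stokes u‖ ^ 2) := by
  refine (hasSum_norm_coeff (stokes u)).congr_fun fun K => ?_
  rw [coeff_stokes hu, norm_smul, mul_pow, Complex.norm_real, Real.norm_eq_abs, sq_abs]

theorem inner_stokes_self {u : L2 L} (hu : u ∈ Hdot L 2) :
    inner ℝ (stokes u) u = gradNorm u ^ 2 := by
  have h1 := hasSum_re_inner_coeff (stokes u) u
  have h2 := hasSum_gradNorm (Hdot_mono one_le_two hu)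
  have h3 : ∀ K, (inner ℂ (coeff (stokes u) K) (coeff u K)).re =
      eigen L K * ‖coeff u K‖ ^ 2 := fun K => by
    rw [coeff_stokes hu, inner_smul_left, Complex.conj_ofReal, inner_self_eq_norm_sq_to_K]
    rw [← Complex.ofReal_re (eigen L K * ‖coeff u K‖ ^ 2)]
    push_cast
    rfl
  simp only [h3] at h1
  have := (cube_pos (L := L)).ne'
  exact mul_left_cancel₀ (inv_ne_zero this) (h1.unique h2)

theorem stokes_sub {u v : L2 L} (hu : u ∈ Hdot L 2) (hv : v ∈ Hdot L 2) :
    stokes (u - v) = stokes u - stokes v := by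
  refine eq_of_coeff_eq fun K => ?_
  rw [coeff_stokes (sub_mem hu hv), coeff_sub, coeff_sub, coeff_stokes hu, coeff_stokes hv,
    smul_sub]

theorem pderiv_sub {u v : L2 L} (hu : u ∈ Hdot L 1) (hv : v ∈ Hdot L 1) (j : Fin 3) :
    pderiv j (u - v) = pderiv j u - pderiv j v := by
  refine eq_of_coeff_eq fun K => ?_
  rw [coeff_pderiv (sub_mem hu hv), coeff_sub, coeff_sub, coeff_pderiv hu, coeff_pderiv hv,
    smul_sub]

/-- Poincaré's inequality, mode by mode: K = 0 is the only mode with eigenvalue below λ₁, and zero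
mean removes it. -/
theorem lam1_mul_sq_norm_le {u : L2 L} (hu : u ∈ Hdot L 1) :
    lam1 L * ‖u‖ ^ 2 ≤ gradNorm u ^ 2 := by
  have h1 := (hasSum_norm_coeff u).mul_left (lam1 L)
  have h2 := hasSum_gradNorm hu
  have h3 := hasSum_le (fun K => ?_) h1 h2
  · have h4 := cube_pos (L := L)
    rw [mul_left_comm] at h3
    exact le_of_mul_le_mul_left h3 (inv_pos.mpr h4)
  · by_cases hK : K = 0
    · subst hK
      simp [hu.1]
    · gcongr
      exact lam1_le_eigen (L := L) hK

theorem lam1_mul_sq_gradNorm_le {u : L2 L} (hu : u ∈ Hdot L 2) :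
    lam1 L * gradNorm u ^ 2 ≤ ‖stokes u‖ ^ 2 := by
  have h1 := (hasSum_gradNorm (Hdot_mono one_le_two hu)).mul_left (lam1 L)
  have h2 := hasSum_stokes hu
  have h3 := hasSum_le (fun K => ?_) h1 h2
  · have h4 := cube_pos (L := L)
    rw [mul_left_comm] at h3
    exact le_of_mul_le_mul_left h3 (inv_pos.mpr h4)
  · by_cases hK : K = 0
    · subst hK
      simp [hu.1]
    · rw [← mul_assoc]
      have h4 := eigen_nonneg (L := L) K
      have h5 := lam1_le_eigen (L := L) hK
      gcongr
      nlinarith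

/-! ### Lattice sums -/

/-- The largest absolute value of a component of a wave vector. -/
def waveSup (K : Wave) : ℕ := Finset.univ.sup fun i => (K i).natAbs

theorem waveSup_le_iff {K : Wave} {n : ℕ} : waveSup K ≤ n ↔ ∀ i, (K i).natAbs ≤ n := by
  simp [waveSup]

theorem waveSup_sq_le (K : Wave) : (waveSup K : ℝ) ^ 2 ≤ waveSq K := by
  obtain ⟨i, -, hi⟩ := Finset.exists_mem_eq_sup Finset.univ Finset.univ_nonempty
    fun i => (K i).natAbs
  have h1 : (K i : ℝ) ^ 2 ≤ waveSq K :=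
    Finset.single_le_sum (f := fun i => (K i : ℝ) ^ 2) (fun _ _ => sq_nonneg _)
      (Finset.mem_univ i)
  rw [waveSup, hi, Nat.cast_natAbs, Int.cast_abs, sq_abs]
  exact h1

theorem waveSup_pos {K : Wave} (h : K ≠ 0) : 1 ≤ waveSup K := by
  by_contra h1
  have h2 : waveSup K ≤ 0 := by omega
  rw [waveSup_le_iff] at h2
  refine h (funext fun i => ?_)
  have := h2 i
  simpa using this

/-- The shell is the difference of two lattice cubes, with (2n+1)³ - (2n-1)³ = 24n² + 2 points. -/
theorem card_waveSup_le (F : Finset Wave) {n : ℕ} (hn : 1 ≤ n) :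
    ((F.filter fun K => waveSup K = n).card : ℝ) ≤ 26 * (n : ℝ) ^ 2 := by
  obtain ⟨m, rfl⟩ : ∃ m, n = m + 1 := ⟨n - 1, by omega⟩
  let B : ℕ → Finset Wave := fun k => Fintype.piFinset fun _ => Finset.Icc (-(k : ℤ)) k
  have hB : ∀ k, (B k).card = (2 * k + 1) ^ 3 := fun k => by
    simp only [B, Fintype.card_piFinset, Int.card_Icc, Finset.prod_const, Finset.card_univ,
      Fintype.card_fin]
    congr 1
    omega
  have hmem : ∀ k K, K ∈ B k ↔ waveSup K ≤ k := fun k K => by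
    simp only [B, Fintype.mem_piFinset, Finset.mem_Icc, waveSup_le_iff]
    exact forall_congr' fun i => by omega
  have hsub : (F.filter fun K => waveSup K = m + 1) ⊆ B (m + 1) \ B m := by
    intro K hK
    rw [Finset.mem_filter] at hK
    rw [Finset.mem_sdiff, hmem, hmem]
    omega
  have hsub' : B m ⊆ B (m + 1) := fun K hK => by
    rw [hmem] at hK ⊢
    omega
  have h1 := Finset.card_le_card hsub
  rw [Finset.card_sdiff_of_subset hsub', hB, hB] at h1
  have h2 : (2 * (m + 1) + 1) ^ 3 - (2 * m + 1) ^ 3 ≤ 26 * (m + 1) ^ 2 := by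
    rw [Nat.sub_le_iff_le_add]
    nlinarith
  exact_mod_cast h1.trans h2

/-- Telescoping: (s+n)(s+n+1) ≤ (s+n+1)² ≤ 2(s² + (n+1)²), so each summand is at most twice the
difference of 1/(s+n) and 1/(s+n+1). -/
theorem sum_inv_add_sq_le {s : ℝ} (hs : 0 < s) (N : ℕ) :
    ∑ n ∈ Finset.range N, 1 / (s ^ 2 + ((n : ℝ) + 1) ^ 2) ≤ 2 / s - 2 / (s + N) := by
  induction N with
  | zero => simp
  | succ N ih =>
    rw [Finset.sum_range_succ]
    have hN : (0 : ℝ) ≤ N := Nat.cast_nonneg N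
    have h1 : 1 / (s ^ 2 + ((N : ℝ) + 1) ^ 2) ≤ 2 / (s + N) - 2 / (s + ((N + 1 : ℕ) : ℝ)) := by
      push_cast
      rw [div_sub_div _ _ (by positivity) (by positivity), div_le_div_iff₀ (by positivity)
        (by positivity)]
      nlinarith [sq_nonneg (s - (N + 1))]
    linarith

/-- Summed over cubic shells: the at most 26n² points of the n-th shell cancel the factor |K|² ≥ n²,
which leaves the one-dimensional sum of 1/(m + n²), of order 1/√m. -/
theorem sum_lattice_le {m : ℝ} (hm : 0 < m) (F : Finset Wave) (hF : ∀ K ∈ F, K ≠ 0) :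
    ∑ K ∈ F, 1 / (waveSq K * (m + waveSq K)) ≤ 52 / √m := by
  have hs : 0 < √m := Real.sqrt_pos.mpr hm
  have hss : √m ^ 2 = m := Real.sq_sqrt hm.le
  set N := F.sup waveSup
  have hmaps : ∀ K ∈ F, waveSup K - 1 ∈ Finset.range N := fun K hK => by
    have h1 := waveSup_pos (hF K hK)
    have h2 : waveSup K ≤ N := Finset.le_sup hK
    rw [Finset.mem_range]
    omega
  rw [← Finset.sum_fiberwise_of_maps_to hmaps]
  calc ∑ n ∈ Finset.range N, ∑ K ∈ F with waveSup K - 1 = n, 1 / (waveSq K * (m + waveSq K))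
      ≤ ∑ n ∈ Finset.range N, 26 * (1 / (√m ^ 2 + ((n : ℝ) + 1) ^ 2)) := by
        refine Finset.sum_le_sum fun n _ => ?_
        have he : (F.filter fun K => waveSup K - 1 = n) = F.filter fun K => waveSup K = n + 1 := by
          refine Finset.filter_congr fun K hK => ?_
          have := waveSup_pos (hF K hK)
          omega
        rw [he]
        have hb : ∀ K ∈ F.filter fun K => waveSup K = n + 1, 1 / (waveSq K * (m + waveSq K)) ≤
            1 / (((n : ℝ) + 1) ^ 2 * (√m ^ 2 + ((n : ℝ) + 1) ^ 2)) := fun K hK => by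
          have h1 := waveSup_sq_le K
          rw [(Finset.mem_filter.mp hK).2] at h1
          push_cast at h1
          rw [hss]
          have h2 := waveSq_nonneg K
          gcongr
        refine (Finset.sum_le_card_nsmul _ _ _ hb).trans ?_
        rw [nsmul_eq_mul]
        have hc := card_waveSup_le F (n := n + 1) (by omega)
        push_cast at hc
        calc _ ≤ 26 * ((n : ℝ) + 1) ^ 2 *
              (1 / (((n : ℝ) + 1) ^ 2 * (√m ^ 2 + ((n : ℝ) + 1) ^ 2))) := by gcongr
          _ = _ := by field_simp
    _ ≤ 26 * (2 / √m - 2 / (√m + N)) := by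
        rw [← Finset.mul_sum]
        gcongr
        exact sum_inv_add_sq_le hs N
    _ ≤ 52 / √m := by
        have h1 : 0 ≤ 2 / (√m + N) := by positivity
        have h2 : 26 * (2 / √m) = 52 / √m := by ring
        linarith

/-- A weighted Cauchy-Schwarz inequality for sums over nonzero wave vectors. -/
theorem sum_norm_le_lattice {m : ℝ} (hm : 0 < m) (F : Finset Wave) (a : Wave → ℝ)
    (ha : a 0 = 0) :
    (∑ K ∈ F, |a K|) ^ 2 ≤ 52 / √m * ∑ K ∈ F, waveSq K * (m + waveSq K) * a K ^ 2 := by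
  classical
  have h1 : ∀ f : Wave → ℝ, f 0 = 0 → ∑ K ∈ F, f K = ∑ K ∈ F.filter (· ≠ 0), f K := fun f hf => by
    rw [Finset.sum_filter]
    refine Finset.sum_congr rfl fun K _ => ?_
    split_ifs with h
    · rfl
    · rw [not_not.mp h, hf]
  rw [h1 (fun K => |a K|) (by simp [ha]),
    h1 (fun K => waveSq K * (m + waveSq K) * a K ^ 2) (by simp [ha])]
  have hK : ∀ K ∈ F.filter (· ≠ 0), K ≠ 0 := fun K hK => (Finset.mem_filter.mp hK).2
  have h2 := sum_lattice_le hm (F.filter (· ≠ 0)) hK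
  have h3 : ∀ K ∈ F.filter (· ≠ 0), 0 < waveSq K * (m + waveSq K) := fun K h => by
    have := one_le_waveSq (hK K h)
    positivity
  have h4 := Finset.sum_mul_sq_le_sq_mul_sq (F.filter (· ≠ 0))
    (fun K => (√(waveSq K * (m + waveSq K)))⁻¹)
    (fun K => √(waveSq K * (m + waveSq K)) * |a K|)
  have e1 : ∑ K ∈ F.filter (· ≠ 0), (√(waveSq K * (m + waveSq K)))⁻¹ *
      (√(waveSq K * (m + waveSq K)) * |a K|) = ∑ K ∈ F.filter (· ≠ 0), |a K| := by
    refine Finset.sum_congr rfl fun K h => ?_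
    have := Real.sqrt_pos.mpr (h3 K h)
    field_simp
  have e2 : ∑ K ∈ F.filter (· ≠ 0), (√(waveSq K * (m + waveSq K)))⁻¹ ^ 2 =
      ∑ K ∈ F.filter (· ≠ 0), 1 / (waveSq K * (m + waveSq K)) := by
    refine Finset.sum_congr rfl fun K h => ?_
    rw [inv_pow, Real.sq_sqrt (h3 K h).le, one_div]
  have e3 : ∑ K ∈ F.filter (· ≠ 0), (√(waveSq K * (m + waveSq K)) * |a K|) ^ 2 =
      ∑ K ∈ F.filter (· ≠ 0), waveSq K * (m + waveSq K) * a K ^ 2 := by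
    refine Finset.sum_congr rfl fun K h => ?_
    rw [mul_pow, Real.sq_sqrt (h3 K h).le, sq_abs]
  rw [e1, e2, e3] at h4
  refine h4.trans ?_
  gcongr
  exact Finset.sum_nonneg fun K h => by have := h3 K h; positivity

/-! ### Absolutely convergent Fourier series -/

theorem hasSum_norm_scalarCoeff {f : Torus L → ℂ} (hf : MemLp f 2 volume) :
    HasSum (fun K => ‖scalarCoeff f K‖ ^ 2) ((L ^ 3)⁻¹ * ∫ x, ‖f x‖ ^ 2) := by
  have h := Complex.hasSum_re (hasSum_scalarCoeff hf hf)
  have e : ((L : ℂ) ^ 3)⁻¹ * ∫ x, conj (f x) * f x =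
      (((L ^ 3)⁻¹ * ∫ x, ‖f x‖ ^ 2 : ℝ) : ℂ) := by
    rw [Complex.ofReal_mul, ← integral_complex_ofReal]
    push_cast
    congr 1
    refine integral_congr_ae (ae_of_all _ fun x => ?_)
    simp [Complex.conj_mul']
  rw [e, Complex.ofReal_re] at h
  refine h.congr_fun fun K => ?_
  rw [Complex.conj_mul']
  norm_cast

theorem memLp_character (K : Wave) : MemLp (character L K) 2 volume :=
  MemLp.of_bound (continuous_character K).aestronglyMeasurable 1
    (ae_of_all _ fun x => (norm_character K x).le)

theorem integrable_conj_character_mul {f : Torus L → ℂ} (hf : Integrable f) (K : Wave) :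
    Integrable fun x => conj (character L K x) * f x :=
  hf.bdd_mul (c := 1)
    (Complex.continuous_conj.comp (continuous_character K)).aestronglyMeasurable
    (ae_of_all _ fun x => by simp [norm_character])

theorem scalarCoeff_character (K M : Wave) :
    scalarCoeff (character L M) K = if K = M then 1 else 0 := by
  have h : ∀ x : Torus L, conj (character L K x) * character L M x = character L (M - K) x :=
    fun x => by rw [← character_neg, ← character_add, add_comm, sub_eq_add_neg]
  simp only [scalarCoeff, h, integral_character, sub_eq_zero, eq_comm (a := M)]
  split_ifs
  · exact inv_mul_cancel₀ side_cube_ne_zero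
  · simp

theorem scalarCoeff_sub_trigPoly {f : Torus L → ℂ} (hf : MemLp f 2 volume) (F : Finset Wave)
    (K : Wave) :
    scalarCoeff (fun x => f x - ∑ M ∈ F, scalarCoeff f M * character L M x) K =
      if K ∈ F then 0 else scalarCoeff f K := by
  have h1 : ∀ M, Integrable fun x => conj (character L K x) *
      (scalarCoeff f M * character L M x) := fun M =>
    integrable_conj_character_mul
      (((memLp_character M).integrable (by norm_num)).const_mul _) K
  have h2 : ∀ M, ((L : ℂ) ^ 3)⁻¹ * ∫ x, conj (character L K x) *
      (scalarCoeff f M * character L M x) = if K = M then scalarCoeff f M else 0 := fun M => by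
    simp only [mul_left_comm _ (scalarCoeff f M)]
    rw [integral_const_mul, mul_left_comm]
    have := scalarCoeff_character (L := L) K M
    rw [scalarCoeff] at this
    rw [this]
    simp
  rw [scalarCoeff]
  simp only [mul_sub, Finset.mul_sum]
  rw [integral_sub (integrable_conj_character_mul (hf.integrable (by norm_num)) K)
    (integrable_finsetSum _ fun M _ => h1 M), integral_finsetSum _ fun M _ => h1 M, mul_sub,
    Finset.mul_sum]
  simp only [h2, Finset.sum_ite_eq]
  rw [← scalarCoeff]
  split_ifs <;> simp

/-- A square integrable function with summable Fourier coefficients is the sum of its Fourier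
series. -/
theorem ae_eq_tsum_character {f : Torus L → ℂ} (hf : MemLp f 2 volume)
    (hs : Summable fun K => ‖scalarCoeff f K‖) :
    ∀ᵐ x, HasSum (fun K => scalarCoeff f K * character L K x) (f x) := by
  have hs' : Summable fun K => scalarCoeff f K • characterMap L K := by
    refine Summable.of_norm_bounded hs fun K => ?_
    rw [norm_smul]
    refine mul_le_of_le_one_right (norm_nonneg _) ?_
    exact (ContinuousMap.norm_le _ zero_le_one).mpr fun x => (norm_character K x).le
  -- The series converges uniformly to a continuous G. Its image in L² coincides with the Hilbert
  -- basis expansion of f, so f = G almost everywhere.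
  obtain ⟨G, hG⟩ := hs'
  have h1 := (ContinuousMap.toLp (E := ℂ) 2 (volume : Measure (Torus L)) ℂ).hasSum hG
  have h2 := (characterBasis L).hasSum_repr (hf.toLp f)
  have h0 := sqrt_side_ne_zero (L := L)
  have h3 : ∀ K, (characterBasis L).repr (hf.toLp f) K • (characterBasis L) K =
      ContinuousMap.toLp (E := ℂ) 2 (volume : Measure (Torus L)) ℂ
        (scalarCoeff f K • characterMap L K) := fun K => by
    rw [characterBasis_repr, scalarCoeff_congr hf.coeFn_toLp, map_smul, characterBasis,
      HilbertBasis.coe_mk, characterLp, smul_smul]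
    congr 1
    field_simp
  simp only [h3] at h2
  have h4 := h1.unique h2
  filter_upwards [hf.coeFn_toLp, ContinuousMap.coeFn_toLp (p := 2) (𝕜 := ℂ)
    (volume : Measure (Torus L)) G] with x hx hx'
  rw [h4, hx] at hx'
  have h5 := (ContinuousMap.evalCLM ℂ x).hasSum hG
  rw [hx']
  exact h5

/-! ### The Sobolev embedding into `L⁶` -/

theorem finite_waveSq_le (r : ℝ) : {K : Wave | waveSq K ≤ r}.Finite := by
  obtain ⟨n, hn⟩ := exists_nat_ge r
  refine (Set.finite_Icc (fun _ => -(n : ℤ)) (fun _ => (n : ℤ))).subset fun K hK => ?_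
  have h1 : waveSup K ≤ n := by
    by_contra h
    have h2 : (n : ℝ) + 1 ≤ waveSup K := by exact_mod_cast (by omega : n + 1 ≤ waveSup K)
    have h3 := waveSup_sq_le K
    have h4 : waveSq K ≤ r := hK
    have h5 : (0 : ℝ) ≤ n := Nat.cast_nonneg n
    nlinarith
  rw [waveSup_le_iff] at h1
  exact ⟨fun i => by have := h1 i; simp only; omega, fun i => by have := h1 i; simp only; omega⟩

variable {f : Torus L → ℂ} {W : ℝ}

/-- A bound for the low frequency part. -/
theorem norm_lowFreq_le (h0 : scalarCoeff f 0 = 0)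
    (hW : ∀ F : Finset Wave, ∑ K ∈ F, waveSq K * ‖scalarCoeff f K‖ ^ 2 ≤ W) {r : ℝ} (hr : 0 < r)
    {F : Finset Wave} (hF : ∀ K ∈ F, waveSq K ≤ r) (x : Torus L) :
    ‖∑ K ∈ F, scalarCoeff f K * character L K x‖ ^ 2 ≤ 104 * √r * W := by
  have h1 : ‖∑ K ∈ F, scalarCoeff f K * character L K x‖ ≤ ∑ K ∈ F, |‖scalarCoeff f K‖| := by
    refine (norm_sum_le _ _).trans (le_of_eq (Finset.sum_congr rfl fun K _ => ?_))
    rw [norm_mul, norm_character, mul_one, abs_norm]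
  -- The weight parameter is the cutoff r itself: for |K|² ≤ r the weight |K|²(r + |K|²) is at most
  -- 2r|K|².
  have h2 := sum_norm_le_lattice hr F (fun K => ‖scalarCoeff f K‖) (by simp [h0])
  have hs := Real.sqrt_pos.mpr hr
  have hss := Real.sq_sqrt hr.le
  calc ‖∑ K ∈ F, scalarCoeff f K * character L K x‖ ^ 2
      ≤ (∑ K ∈ F, |‖scalarCoeff f K‖|) ^ 2 := by gcongr
    _ ≤ 52 / √r * ∑ K ∈ F, waveSq K * (r + waveSq K) * ‖scalarCoeff f K‖ ^ 2 := h2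
    _ ≤ 52 / √r * ∑ K ∈ F, 2 * r * (waveSq K * ‖scalarCoeff f K‖ ^ 2) := by
        refine mul_le_mul_of_nonneg_left (Finset.sum_le_sum fun K hK => ?_) (by positivity)
        have h3 := hF K hK
        have h4 := waveSq_nonneg K
        have h5 : 0 ≤ waveSq K * ‖scalarCoeff f K‖ ^ 2 := by positivity
        nlinarith
    _ = 104 * √r * ∑ K ∈ F, waveSq K * ‖scalarCoeff f K‖ ^ 2 := by
        rw [← Finset.mul_sum]
        field_simp
        rw [hss]
        ring
    _ ≤ 104 * √r * W := by gcongr; exact hW F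

/-- The distribution function of `|f|` is controlled by the high frequencies. -/
theorem volume_le_norm_le (hf : MemLp f 2 volume) (h0 : scalarCoeff f 0 = 0) (hWpos : 0 < W)
    (hW : ∀ F : Finset Wave, ∑ K ∈ F, waveSq K * ‖scalarCoeff f K‖ ^ 2 ≤ W) {t : ℝ}
    (ht : 0 < t) :
    ENNReal.ofReal (t ^ 2) * volume {x | t ≤ ‖f x‖} ≤
      ∑' K, if t ^ 4 < (416 * W) ^ 2 * waveSq K then
        ENNReal.ofReal (4 * L ^ 3 * ‖scalarCoeff f K‖ ^ 2) else 0 := by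
  classical
  -- The cutoff depends on the level t. It solves 104√r W = (t/2)², so the part of f with |K|² ≤ r
  -- is at most t/2 everywhere, and where |f| ≥ t the high frequency part must be at least t/2.
  -- Chebyshev's inequality does the rest.
  set r : ℝ := (t ^ 2 / (416 * W)) ^ 2 with hr
  have hrpos : 0 < r := by positivity
  have hrs : √r = t ^ 2 / (416 * W) := Real.sqrt_sq (by positivity)
  set F := (finite_waveSq_le r).toFinset
  have hF : ∀ K, K ∈ F ↔ waveSq K ≤ r := fun K => by simp [F]
  set l : Torus L → ℂ := fun x => ∑ M ∈ F, scalarCoeff f M * character L M x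
  have hl : ∀ x, ‖l x‖ ≤ t / 2 := fun x => by
    have h1 := norm_lowFreq_le h0 hW hrpos (F := F) (fun K hK => (hF K).mp hK) x
    rw [hrs] at h1
    have h2 : 104 * (t ^ 2 / (416 * W)) * W = (t / 2) ^ 2 := by field_simp; ring
    rw [h2] at h1
    exact le_of_sq_le_sq h1 (by positivity)
  have hlm : MemLp l 2 volume :=
    memLp_finsetSum _ fun M _ => (memLp_character M).const_mul _
  have hh : MemLp (fun x => f x - l x) 2 volume := hf.sub hlm
  have hp := hasSum_norm_scalarCoeff hh
  have hL := cube_pos (L := L)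
  have e1 : ∫⁻ x, ENNReal.ofReal (‖f x - l x‖ ^ 2) =
      ∑' K, ENNReal.ofReal (L ^ 3 * ‖scalarCoeff (fun x => f x - l x) K‖ ^ 2) := by
    have hp' := hp.mul_left (L ^ 3)
    rw [mul_inv_cancel_left₀ hL.ne'] at hp'
    rw [← ofReal_integral_eq_lintegral_ofReal hh.norm.integrable_sq
      (ae_of_all _ fun x => by positivity), ← hp'.tsum_eq,
      ENNReal.ofReal_tsum_of_nonneg (fun K => by positivity) hp'.summable]
  have hsub : {x | t ≤ ‖f x‖} ⊆
      {x | ENNReal.ofReal ((t / 2) ^ 2) ≤ ENNReal.ofReal (‖f x - l x‖ ^ 2)} := fun x hx => by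
    have hx' : t ≤ ‖f x‖ := hx
    have h1 := hl x
    have h2 : ‖f x‖ ≤ ‖f x - l x‖ + ‖l x‖ := by
      simpa using norm_add_le (f x - l x) (l x)
    refine ENNReal.ofReal_le_ofReal ?_
    have h3 : t / 2 ≤ ‖f x - l x‖ := by linarith
    gcongr
  have hch := mul_meas_ge_le_lintegral₀ (μ := (volume : Measure (Torus L)))
    (f := fun x => ENNReal.ofReal (‖f x - l x‖ ^ 2))
    (hh.1.aemeasurable.norm.pow_const 2).ennreal_ofReal (ENNReal.ofReal ((t / 2) ^ 2))
  calc ENNReal.ofReal (t ^ 2) * volume {x | t ≤ ‖f x‖}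
      = ENNReal.ofReal 4 * (ENNReal.ofReal ((t / 2) ^ 2) * volume {x | t ≤ ‖f x‖}) := by
        rw [← mul_assoc, ← ENNReal.ofReal_mul (by norm_num)]
        congr 2
        ring
    _ ≤ ENNReal.ofReal 4 * ∫⁻ x, ENNReal.ofReal (‖f x - l x‖ ^ 2) := by
        gcongr
        exact le_trans (by gcongr) hch
    _ = ∑' K, ENNReal.ofReal 4 *
          ENNReal.ofReal (L ^ 3 * ‖scalarCoeff (fun x => f x - l x) K‖ ^ 2) := by
        rw [e1, ENNReal.tsum_mul_left]
    _ = _ := by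
        refine tsum_congr fun K => ?_
        rw [scalarCoeff_sub_trigPoly hf, ← ENNReal.ofReal_mul (by norm_num)]
        have h6 : K ∈ F ↔ ¬ t ^ 4 < (416 * W) ^ 2 * waveSq K := by
          rw [hF, hr, not_lt, div_pow, le_div_iff₀ (by positivity)]
          ring_nf
        by_cases hK : K ∈ F
        · rw [if_pos hK, if_neg (h6.mp hK)]
          simp
        · rw [if_neg hK, if_pos (not_not.mp fun h => hK (h6.mpr h))]
          congr 1
          ring

theorem lintegral_ite_cube {R : ℝ} (hR : 0 ≤ R) :
    ∫⁻ t in Set.Ioi (0 : ℝ), (if t ^ 4 < R ^ 4 then ENNReal.ofReal (t ^ 3) else 0) =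
      ENNReal.ofReal (R ^ 4 / 4) := by
  have e1 : ∀ t ∈ Set.Ioi (0 : ℝ), (if t ^ 4 < R ^ 4 then ENNReal.ofReal (t ^ 3) else 0) =
      (Set.Iio R).indicator (fun t => ENNReal.ofReal (t ^ 3)) t := fun t ht => by
    have : t ^ 4 < R ^ 4 ↔ t < R := pow_lt_pow_iff_left₀ (le_of_lt ht) hR (by norm_num)
    simp only [Set.indicator, Set.mem_Iio, this]
  rw [setLIntegral_congr_fun measurableSet_Ioi e1, lintegral_indicator measurableSet_Iio,
    Measure.restrict_restrict measurableSet_Iio, Set.inter_comm, Set.Ioi_inter_Iio,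
    Measure.restrict_congr_set Ioo_ae_eq_Ioc]
  rw [← ofReal_integral_eq_lintegral_ofReal, ← intervalIntegral.integral_of_le hR, integral_pow]
  · congr 1
    norm_num
  · exact (continuous_pow 3).integrableOn_Ioc
  · refine (ae_restrict_iff' measurableSet_Ioc).mpr (ae_of_all _ fun t ht => ?_)
    have := ht.1.le
    positivity

/-- The **Sobolev inequality** `Ḣ¹ ⊂ L⁶` for scalar functions, in Fourier form. -/
theorem lintegral_norm_pow_six_le (hf : MemLp f 2 volume) (h0 : scalarCoeff f 0 = 0)
    (hWpos : 0 < W)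
    (hW : ∀ F : Finset Wave, ∑ K ∈ F, waveSq K * ‖scalarCoeff f K‖ ^ 2 ≤ W) :
    ∫⁻ x, ENNReal.ofReal (‖f x‖ ^ 6) ≤ ENNReal.ofReal (6 * 416 ^ 2 * L ^ 3 * W ^ 3) := by
  have hL := cube_pos (L := L)
  have hlc := lintegral_rpow_eq_lintegral_meas_le_mul (volume : Measure (Torus L))
    (f := fun x => ‖f x‖) (ae_of_all _ fun x => norm_nonneg _) hf.1.aemeasurable.norm
    (p := 6) (by norm_num)
  simp only [Real.rpow_ofNat] at hlc
  rw [hlc]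
  -- In the layer cake formula the mode K counts only for t below R_K = √(416W|K|). For fixed K the
  -- t-integral is therefore ∫ t³ over (0, R_K), which is R_K⁴/4 and proportional to |K|².
  -- Interchanging sum and integral turns the L² mass of the high frequencies into Σ|K|²|f_K|² ≤ W.
  have e1 : ∀ t ∈ Set.Ioi (0 : ℝ), volume {a : Torus L | t ≤ ‖f a‖} *
      ENNReal.ofReal (t ^ ((6 : ℝ) - 1)) ≤ ∑' K,
        ENNReal.ofReal (4 * L ^ 3 * ‖scalarCoeff f K‖ ^ 2) *
          (if t ^ 4 < (√(416 * W * √(waveSq K))) ^ 4 then ENNReal.ofReal (t ^ 3) else 0) := by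
    intro t ht
    have ht' : 0 < t := ht
    have h1 : t ^ ((6 : ℝ) - 1) = t ^ 2 * t ^ 3 := by
      rw [← pow_add, ← Real.rpow_natCast]
      norm_num
    rw [h1, ENNReal.ofReal_mul (by positivity), ← mul_assoc, mul_comm (volume _)]
    refine (mul_le_mul_left (volume_le_norm_le hf h0 hWpos hW ht') _).trans (le_of_eq ?_)
    rw [← ENNReal.tsum_mul_right]
    refine tsum_congr fun K => ?_
    have h2 : (√(416 * W * √(waveSq K))) ^ 4 = (416 * W) ^ 2 * waveSq K := by
      have h3 := waveSq_nonneg K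
      have h4 : (√(416 * W * √(waveSq K))) ^ 4 = ((√(416 * W * √(waveSq K))) ^ 2) ^ 2 := by ring
      rw [h4, Real.sq_sqrt (by positivity), mul_pow, Real.sq_sqrt h3]
    rw [h2]
    split_ifs <;> simp
  have hmeas : ∀ K : Wave, Measurable fun t : ℝ =>
      if t ^ 4 < (√(416 * W * √(waveSq K))) ^ 4 then ENNReal.ofReal (t ^ 3) else 0 := fun K =>
    Measurable.ite (measurableSet_lt (by fun_prop) (by fun_prop)) (by fun_prop) (by fun_prop)
  calc ENNReal.ofReal 6 * ∫⁻ t in Set.Ioi (0 : ℝ), volume {a : Torus L | t ≤ ‖f a‖} *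
        ENNReal.ofReal (t ^ ((6 : ℝ) - 1))
      ≤ ENNReal.ofReal 6 * ∫⁻ t in Set.Ioi (0 : ℝ), ∑' K,
        ENNReal.ofReal (4 * L ^ 3 * ‖scalarCoeff f K‖ ^ 2) *
          (if t ^ 4 < (√(416 * W * √(waveSq K))) ^ 4 then ENNReal.ofReal (t ^ 3) else 0) := by
        gcongr 1
        exact setLIntegral_mono' measurableSet_Ioi e1
    _ = ENNReal.ofReal 6 * ∑' K, ENNReal.ofReal
          (L ^ 3 * (416 * W) ^ 2 * (waveSq K * ‖scalarCoeff f K‖ ^ 2)) := by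
        rw [lintegral_tsum fun K => ((hmeas K).const_mul _).aemeasurable]
        congr 1
        refine tsum_congr fun K => ?_
        rw [lintegral_const_mul _ (hmeas K), lintegral_ite_cube (Real.sqrt_nonneg _),
          ← ENNReal.ofReal_mul (by positivity)]
        congr 1
        have h3 := waveSq_nonneg K
        have h4 : (√(416 * W * √(waveSq K))) ^ 4 = ((√(416 * W * √(waveSq K))) ^ 2) ^ 2 := by ring
        rw [h4, Real.sq_sqrt (by positivity), mul_pow, Real.sq_sqrt h3]
        ring
    _ ≤ ENNReal.ofReal 6 * ENNReal.ofReal (L ^ 3 * (416 * W) ^ 2 * W) := by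
        gcongr
        rw [ENNReal.tsum_eq_iSup_sum]
        refine iSup_le fun F => ?_
        rw [← ENNReal.ofReal_sum_of_nonneg fun K _ => by
          have := waveSq_nonneg K
          positivity, ← Finset.mul_sum]
        gcongr
        exact hW F
    _ = _ := by
        rw [← ENNReal.ofReal_mul (by norm_num)]
        congr 1
        ring

/-! ### The Gagliardo-Nirenberg inequalities -/

theorem eq_zero_of_gradNorm_eq_zero {u : L2 L} (hu : u ∈ Hdot L 1) (h : gradNorm u = 0) :
    u = 0 := by
  have h1 := lam1_mul_sq_norm_le hu
  rw [h] at h1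
  have h2 := lam1_pos (L := L)
  have h3 : ‖u‖ ^ 2 ≤ 0 := by nlinarith [sq_nonneg ‖u‖]
  exact norm_eq_zero.mp (pow_eq_zero_iff two_ne_zero |>.mp (le_antisymm h3 (sq_nonneg _)))

theorem sum_waveSq_mul_norm_coeff_le {u : L2 L} (hu : u ∈ Hdot L 1) (F : Finset Wave) :
    ∑ K ∈ F, waveSq K * ‖coeff u K‖ ^ 2 ≤ (lam1 L)⁻¹ * ((L ^ 3)⁻¹ * gradNorm u ^ 2) := by
  have h := (hasSum_gradNorm hu).mul_left (lam1 L)⁻¹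
  refine le_trans (le_of_eq ?_) (sum_le_hasSum F (fun K _ => ?_) h)
  · refine Finset.sum_congr rfl fun K _ => ?_
    rw [eigen_eq, ← mul_assoc, inv_mul_cancel_left₀ lam1_pos.ne']
  · have := lam1_pos (L := L)
    have := eigen_nonneg (L := L) K
    positivity

theorem one_le_lam1_mul_side_sq : 1 ≤ lam1 L * L ^ 2 := by
  have h : L ≠ 0 := side_pos.ne'
  unfold lam1
  field_simp
  nlinarith [Real.pi_gt_three]

theorem scalarCoeff_component_zero {u : L2 L} (h : coeff u 0 = 0) (i : Fin 3) :
    scalarCoeff (fun x => ((u x i : ℝ) : ℂ)) 0 = 0 := by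
  rw [← coeff_apply, h]
  rfl

theorem norm_scalarCoeff_component_le (u : L2 L) (i : Fin 3) (K : Wave) :
    ‖scalarCoeff (fun x => ((u x i : ℝ) : ℂ)) K‖ ≤ ‖coeff u K‖ := by
  rw [← coeff_apply]
  exact PiLp.norm_apply_le _ i

/-- The Sobolev inequality `‖u‖_{L⁶} ≤ 18 ‖∇u‖`. -/
theorem lintegral_pow_six_le {u : L2 L} (hu : u ∈ Hdot L 1) :
    ∫⁻ x, ENNReal.ofReal (‖u x‖ ^ 6) ≤ ENNReal.ofReal ((18 * gradNorm u) ^ 6) := by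
  rcases (gradNorm_nonneg u).eq_or_lt with h0 | h0
  · have h1 := eq_zero_of_gradNorm_eq_zero hu h0.symm
    have h2 : ∫⁻ x, ENNReal.ofReal (‖u x‖ ^ 6) = ∫⁻ _ : Torus L, 0 := by
      refine lintegral_congr_ae ?_
      rw [h1]
      filter_upwards [Lp.coeFn_zero R3 2 (volume : Measure (Torus L))] with x hx
      rw [hx]
      simp
    rw [h2, lintegral_zero]
    exact zero_le
  have hL := cube_pos (L := L)
  have hk := lam1_pos (L := L)
  set W := (lam1 L)⁻¹ * ((L ^ 3)⁻¹ * gradNorm u ^ 2)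
  have hW : 0 < W := by positivity
  have hi : ∀ i, ∫⁻ x, ENNReal.ofReal (|u x i| ^ 6) ≤
      ENNReal.ofReal (6 * 416 ^ 2 * L ^ 3 * W ^ 3) := fun i => by
    have h2 := lintegral_norm_pow_six_le (memLp_component u i) (scalarCoeff_component_zero hu.1 i)
      hW fun F => (Finset.sum_le_sum fun K _ => by
        have h3 := waveSq_nonneg K
        have h4 := norm_scalarCoeff_component_le u i K
        gcongr).trans (sum_waveSq_mul_norm_coeff_le hu F)
    simpa only [Complex.norm_real, Real.norm_eq_abs] using h2
  -- Power means for three components: (a + b + c)³ ≤ 9(a³ + b³ + c³).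
  have hpt : ∀ x, ENNReal.ofReal (‖u x‖ ^ 6) ≤
      ∑ i, ENNReal.ofReal 9 * ENNReal.ofReal (|u x i| ^ 6) := fun x => by
    rw [← Finset.mul_sum, ← ENNReal.ofReal_sum_of_nonneg fun i _ => by positivity,
      ← ENNReal.ofReal_mul (by norm_num)]
    refine ENNReal.ofReal_le_ofReal ?_
    have e : ‖u x‖ ^ 6 = (∑ i, |u x i| ^ 2) ^ 3 := by
      have : ‖u x‖ ^ 6 = (‖u x‖ ^ 2) ^ 3 := by ring
      rw [this, EuclideanSpace.norm_sq_eq]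
      simp only [Real.norm_eq_abs]
    have h5 := pow_sum_le_card_mul_sum_pow (s := Finset.univ) (f := fun i => |u x i| ^ 2)
      (fun _ _ => by positivity) 2
    rw [e]
    refine h5.trans (le_of_eq ?_)
    simp only [← pow_mul]
    norm_num
  have hm : ∀ i, AEMeasurable (fun x => ENNReal.ofReal (|u x i| ^ 6)) volume := fun i => by
    have h6 := (memLp_component u i).1.aemeasurable.norm.pow_const 6
    simp only [Complex.norm_real, Real.norm_eq_abs] at h6
    exact h6.ennreal_ofReal
  calc ∫⁻ x, ENNReal.ofReal (‖u x‖ ^ 6)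
      ≤ ∫⁻ x, ∑ i, ENNReal.ofReal 9 * ENNReal.ofReal (|u x i| ^ 6) := lintegral_mono hpt
    _ = ∑ i, ENNReal.ofReal 9 * ∫⁻ x, ENNReal.ofReal (|u x i| ^ 6) := by
        rw [lintegral_finsetSum' _ fun i _ => (hm i).const_mul _]
        refine Finset.sum_congr rfl fun i _ => ?_
        rw [lintegral_const_mul'' _ (hm i)]
    _ ≤ ∑ i : Fin 3, ENNReal.ofReal 9 * ENNReal.ofReal (6 * 416 ^ 2 * L ^ 3 * W ^ 3) := by
        gcongr with i
        exact hi i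
    _ = ENNReal.ofReal (27 * (6 * 416 ^ 2 * L ^ 3 * W ^ 3)) := by
        rw [Finset.sum_const, Finset.card_univ, Fintype.card_fin, nsmul_eq_mul,
          ← ENNReal.ofReal_mul (by norm_num), ← ENNReal.ofReal_natCast,
          ← ENNReal.ofReal_mul (by norm_num)]
        congr 1
        push_cast
        ring
    _ ≤ _ := by
        refine ENNReal.ofReal_le_ofReal ?_
        have hs := one_le_lam1_mul_side_sq (L := L)
        have hLp : 0 < L := side_pos
        -- The side L enters only through λ₁L² = 4π², so the constant is absolute; 28035072 lies
        -- below 18⁶ = 34012224.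
        have e : 27 * (6 * 416 ^ 2 * L ^ 3 * W ^ 3) =
            28035072 * gradNorm u ^ 6 / (lam1 L * L ^ 2) ^ 3 := by
          simp only [W]
          field_simp
          norm_num
        rw [e, div_le_iff₀ (by positivity)]
        have h7 : 1 ≤ (lam1 L * L ^ 2) ^ 3 := one_le_pow₀ hs
        have h8 : 0 ≤ gradNorm u ^ 6 := by positivity
        rw [mul_pow]
        nlinarith

/-- Agmon's inequality for the Fourier coefficients. -/
theorem sq_sum_norm_coeff_le {u : L2 L} (hu : u ∈ Hdot L 2) (F : Finset Wave) :
    (∑ K ∈ F, ‖coeff u K‖) ^ 2 ≤ gradNorm u * ‖stokes u‖ := by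
  have hu1 := Hdot_mono one_le_two hu
  rcases (gradNorm_nonneg u).eq_or_lt with h0 | h0
  · have h1 := eq_zero_of_gradNorm_eq_zero hu1 h0.symm
    have h2 : ∀ K, ‖coeff u K‖ = 0 := fun K => by rw [h1, coeff_zero, norm_zero]
    simp [h2, ← h0]
  have hL := cube_pos (L := L)
  have hLp : 0 < L := side_pos
  have hk := lam1_pos (L := L)
  have hA : 0 < ‖stokes u‖ := by
    have h1 := lam1_mul_sq_gradNorm_le hu
    have h2 : 0 < ‖stokes u‖ ^ 2 := lt_of_lt_of_le (by positivity) h1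
    exact lt_of_le_of_ne (norm_nonneg _) fun h => by simp [← h] at h2
  set G := gradNorm u
  set A := ‖stokes u‖
  have hG2 := sum_waveSq_mul_norm_coeff_le hu1 F
  have hA2 : ∑ K ∈ F, waveSq K ^ 2 * ‖coeff u K‖ ^ 2 ≤
      ((lam1 L)⁻¹) ^ 2 * ((L ^ 3)⁻¹ * A ^ 2) := by
    have h := (hasSum_stokes hu).mul_left (((lam1 L)⁻¹) ^ 2)
    refine le_trans (le_of_eq ?_) (sum_le_hasSum F (fun K _ => ?_) h)
    · refine Finset.sum_congr rfl fun K _ => ?_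
      rw [eigen_eq]
      field_simp
    · have := eigen_nonneg (L := L) K
      positivity
  have hk2 : lam1 L = (2 * Real.pi / L) ^ 2 := by
    unfold lam1
    ring
  have hpi := Real.pi_gt_three
  have hks : √(lam1 L) = 2 * Real.pi / L := by
    rw [hk2]
    exact Real.sqrt_sq (by positivity)
  -- This value of s balances the gradient term and the Laplacian term of the weighted sum.
  -- Inserting it gives the factor 104/(8π³), which is below 1.
  set s : ℝ := A / (√(lam1 L) * G) with hs
  have hspos : 0 < s := by positivity
  have h2 := sum_norm_le_lattice (m := s ^ 2) (by positivity) F (fun K => ‖coeff u K‖)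
    (by simp [hu.1])
  simp only [abs_norm] at h2
  rw [Real.sqrt_sq hspos.le] at h2
  have h3 : ∑ K ∈ F, waveSq K * (s ^ 2 + waveSq K) * ‖coeff u K‖ ^ 2 =
      s ^ 2 * ∑ K ∈ F, waveSq K * ‖coeff u K‖ ^ 2 + ∑ K ∈ F, waveSq K ^ 2 * ‖coeff u K‖ ^ 2 := by
    rw [Finset.mul_sum, ← Finset.sum_add_distrib]
    exact Finset.sum_congr rfl fun K _ => by ring
  rw [h3] at h2
  calc (∑ K ∈ F, ‖coeff u K‖) ^ 2
      ≤ 52 / s * (s ^ 2 * ((lam1 L)⁻¹ * ((L ^ 3)⁻¹ * G ^ 2)) +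
          ((lam1 L)⁻¹) ^ 2 * ((L ^ 3)⁻¹ * A ^ 2)) := by
        refine h2.trans ?_
        gcongr
    _ = 104 / (8 * Real.pi ^ 3) * (G * A) := by
        rw [hs, hks, hk2]
        field_simp
        ring
    _ ≤ 1 * (G * A) := by
        gcongr
        rw [div_le_one (by positivity)]
        have : (3 : ℝ) ^ 3 ≤ Real.pi ^ 3 := by gcongr
        linarith
    _ = G * A := one_mul _

theorem summable_norm_coeff {u : L2 L} (hu : u ∈ Hdot L 2) :
    Summable fun K => ‖coeff u K‖ :=
  summable_of_sum_le (fun _ => norm_nonneg _) fun F =>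
    Real.le_sqrt_of_sq_le (sq_sum_norm_coeff_le hu F)

theorem tsum_norm_coeff_le {u : L2 L} (hu : u ∈ Hdot L 2) :
    ∑' K, ‖coeff u K‖ ≤ √(gradNorm u * ‖stokes u‖) :=
  (summable_norm_coeff hu).tsum_le_of_sum_le fun F =>
    Real.le_sqrt_of_sq_le (sq_sum_norm_coeff_le hu F)

theorem ae_hasSum_component {u : L2 L} (hs : Summable fun K => ‖coeff u K‖) :
    ∀ᵐ x, ∀ i, HasSum (fun K => coeff u K i * character L K x) ((u x i : ℝ) : ℂ) := by
  rw [ae_all_iff]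
  intro i
  exact ae_eq_tsum_character (memLp_component u i)
    (Summable.of_nonneg_of_le (fun _ => norm_nonneg _) (norm_scalarCoeff_component_le u i) hs)

/-- The series is summed in ℂ³ and not by components, so the triangle inequality costs no
dimensional factor. -/
theorem ae_norm_le_tsum {u : L2 L} (hs : Summable fun K => ‖coeff u K‖) :
    ∀ᵐ x, ‖u x‖ ≤ ∑' K, ‖coeff u K‖ := by
  filter_upwards [ae_hasSum_component hs] with x hx
  let y : C3 := WithLp.toLp 2 fun i => ((u x i : ℝ) : ℂ)
  have hy : ‖y‖ = ‖u x‖ := by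
    simp [y, EuclideanSpace.norm_eq]
  have hn : ∀ K, ‖character L K x • coeff u K‖ = ‖coeff u K‖ := fun K => by
    rw [norm_smul, norm_character, one_mul]
  have hsv : Summable fun K => character L K x • coeff u K :=
    Summable.of_norm (by simpa only [hn] using hs)
  have h1 : ∑' K, character L K x • coeff u K = y := by
    ext i
    have h2 := (EuclideanSpace.proj i : C3 →L[ℂ] ℂ).hasSum hsv.hasSum
    refine h2.unique ((hx i).congr_fun fun K => ?_)
    simp [mul_comm]
  rw [← hy, ← h1]
  refine (norm_tsum_le_tsum_norm (by simpa only [hn] using hs)).trans (le_of_eq ?_)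
  simp only [hn]

/-- Agmon's inequality. -/
theorem ae_norm_le_agmon {u : L2 L} (hu : u ∈ Hdot L 2) :
    ∀ᵐ x, ‖u x‖ ≤ √(gradNorm u * ‖stokes u‖) := by
  filter_upwards [ae_norm_le_tsum (summable_norm_coeff hu)] with x hx
  exact hx.trans (tsum_norm_coeff_le hu)

theorem eLpNorm_six_le {u : L2 L} (hu : u ∈ Hdot L 1) :
    eLpNorm u 6 volume ≤ ENNReal.ofReal (18 * gradNorm u) := by
  have hG := gradNorm_nonneg u
  rw [eLpNorm_eq_lintegral_rpow_enorm_toReal (by norm_num) (by norm_num)]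
  have h := lintegral_pow_six_le hu
  have e : ∀ x, ‖u x‖ₑ ^ (6 : ℝ≥0∞).toReal = ENNReal.ofReal (‖u x‖ ^ 6) := fun x => by
    rw [ENNReal.ofReal_pow (norm_nonneg _), ofReal_norm, ENNReal.toReal_ofNat,
      ENNReal.rpow_ofNat]
  simp only [e]
  rw [ENNReal.ofReal_pow (by positivity), ← ENNReal.rpow_ofNat] at h
  calc _ ≤ (ENNReal.ofReal (18 * gradNorm u) ^ (6 : ℝ)) ^ (1 / (6 : ℝ≥0∞).toReal) := by
        gcongr
    _ = _ := by
        rw [ENNReal.toReal_ofNat, ← ENNReal.rpow_mul]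
        norm_num

theorem lintegral_pow_two_eq (u : L2 L) :
    ∫⁻ x, ENNReal.ofReal (‖u x‖ ^ 2) = ENNReal.ofReal (‖u‖ ^ 2) := by
  rw [← real_inner_self_eq_norm_sq, MeasureTheory.L2.inner_def,
    ofReal_integral_eq_lintegral_ofReal]
  · simp only [real_inner_self_eq_norm_sq]
  · exact MeasureTheory.L2.integrable_inner u u
  · exact ae_of_all _ fun x => real_inner_self_nonneg

/-- Interpolation between L² and L⁶: Hölder's inequality with exponents 4/3 and 4 for |u|³ =
|u|^{3/2}|u|^{3/2}. This gives the constant √18, rounded up to 18. -/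
theorem eLpNorm_three_le {u : L2 L} (hu : u ∈ Hdot L 1) :
    eLpNorm u 3 volume ≤ ENNReal.ofReal (18 * √‖u‖ * √(gradNorm u)) := by
  have hG := gradNorm_nonneg u
  have h2 := lintegral_pow_two_eq u
  have h6 := lintegral_pow_six_le hu
  have hm : AEMeasurable (fun x => ‖u x‖ₑ) volume := (Lp.memLp u).1.enorm
  have hp : (4 / 3 : ℝ).HolderConjugate 4 := by
    rw [Real.holderConjugate_iff]
    norm_num
  have hh := ENNReal.lintegral_mul_le_Lp_mul_Lq volume hp (hm.pow_const (3 / 2 : ℝ))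
    (hm.pow_const (3 / 2 : ℝ))
  have e2 : ∀ x, ENNReal.ofReal (‖u x‖ ^ 2) = ‖u x‖ₑ ^ (2 : ℝ) := fun x => by
    rw [ENNReal.ofReal_pow (norm_nonneg _), ofReal_norm, ENNReal.rpow_ofNat]
  have e6 : ∀ x, ENNReal.ofReal (‖u x‖ ^ 6) = ‖u x‖ₑ ^ (6 : ℝ) := fun x => by
    rw [ENNReal.ofReal_pow (norm_nonneg _), ofReal_norm, ENNReal.rpow_ofNat]
  simp only [e2] at h2
  simp only [e6] at h6
  have e3 : ∀ x, (‖u x‖ₑ ^ (3 / 2 : ℝ)) * (‖u x‖ₑ ^ (3 / 2 : ℝ)) = ‖u x‖ₑ ^ (3 : ℝ) := fun x => by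
    rw [← ENNReal.rpow_add_of_nonneg _ _ (by norm_num) (by norm_num)]
    norm_num
  have e4 : ∀ x, (‖u x‖ₑ ^ (3 / 2 : ℝ)) ^ (4 / 3 : ℝ) = ‖u x‖ₑ ^ (2 : ℝ) := fun x => by
    rw [← ENNReal.rpow_mul]
    norm_num
  have e5 : ∀ x, (‖u x‖ₑ ^ (3 / 2 : ℝ)) ^ (4 : ℝ) = ‖u x‖ₑ ^ (6 : ℝ) := fun x => by
    rw [← ENNReal.rpow_mul]
    norm_num
  simp only [Pi.mul_apply, e3, e4, e5] at hh
  rw [eLpNorm_eq_lintegral_rpow_enorm_toReal (by norm_num) (by norm_num), ENNReal.toReal_ofNat]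
  calc (∫⁻ x, ‖u x‖ₑ ^ (3 : ℝ)) ^ (1 / (3 : ℝ))
      ≤ (ENNReal.ofReal (‖u‖ ^ 2) ^ (1 / (4 / 3) : ℝ) *
          ENNReal.ofReal ((18 * gradNorm u) ^ 6) ^ (1 / 4 : ℝ)) ^ (1 / (3 : ℝ)) := by
        gcongr
        refine hh.trans ?_
        rw [h2]
        gcongr
    _ = ENNReal.ofReal (√18 * √‖u‖ * √(gradNorm u)) := by
        rw [ENNReal.ofReal_rpow_of_nonneg (by positivity) (by norm_num),
          ENNReal.ofReal_rpow_of_nonneg (by positivity) (by norm_num),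
          ← ENNReal.ofReal_mul (by positivity),
          ENNReal.ofReal_rpow_of_nonneg (by positivity) (by norm_num)]
        congr 1
        rw [Real.mul_rpow (by positivity) (by positivity), ← Real.rpow_mul (by positivity),
          ← Real.rpow_mul (by positivity), ← Real.rpow_natCast, ← Real.rpow_natCast,
          ← Real.rpow_mul (by positivity), ← Real.rpow_mul (by positivity),
          mul_right_comm, ← Real.sqrt_mul (by norm_num), Real.sqrt_eq_rpow, Real.sqrt_eq_rpow]
        norm_num
        ring
    _ ≤ _ := by
        gcongr
        rw [Real.sqrt_le_left (by norm_num)]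
        norm_num

theorem gagliardoNirenberg {c : ℝ} (hc : 18 ≤ c) : GagliardoNirenberg L c := by
  refine ⟨fun g hg => (eLpNorm_six_le hg.1).trans ?_, fun g hg =>
    (eLpNorm_three_le hg.1).trans ?_, fun g hg => ?_⟩
  · have := gradNorm_nonneg g
    gcongr
  · gcongr
  · rw [eLpNorm_exponent_top]
    refine eLpNormEssSup_le_of_ae_bound ?_
    filter_upwards [ae_norm_le_agmon hg.1] with x hx
    rw [Real.sqrt_mul (gradNorm_nonneg g)] at hx
    refine hx.trans ?_
    have h1 : 0 ≤ √(gradNorm g) * √‖stokes g‖ := by positivity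
    rw [mul_assoc]
    nlinarith

/-! ### The trilinear form -/

/-- The advection term is a product of two L² functions, so it is only integrable and Parseval's
identity in L² does not apply. Absolute convergence of the series of φ still allows termwise
integration against it. -/
theorem hasSum_integral_character_mul {φ Q : Torus L → ℂ} (hφ : MemLp φ 2 volume)
    (hs : Summable fun K => ‖scalarCoeff φ K‖) (hQ : Integrable Q) :
    HasSum (fun K => scalarCoeff φ K * ∫ x, character L K x * Q x) (∫ x, φ x * Q x) := by
  have hc : ∀ K, Integrable fun x => scalarCoeff φ K * (character L K x * Q x) := fun K =>
    (hQ.bdd_mul (c := 1) (continuous_character K).aestronglyMeasurable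
      (ae_of_all _ fun x => (norm_character K x).le)).const_mul _
  have h := hasSum_integral_of_summable_integral_norm hc ?_
  · have e : ∫ x, ∑' K, scalarCoeff φ K * (character L K x * Q x) = ∫ x, φ x * Q x := by
      refine integral_congr_ae ?_
      filter_upwards [ae_eq_tsum_character hφ hs] with x hx
      simp only [← mul_assoc]
      exact (hx.mul_right (Q x)).tsum_eq
    rw [e] at h
    refine h.congr_fun fun K => ?_
    rw [integral_const_mul]
  · simp only [norm_mul, norm_character, one_mul, integral_const_mul]
    exact hs.mul_right _

theorem hasSum_conj_scalarCoeff_mul {φ Q : Torus L → ℂ} (hφ : MemLp φ 2 volume)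
    (hs : Summable fun K => ‖scalarCoeff φ K‖) (hQ : Integrable Q) :
    HasSum (fun K => conj (scalarCoeff φ K) * scalarCoeff Q K)
      (((L : ℂ) ^ 3)⁻¹ * ∫ x, conj (φ x) * Q x) := by
  have hQ' : Integrable fun x => conj (Q x) :=
    memLp_one_iff_integrable.mp (memLp_one_iff_integrable.mpr hQ).star
  have h := ((hasSum_integral_character_mul hφ hs hQ').star).mul_left ((L : ℂ) ^ 3)⁻¹
  have e : star (∫ x, φ x * conj (Q x)) = ∫ x, conj (φ x) * Q x := by
    rw [← starRingEnd_apply, ← integral_conj]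
    simp
  rw [e] at h
  refine h.congr_fun fun K => ?_
  have e2 : scalarCoeff Q K = ((L : ℂ) ^ 3)⁻¹ * ∫ x, conj (character L K x) * Q x := rfl
  rw [← starRingEnd_apply, map_mul, ← integral_conj, e2, mul_left_comm]
  simp only [map_mul, Complex.conj_conj]

theorem integrable_component {F : Torus L → R3} (hF : Integrable F) (i : Fin 3) :
    Integrable fun x => ((F x i : ℝ) : ℂ) :=
  (ContinuousLinearMap.integrable_comp (EuclideanSpace.proj i : R3 →L[ℝ] ℝ) hF).ofReal

/-- Parseval's identity for an integrable field and a field with summable coefficients. -/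
theorem hasSum_inner_coeff_of_integrable {F : Torus L → R3} (hF : Integrable F) {φ : L2 L}
    (hs : Summable fun K => ‖coeff φ K‖) :
    HasSum (fun K => inner ℂ (coeff φ K) (coeff F K))
      (((L ^ 3)⁻¹ * ∫ x, inner ℝ (F x) (φ x) : ℝ) : ℂ) := by
  have hsi : ∀ i, Summable fun K => ‖scalarCoeff (fun x => ((φ x i : ℝ) : ℂ)) K‖ := fun i =>
    Summable.of_nonneg_of_le (fun _ => norm_nonneg _) (norm_scalarCoeff_component_le φ i) hs
  have h := hasSum_sum fun i (_ : i ∈ Finset.univ) =>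
    hasSum_conj_scalarCoeff_mul (memLp_component φ i) (hsi i) (integrable_component hF i)
  have hb := ae_norm_le_tsum hs
  have e : ∑ i, ((L : ℂ) ^ 3)⁻¹ * ∫ x, conj ((φ x i : ℝ) : ℂ) * ((F x i : ℝ) : ℂ) =
      (((L ^ 3)⁻¹ * ∫ x, inner ℝ (F x) (φ x) : ℝ) : ℂ) := by
    rw [← Finset.mul_sum, ← integral_finsetSum]
    · rw [Complex.ofReal_mul, ← integral_complex_ofReal]
      push_cast
      congr 1
      refine integral_congr_ae (ae_of_all _ fun x => ?_)
      simp only [PiLp.inner_apply, Complex.conj_ofReal]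
      push_cast
      refine Finset.sum_congr rfl fun i _ => ?_
      simp
    · intro i _
      refine (integrable_component hF i).bdd_mul (c := ∑' K, ‖coeff φ K‖)
        (memLp_component φ i).star.1 ?_
      filter_upwards [hb] with x hx
      simp only [RCLike.norm_conj, Complex.norm_real]
      exact (PiLp.norm_apply_le (φ x) i).trans hx
  rw [e] at h
  refine h.congr_fun fun K => ?_
  simp only [PiLp.inner_apply, RCLike.inner_apply, coeff_apply]
  exact Finset.sum_congr rfl fun i _ => mul_comm _ _

/-- The Leray projection is invisible to divergence free fields. -/
theorem inner_leray {a : C3} {K : Wave} (h0 : K = 0 → a = 0)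
    (hd : ∑ i, (K i : ℂ) * a i = 0) (b : Wave → C3) :
    inner ℂ a (leray b K) = inner ℂ a (b K) := by
  by_cases hK : K = 0
  · simp [h0 hK]
  · rw [leray, if_neg hK]
    simp only [PiLp.inner_apply, RCLike.inner_apply, sub_mul, Finset.sum_sub_distrib]
    have h1 : ∑ i, (K i : ℂ) * conj (a i) = 0 := by
      have := congrArg conj hd
      simpa using this
    have h2 : ∑ i, (K i : ℂ) * (∑ j, b K j * (K j : ℂ)) / (waveSq K : ℂ) * conj (a i) =
        (∑ j, b K j * (K j : ℂ)) / (waveSq K : ℂ) * ∑ i, (K i : ℂ) * conj (a i) := by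
      rw [Finset.mul_sum]
      exact Finset.sum_congr rfl fun i _ => by ring
    rw [h2, h1, mul_zero, sub_zero]

theorem inner_leray_of_mem {φ : L2 L} (hφ : φ ∈ Vdot L 0) (b : Wave → C3) (K : Wave) :
    inner ℂ (coeff φ K) (leray b K) = inner ℂ (coeff φ K) (b K) :=
  inner_leray (fun h => by rw [h]; exact hφ.1.1) (hφ.2 K) b

/-! ### Definition of the trilinear form and its bounds. -/

/-- `|∇u(x)|`. -/
def gradSize (u : L2 L) (x : Torus L) : ℝ := √(∑ j, ‖pderiv j u x‖ ^ 2)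

theorem gradSize_nonneg (u : L2 L) (x : Torus L) : 0 ≤ gradSize u x := Real.sqrt_nonneg _

theorem gradSize_sq (u : L2 L) (x : Torus L) : gradSize u x ^ 2 = ∑ j, ‖pderiv j u x‖ ^ 2 :=
  Real.sq_sqrt (Finset.sum_nonneg fun _ _ => sq_nonneg _)

theorem integral_norm_sq (u : L2 L) : ∫ x, ‖u x‖ ^ 2 = ‖u‖ ^ 2 := by
  rw [← real_inner_self_eq_norm_sq, MeasureTheory.L2.inner_def]
  simp only [real_inner_self_eq_norm_sq]

theorem integral_gradSize_sq (u : L2 L) : ∫ x, gradSize u x ^ 2 = gradNorm u ^ 2 := by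
  simp only [gradSize_sq]
  rw [gradNorm_sq, integral_finsetSum]
  · simp only [integral_norm_sq]
  · exact fun j _ => (Lp.memLp (pderiv j u)).norm.integrable_sq

theorem aestronglyMeasurable_gradSize (u : L2 L) : AEStronglyMeasurable (gradSize u) volume := by
  unfold gradSize
  refine Real.continuous_sqrt.comp_aestronglyMeasurable ?_
  exact Finset.aestronglyMeasurable_fun_sum _ fun j _ =>
    ((Lp.memLp (pderiv j u)).1.norm.pow 2)

theorem memLp_gradSize (u : L2 L) : MemLp (gradSize u) 2 volume := by
  rw [memLp_two_iff_integrable_sq (aestronglyMeasurable_gradSize u)]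
  simp only [gradSize_sq]
  exact integrable_finsetSum _ fun j _ => (Lp.memLp (pderiv j u)).norm.integrable_sq

theorem norm_advect_le (v u : L2 L) (x : Torus L) : ‖advect v u x‖ ≤ ‖v x‖ * gradSize u x := by
  have h1 : ‖advect v u x‖ ≤ ∑ j, |v x j| * ‖pderiv j u x‖ := by
    refine (norm_sum_le _ _).trans (le_of_eq (Finset.sum_congr rfl fun j _ => ?_))
    rw [norm_smul, Real.norm_eq_abs]
  refine h1.trans ((Real.sum_mul_le_sqrt_mul_sqrt _ _ _).trans (le_of_eq ?_))
  rw [EuclideanSpace.norm_eq]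
  rfl

theorem integrable_advect (v u : L2 L) : Integrable (advect v u) := by
  unfold advect
  refine integrable_finsetSum _ fun j _ => ?_
  have h1 : MemLp (fun x => v x j) 2 volume :=
    ContinuousLinearMap.comp_memLp' (EuclideanSpace.proj j : R3 →L[ℝ] ℝ) (Lp.memLp v)
  exact memLp_one_iff_integrable.mp ((Lp.memLp (pderiv j u)).smul (r := 1) h1)

/-- `∫ ((v·∇)u)·φ`. -/
def triForm (v u φ : L2 L) : ℝ := ∫ x, inner ℝ (advect v u x) (φ x)

theorem integrable_triForm (v u : L2 L) {φ : L2 L} (hφ : φ ∈ Hdot L 2) :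
    Integrable fun x => inner ℝ (advect v u x) (φ x) := by
  refine ((integrable_advect v u).norm.mul_const (√(gradNorm φ * ‖stokes φ‖))).mono'
    ((integrable_advect v u).1.inner (Lp.memLp φ).1) ?_
  filter_upwards [ae_norm_le_agmon hφ] with x hx
  refine (norm_inner_le_norm _ _).trans ?_
  gcongr

theorem triForm_add_left (v v' u : L2 L) {φ : L2 L} (hφ : φ ∈ Hdot L 2) :
    triForm (v + v') u φ = triForm v u φ + triForm v' u φ := by
  unfold triForm
  rw [← integral_add (integrable_triForm v u hφ) (integrable_triForm v' u hφ)]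
  refine integral_congr_ae ?_
  filter_upwards [Lp.coeFn_add v v'] with x hx
  rw [← inner_add_left]
  congr 1
  simp only [advect, hx, Pi.add_apply, PiLp.add_apply, add_smul, Finset.sum_add_distrib]

theorem triForm_smul_left (r : ℝ) (v u φ : L2 L) :
    triForm (r • v) u φ = r * triForm v u φ := by
  unfold triForm
  rw [← integral_const_mul]
  refine integral_congr_ae ?_
  filter_upwards [Lp.coeFn_smul r v] with x hx
  rw [← real_inner_smul_left]
  congr 1
  simp only [advect, hx, Pi.smul_apply, PiLp.smul_apply, smul_eq_mul, mul_smul, Finset.smul_sum]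

theorem triForm_sub_middle (v : L2 L) {u u' φ : L2 L} (hu : u ∈ Hdot L 1) (hu' : u' ∈ Hdot L 1)
    (hφ : φ ∈ Hdot L 2) : triForm v (u - u') φ = triForm v u φ - triForm v u' φ := by
  unfold triForm
  rw [← integral_sub (integrable_triForm v u hφ) (integrable_triForm v u' hφ)]
  refine integral_congr_ae ?_
  have h : ∀ᵐ x, ∀ j, pderiv j (u - u') x = pderiv j u x - pderiv j u' x := by
    rw [ae_all_iff]
    intro j
    rw [pderiv_sub hu hu']
    exact Lp.coeFn_sub _ _
  filter_upwards [h] with x hx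
  rw [← inner_sub_left]
  congr 1
  simp only [advect, hx, smul_sub, Finset.sum_sub_distrib]

/-- The Cauchy-Schwarz inequality for nonnegative functions. -/
theorem integral_mul_le_sqrt {f g : Torus L → ℝ} (hf : MemLp f 2 volume) (hg : MemLp g 2 volume)
    (hf0 : ∀ x, 0 ≤ f x) (hg0 : ∀ x, 0 ≤ g x) :
    ∫ x, f x * g x ≤ √(∫ x, f x ^ 2) * √(∫ x, g x ^ 2) := by
  have h := integral_mul_le_Lp_mul_Lq_of_nonneg (μ := (volume : Measure (Torus L)))
    Real.HolderConjugate.two_two (ae_of_all _ hf0) (ae_of_all _ hg0) (by simpa using hf)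
    (by simpa using hg)
  simpa [Real.sqrt_eq_rpow] using h

/-- Hölder's inequality with L^∞ on the test field, for advecting fields such as Au that are only
square integrable. -/
theorem abs_triForm_le (v u : L2 L) {φ : L2 L} {C : ℝ} (hC : ∀ᵐ x, ‖φ x‖ ≤ C) :
    |triForm v u φ| ≤ C * (‖v‖ * gradNorm u) := by
  have hC0 : 0 ≤ C := by
    obtain ⟨x, hx⟩ := hC.exists
    exact (norm_nonneg _).trans hx
  have h1 := integral_mul_le_sqrt (Lp.memLp v).norm (memLp_gradSize u) (fun _ => norm_nonneg _)
    (gradSize_nonneg u)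
  rw [integral_norm_sq, integral_gradSize_sq, Real.sqrt_sq (norm_nonneg _),
    Real.sqrt_sq (gradNorm_nonneg _)] at h1
  have hi : Integrable fun x => ‖v x‖ * gradSize u x :=
    (Lp.memLp v).norm.integrable_mul (memLp_gradSize u)
  rw [← Real.norm_eq_abs]
  calc ‖triForm v u φ‖ ≤ ∫ x, C * (‖v x‖ * gradSize u x) := by
        refine norm_integral_le_of_norm_le (hi.const_mul C) ?_
        filter_upwards [hC] with x hx
        refine (norm_inner_le_norm _ _).trans ?_
        rw [mul_comm C]
        have h2 := norm_advect_le v u x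
        have h3 := gradSize_nonneg u x
        gcongr
    _ = C * ∫ x, ‖v x‖ * gradSize u x := integral_const_mul _ _
    _ ≤ _ := by gcongr

/-- Cauchy-Schwarz for |u|⁴ = |u|·|u|³ and the L⁶ bound. The Agmon bound serves only to make the
powers square integrable; its size does not enter. -/
theorem integral_pow_four_le {u : L2 L} (hu : u ∈ Hdot L 2) :
    MemLp (fun x => ‖u x‖ ^ 2) 2 volume ∧
      ∫ x, (‖u x‖ ^ 2) ^ 2 ≤ ‖u‖ * (18 * gradNorm u) ^ 3 := by
  have hb := ae_norm_le_agmon hu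
  set C := √(gradNorm u * ‖stokes u‖)
  have hm := (Lp.memLp u).1.norm
  have hp : ∀ n, MemLp (fun x => ‖u x‖ ^ n) 2 volume := fun n => by
    refine MemLp.of_bound (hm.pow n) (C ^ n) ?_
    filter_upwards [hb] with x hx
    rw [norm_pow, norm_norm]
    gcongr
  refine ⟨hp 2, ?_⟩
  have h1 := integral_mul_le_sqrt (Lp.memLp u).norm (hp 3) (fun _ => norm_nonneg _)
    (fun _ => by positivity)
  have h6 : ∫ x, (‖u x‖ ^ 3) ^ 2 ≤ (18 * gradNorm u) ^ 6 := by
    have h2 := lintegral_pow_six_le (Hdot_mono one_le_two hu)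
    have h3 : Integrable fun x => ‖u x‖ ^ 6 := by
      simpa only [← pow_mul] using (hp 3).integrable_sq
    rw [← ofReal_integral_eq_lintegral_ofReal h3 (ae_of_all _ fun _ => by positivity),
      ENNReal.ofReal_le_ofReal_iff (by positivity)] at h2
    simpa only [← pow_mul] using h2
  have hG := gradNorm_nonneg u
  calc ∫ x, (‖u x‖ ^ 2) ^ 2 = ∫ x, ‖u x‖ * ‖u x‖ ^ 3 := by
        refine integral_congr_ae (ae_of_all _ fun x => ?_)
        ring
    _ ≤ √(∫ x, ‖u x‖ ^ 2) * √(∫ x, (‖u x‖ ^ 3) ^ 2) := h1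
    _ ≤ ‖u‖ * (18 * gradNorm u) ^ 3 := by
        rw [integral_norm_sq, Real.sqrt_sq (norm_nonneg _)]
        gcongr
        rw [Real.sqrt_le_left (by positivity), ← pow_mul]
        exact h6

theorem abs_triForm_diag_le {g : L2 L} (hg : g ∈ Hdot L 2) (u : L2 L) :
    |triForm g u g| ≤ √(‖g‖ * (18 * gradNorm g) ^ 3) * gradNorm u := by
  obtain ⟨h1, h2⟩ := integral_pow_four_le hg
  have h3 := integral_mul_le_sqrt h1 (memLp_gradSize u) (fun _ => by positivity)
    (gradSize_nonneg u)
  rw [integral_gradSize_sq, Real.sqrt_sq (gradNorm_nonneg _)] at h3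
  have hi : Integrable fun x => ‖g x‖ ^ 2 * gradSize u x := h1.integrable_mul (memLp_gradSize u)
  rw [← Real.norm_eq_abs]
  calc ‖triForm g u g‖ ≤ ∫ x, ‖g x‖ ^ 2 * gradSize u x := by
        refine norm_integral_le_of_norm_le hi (ae_of_all _ fun x => ?_)
        refine (norm_inner_le_norm _ _).trans ?_
        have h4 := norm_advect_le g u x
        nlinarith [norm_nonneg (g x)]
    _ ≤ _ := h3
    _ ≤ _ := by
        have := gradNorm_nonneg u
        gcongr

/-! ### The cancellation property of the nonlinearity -/

/-- The Fourier multiplier of `∂_j`. -/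
def waveSymbol (L : ℝ) (j : Fin 3) (K : Wave) : ℂ := 2 * Real.pi * Complex.I * (K j : ℂ) / (L : ℂ)

/-- The convolution formula for a product, read off from Parseval's identity for the pair
e^{-2πiM·x/L}z_j and ∂_j g, both of which lie in L². -/
theorem hasSum_character_mul_advect (z : L2 L) {g : L2 L} (hg : g ∈ Hdot L 1) (i : Fin 3)
    (M : Wave) :
    HasSum (fun K => coeff g K i * ∑ j, waveSymbol L j K * conj (coeff z (K + M) j))
      (((L : ℂ) ^ 3)⁻¹ * ∫ x, character L M x * ((advect z g x i : ℝ) : ℂ)) := by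
  have hm : ∀ j, MemLp (fun x => conj (character L M x) * ((z x j : ℝ) : ℂ)) 2 volume := fun j =>
    MemLp.of_le (memLp_component z j)
      ((Complex.continuous_conj.comp (continuous_character M)).aestronglyMeasurable.mul
        (memLp_component z j).1)
      (ae_of_all _ fun x => by simp [norm_character])
  have h := hasSum_sum fun j (_ : j ∈ Finset.univ) =>
    hasSum_scalarCoeff (hm j) (memLp_component (pderiv j g) i)
  have e : ∑ j, ((L : ℂ) ^ 3)⁻¹ * ∫ x, conj (conj (character L M x) * ((z x j : ℝ) : ℂ)) *
      ((pderiv j g x i : ℝ) : ℂ) =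
      ((L : ℂ) ^ 3)⁻¹ * ∫ x, character L M x * ((advect z g x i : ℝ) : ℂ) := by
    rw [← Finset.mul_sum, ← integral_finsetSum]
    · congr 1
      refine integral_congr_ae (ae_of_all _ fun x => ?_)
      simp [advect, Finset.mul_sum, mul_assoc]
    · intro j _
      exact (hm j).star.integrable_mul (memLp_component (pderiv j g) i)
  rw [e] at h
  refine h.congr_fun fun K => ?_
  rw [Finset.mul_sum]
  refine Finset.sum_congr rfl fun j _ => ?_
  have e1 : scalarCoeff (fun x => conj (character L M x) * ((z x j : ℝ) : ℂ)) K =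
      coeff z (K + M) j := by
    rw [coeff_apply]
    unfold scalarCoeff
    congr 1
    refine integral_congr_ae (ae_of_all _ fun x => ?_)
    simp only [character_add, map_mul]
    ring
  rw [e1, ← coeff_apply, coeff_pderiv hg]
  simp only [PiLp.smul_apply, smul_eq_mul, waveSymbol]
  ring

theorem sum_waveSymbol_mul_conj {z : L2 L} (hz : z ∈ Vdot L 0) (P : Wave) :
    ∑ j, waveSymbol L j P * conj (coeff z P j) = 0 := by
  have h : ∑ j, (P j : ℂ) * conj (coeff z P j) = 0 := by
    have := congrArg conj (hz.2 P)
    simpa using this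
  have e : ∑ j, waveSymbol L j P * conj (coeff z P j) =
      2 * Real.pi * Complex.I / (L : ℂ) * ∑ j, (P j : ℂ) * conj (coeff z P j) := by
    rw [Finset.mul_sum]
    exact Finset.sum_congr rfl fun j _ => by unfold waveSymbol; ring
  rw [e, h, mul_zero]

/-- Young's inequality separates the triad into |g_M|·λ_K|g_K|² and |g_M|·|z_{K+M}|². Both are
products of summable families, the second after the injective shear (M, K) ↦ (M, K+M). Only g has to
be smooth; z may be any L² field. -/
theorem summable_triad (z : L2 L) {g : L2 L} (hg : g ∈ Hdot L 2) (i : Fin 3) :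
    Summable fun p : Wave × Wave => coeff g p.1 i *
      (coeff g p.2 i * ∑ j, waveSymbol L j p.2 * conj (coeff z (p.2 + p.1) j)) := by
  have h1 := summable_norm_coeff hg
  have h2 := summable_eigen (Hdot_mono one_le_two hg)
  have h3 := (hasSum_norm_coeff z).summable
  have hA := Summable.mul_of_nonneg h1 h2 (fun _ => norm_nonneg _)
    (fun K => by have := eigen_nonneg (L := L) K; positivity)
  have hB := Summable.mul_of_nonneg h1 h3 (fun _ => norm_nonneg _) (fun K => by positivity)
  let e : Wave × Wave → Wave × Wave := fun p => (p.1, p.2 + p.1)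
  have he : Function.Injective e := by
    rintro ⟨a, b⟩ ⟨c, d⟩ h
    simp only [e, Prod.mk.injEq] at h
    obtain ⟨rfl, h⟩ := h
    rw [add_right_cancel h]
  have hB' := hB.comp_injective he
  refine Summable.of_norm_bounded ((hA.add hB').mul_left 3) fun p => ?_
  obtain ⟨M, K⟩ := p
  simp only [Function.comp_apply, e, pow_one]
  rw [norm_mul, norm_mul]
  have b1 : ‖coeff g M i‖ ≤ ‖coeff g M‖ := PiLp.norm_apply_le _ i
  have b2 : ‖coeff g K i‖ ≤ ‖coeff g K‖ := PiLp.norm_apply_le _ i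
  have b3 : ∀ j, ‖coeff g K‖ * ‖waveSymbol L j K * conj (coeff z (K + M) j)‖ ≤
      eigen L K * ‖coeff g K‖ ^ 2 + ‖coeff z (K + M)‖ ^ 2 := fun j => by
    rw [norm_mul, RCLike.norm_conj]
    have c1 : ‖coeff z (K + M) j‖ ≤ ‖coeff z (K + M)‖ := PiLp.norm_apply_le _ j
    have c2 : ‖waveSymbol L j K‖ ^ 2 ≤ eigen L K := by
      rw [← sum_norm_wave_symbol_sq]
      exact Finset.single_le_sum
        (f := fun j => ‖2 * Real.pi * Complex.I * (K j : ℂ) / (L : ℂ)‖ ^ 2)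
        (fun _ _ => sq_nonneg _) (Finset.mem_univ j)
    calc _ ≤ ‖coeff g K‖ * (‖waveSymbol L j K‖ * ‖coeff z (K + M)‖) := by gcongr
      _ ≤ ‖waveSymbol L j K‖ ^ 2 * ‖coeff g K‖ ^ 2 + ‖coeff z (K + M)‖ ^ 2 := by
        nlinarith [sq_nonneg (‖waveSymbol L j K‖ * ‖coeff g K‖ - ‖coeff z (K + M)‖),
          sq_nonneg (‖waveSymbol L j K‖ * ‖coeff g K‖), sq_nonneg ‖coeff z (K + M)‖]
      _ ≤ _ := by gcongr
  calc ‖coeff g M i‖ * (‖coeff g K i‖ * ‖∑ j, waveSymbol L j K * conj (coeff z (K + M) j)‖)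
      ≤ ‖coeff g M‖ * (‖coeff g K‖ * ∑ j, ‖waveSymbol L j K * conj (coeff z (K + M) j)‖) := by
        gcongr
        exact norm_sum_le _ _
    _ = ‖coeff g M‖ * ∑ j, ‖coeff g K‖ * ‖waveSymbol L j K * conj (coeff z (K + M) j)‖ := by
        rw [Finset.mul_sum]
    _ ≤ ‖coeff g M‖ * ∑ j : Fin 3, (eigen L K * ‖coeff g K‖ ^ 2 + ‖coeff z (K + M)‖ ^ 2) := by
        gcongr with j
        exact b3 j
    _ = _ := by
        rw [Finset.sum_const, Finset.card_univ, Fintype.card_fin]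
        simp only [nsmul_eq_mul]
        push_cast
        ring

/-- Instead of integrating by parts, the roles of M and K are exchanged in the absolutely convergent
triad sum. The two versions add up to multiples of (K+M)·conj z_{K+M}, which vanish by
incompressibility, so the sum equals its own negative. -/
theorem integral_component_mul_advect_eq_zero {z g : L2 L} (hz : z ∈ Vdot L 0)
    (hg : g ∈ Hdot L 2) (i : Fin 3) :
    ∫ x, ((g x i : ℝ) : ℂ) * ((advect z g x i : ℝ) : ℂ) = 0 := by
  set t : Wave × Wave → ℂ := fun p => coeff g p.1 i *
    (coeff g p.2 i * ∑ j, waveSymbol L j p.2 * conj (coeff z (p.2 + p.1) j))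
  have ht : Summable t := summable_triad z hg i
  have hsi : Summable fun K => ‖scalarCoeff (fun x => ((g x i : ℝ) : ℂ)) K‖ :=
    Summable.of_nonneg_of_le (fun _ => norm_nonneg _) (norm_scalarCoeff_component_le g i)
      (summable_norm_coeff hg)
  have h1 := (hasSum_integral_character_mul (memLp_component g i) hsi
    (integrable_component (integrable_advect z g) i)).mul_left ((L : ℂ) ^ 3)⁻¹
  simp only [← coeff_apply] at h1
  have h2 : ∀ M, HasSum (fun K => t (M, K)) (((L : ℂ) ^ 3)⁻¹ * (coeff g M i *
        ∫ x, character L M x * ((advect z g x i : ℝ) : ℂ))) := fun M => by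
    have h := (hasSum_character_mul_advect z (Hdot_mono one_le_two hg) i M).mul_left (coeff g M i)
    rw [mul_left_comm] at h
    exact h
  have h4 : ∑' p, t p = ((L : ℂ) ^ 3)⁻¹ *
      ∫ x, ((g x i : ℝ) : ℂ) * ((advect z g x i : ℝ) : ℂ) :=
    (HasSum.prod_fiberwise ht.hasSum h2).unique h1
  have h5 : ∑' p, t p = -∑' p, t p := by
    conv_lhs => rw [← (Equiv.prodComm Wave Wave).tsum_eq t]
    rw [← tsum_neg]
    refine tsum_congr fun p => ?_
    obtain ⟨M, K⟩ := p
    simp only [Equiv.prodComm_apply, Prod.swap_prod_mk, t]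
    have h6 := sum_waveSymbol_mul_conj hz (K + M)
    have h7 : ∑ j, waveSymbol L j (K + M) * conj (coeff z (K + M) j) =
        ∑ j, waveSymbol L j K * conj (coeff z (K + M) j) +
          ∑ j, waveSymbol L j M * conj (coeff z (K + M) j) := by
      rw [← Finset.sum_add_distrib]
      refine Finset.sum_congr rfl fun j _ => ?_
      simp only [waveSymbol, Pi.add_apply]
      push_cast
      ring
    rw [h7] at h6
    rw [add_comm M K]
    linear_combination (coeff g K i * coeff g M i) * h6
  have h8 : ∑' p, t p = 0 := self_eq_neg.mp h5
  rw [h8] at h4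
  exact (mul_eq_zero.mp h4.symm).resolve_left (inv_ne_zero side_cube_ne_zero)

/-- `((z·∇)g, g) = 0` for divergence free `z`. -/
theorem triForm_self_eq_zero {z g : L2 L} (hz : z ∈ Vdot L 0) (hg : g ∈ Hdot L 2) :
    triForm z g g = 0 := by
  have h1 : ((triForm z g g : ℝ) : ℂ) =
      ∑ i, ∫ x, ((g x i : ℝ) : ℂ) * ((advect z g x i : ℝ) : ℂ) := by
    unfold triForm
    rw [← integral_complex_ofReal, ← integral_finsetSum]
    · refine integral_congr_ae (ae_of_all _ fun x => ?_)
      simp only [PiLp.inner_apply]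
      push_cast
      refine Finset.sum_congr rfl fun i _ => ?_
      simp
    · intro i _
      refine (integrable_component (integrable_advect z g) i).bdd_mul
        (c := √(gradNorm g * ‖stokes g‖)) (memLp_component g i).1 ?_
      filter_upwards [ae_norm_le_agmon hg] with x hx
      rw [Complex.norm_real]
      exact (PiLp.norm_apply_le (g x) i).trans hx
  simp only [integral_component_mul_advect_eq_zero hz hg, Finset.sum_const_zero] at h1
  exact_mod_cast h1

/-- The nonlinearity tested with a smooth divergence free field. -/
theorem hasSum_inner_bilin (v u : L2 L) {φ : L2 L} (hφ : φ ∈ Vdot L 2) :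
    HasSum (fun K => (inner ℂ (coeff φ K) (bilin v u K)).re) ((L ^ 3)⁻¹ * triForm v u φ) := by
  have h := Complex.hasSum_re
    (hasSum_inner_coeff_of_integrable (integrable_advect v u) (summable_norm_coeff hφ.1))
  rw [Complex.ofReal_re] at h
  refine h.congr_fun fun K => ?_
  rw [bilin, inner_leray_of_mem (Vdot_mono (by norm_num) hφ)]

/-! ### Absolutely continuous functions of time -/

theorem absolutelyContinuousOnInterval_primitive {p' : ℝ → ℝ} {a b : ℝ} (c : ℝ)
    (hp' : IntervalIntegrable p' volume a b) :
    AbsolutelyContinuousOnInterval (fun t => c + ∫ s in a..t, p' s) a b :=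
  (contDiffOn_const.absolutelyContinuousOnInterval (f := fun _ => c)).fun_add
    (hp'.absolutelyContinuousOnInterval_intervalIntegral Set.left_mem_uIcc)

/-- The product rule for absolutely continuous functions, in integrated form. -/
theorem integral_product_rule {p p' q q' : ℝ → ℝ} {a b : ℝ} (hab : a ≤ b)
    (hp' : IntervalIntegrable p' volume a b) (hq' : IntervalIntegrable q' volume a b)
    (hp : ∀ t ∈ Set.Icc a b, p t = p a + ∫ s in a..t, p' s)
    (hq : ∀ t ∈ Set.Icc a b, q t = q a + ∫ s in a..t, q' s) :
    IntervalIntegrable (fun s => p' s * q s + p s * q' s) volume a b ∧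
      ∫ s in a..b, (p' s * q s + p s * q' s) = p b * q b - p a * q a := by
  -- The functions p and q are known only on [a, b]; their primitives are defined on the whole line,
  -- so that differentiation makes sense at the end points too.
  set P : ℝ → ℝ := fun t => p a + ∫ s in a..t, p' s
  set Q : ℝ → ℝ := fun t => q a + ∫ s in a..t, q' s
  have hP : AbsolutelyContinuousOnInterval P a b :=
    absolutelyContinuousOnInterval_primitive _ hp'
  have hQ : AbsolutelyContinuousOnInterval Q a b :=
    absolutelyContinuousOnInterval_primitive _ hq'
  have huI : Set.uIcc a b = Set.Icc a b := Set.uIcc_of_le hab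
  have hcP : ContinuousOn p (Set.uIcc a b) := hP.continuousOn.congr fun t ht => hp t (huI ▸ ht)
  have hcQ : ContinuousOn q (Set.uIcc a b) := hQ.continuousOn.congr fun t ht => hq t (huI ▸ ht)
  refine ⟨(hp'.mul_continuousOn hcQ).add (hq'.continuousOn_mul hcP), ?_⟩
  have h := hP.integral_deriv_mul_eq_sub hQ
  have hPa : P a = p a := by simp [P]
  have hQa : Q a = q a := by simp [Q]
  have hPb : P b = p b := (hp b (Set.right_mem_Icc.mpr hab)).symm
  have hQb : Q b = q b := (hq b (Set.right_mem_Icc.mpr hab)).symm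
  rw [hPa, hQa, hPb, hQb] at h
  rw [← h]
  refine intervalIntegral.integral_congr_ae ?_
  filter_upwards [hp'.ae_hasDerivAt_integral, hq'.ae_hasDerivAt_integral] with x h1 h2 hx
  have hx' : x ∈ Set.uIcc a b := Set.uIoc_subset_uIcc hx
  have e1 : deriv P x = p' x := ((h1 hx' a Set.left_mem_uIcc).const_add (p a)).deriv
  have e2 : deriv Q x = q' x := ((h2 hx' a Set.left_mem_uIcc).const_add (q a)).deriv
  rw [e1, e2, hp x (huI ▸ hx'), hq x (huI ▸ hx')]

/-- Grönwall's inequality for an absolutely continuous function. -/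
theorem gronwall_ac {E ψ Φ : ℝ → ℝ} {κ a b : ℝ} (hκ : 0 ≤ κ) (hab : a ≤ b)
    (hψ : IntervalIntegrable ψ volume a b) (hΦ : IntervalIntegrable Φ volume a b)
    (hE : ∀ t ∈ Set.Icc a b, E t = E a + ∫ s in a..t, ψ s)
    (hle : ∀ᵐ s ∂(volume.restrict (Set.Icc a b)), ψ s ≤ -κ * E s + Φ s)
    (hΦ0 : ∀ᵐ s ∂(volume.restrict (Set.Icc a b)), 0 ≤ Φ s) :
    E b ≤ Real.exp (-κ * (b - a)) * E a + ∫ s in a..b, Φ s := by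
  -- The integrating factor is normalized to 1 at time b. It is then at most 1 on [a, b] and can be
  -- dropped from the nonnegative forcing.
  have hq : ∀ t ∈ Set.Icc a b, Real.exp (-κ * (b - t)) = Real.exp (-κ * (b - a)) +
      ∫ s in a..t, κ * Real.exp (-κ * (b - s)) := by
    intro t _
    have h1 : ∀ x ∈ Set.uIcc a t, HasDerivAt (fun s => Real.exp (-κ * (b - s)))
        (κ * Real.exp (-κ * (b - x))) x := fun x _ => by
      have h2 : HasDerivAt (fun s => -κ * (b - s)) (-κ * -1) x :=
        ((hasDerivAt_id x).const_sub b).const_mul _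
      convert h2.exp using 1
      ring
    rw [intervalIntegral.integral_eq_sub_of_hasDerivAt h1
      (Continuous.intervalIntegrable (by fun_prop) _ _)]
    ring
  have hq' : IntervalIntegrable (fun s => κ * Real.exp (-κ * (b - s))) volume a b :=
    Continuous.intervalIntegrable (by fun_prop) _ _
  obtain ⟨hi, he⟩ := integral_product_rule hab hψ hq' hE hq
  have hmono : ∫ s in a..b, (ψ s * Real.exp (-κ * (b - s)) +
      E s * (κ * Real.exp (-κ * (b - s)))) ≤ ∫ s in a..b, Φ s := by
    refine intervalIntegral.integral_mono_ae_restrict hab hi hΦ ?_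
    filter_upwards [hle, hΦ0, ae_restrict_mem measurableSet_Icc] with s h1 h2 hs
    have h3 : 0 < Real.exp (-κ * (b - s)) := Real.exp_pos _
    have h4 : Real.exp (-κ * (b - s)) ≤ 1 := by
      rw [Real.exp_le_one_iff]
      nlinarith [hs.2]
    nlinarith
  rw [he] at hmono
  simp only [sub_self, mul_zero, Real.exp_zero, mul_one] at hmono
  linarith

/-- Grönwall's inequality with a forcing that is bounded on windows of fixed length. -/
theorem gronwall_window {E ψ Φ : ℝ → ℝ} {κ T M : ℝ} (hκ : 0 < κ) (hT : 0 < T) (hM : 0 ≤ M)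
    (hψ : ∀ a b, 0 ≤ a → a ≤ b → IntervalIntegrable ψ volume a b)
    (hΦ : ∀ a b, 0 ≤ a → a ≤ b → IntervalIntegrable Φ volume a b)
    (hE : ∀ a t, 0 ≤ a → a ≤ t → E t = E a + ∫ s in a..t, ψ s)
    (hle : ∀ᵐ s ∂(volume.restrict (Set.Ici (0 : ℝ))), ψ s ≤ -κ * E s + Φ s)
    (hΦ0 : ∀ s, 0 ≤ Φ s)
    (hwin : ∀ a, 0 ≤ a → ∫ s in a..(a + T), Φ s ≤ M) {t : ℝ} (ht : 0 ≤ t) :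
    E t ≤ Real.exp (-κ * t) * E 0 + M / (1 - Real.exp (-κ * T)) := by
  have hr : Real.exp (-κ * T) < 1 := by
    rw [Real.exp_lt_one_iff]
    nlinarith [mul_pos hκ hT]
  have hr0 : 0 < Real.exp (-κ * T) := Real.exp_pos _
  set r := Real.exp (-κ * T)
  have h1r : 0 < 1 - r := by linarith
  have hMr : M ≤ M / (1 - r) := by
    rw [le_div_iff₀ h1r]
    nlinarith
  have hgr : ∀ a b, 0 ≤ a → a ≤ b →
      E b ≤ Real.exp (-κ * (b - a)) * E a + ∫ s in a..b, Φ s := fun a b ha hab => by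
    refine gronwall_ac hκ.le hab (hψ a b ha hab) (hΦ a b ha hab)
      (fun t ht => hE a t ha ht.1) ?_ (ae_of_all _ hΦ0)
    exact ae_restrict_of_ae_restrict_of_subset (fun s hs => ha.trans hs.1) hle
  -- Induction over the number of windows, stepping back from t by exactly T. The bound reproduces
  -- itself because M/(1 - r) is the fixed point of X ↦ rX + M.
  have key : ∀ n : ℕ, ∀ t, 0 ≤ t → t ≤ n * T →
      E t ≤ Real.exp (-κ * t) * E 0 + M / (1 - r) := by
    intro n
    induction n with
    | zero =>
      intro t h0 h1
      have : t = 0 := le_antisymm (by simpa using h1) h0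
      subst this
      simp only [mul_zero, Real.exp_zero, one_mul]
      linarith
    | succ n ih =>
      intro t h0 h1
      push_cast at h1
      rcases le_or_gt t T with h | h
      · have h2 := hgr 0 t le_rfl h0
        have h3 : ∫ s in (0 : ℝ)..t, Φ s ≤ ∫ s in (0 : ℝ)..(0 + T), Φ s := by
          refine intervalIntegral.integral_mono_interval le_rfl h0 (by linarith)
            (ae_of_all _ hΦ0) (hΦ _ _ le_rfl (by linarith))
        have h4 := hwin 0 le_rfl
        rw [sub_zero] at h2
        linarith
      · have h2 := hgr (t - T) t (by linarith) (by linarith)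
        have h3 := hwin (t - T) (by linarith)
        have h4 := ih (t - T) (by linarith) (by linarith)
        rw [sub_add_cancel] at h3
        rw [sub_sub_cancel] at h2
        have h5 : r * (Real.exp (-κ * (t - T)) * E 0 + M / (1 - r)) + M =
            Real.exp (-κ * t) * E 0 + M / (1 - r) := by
          have e : Real.exp (-κ * t) = r * Real.exp (-κ * (t - T)) := by
            simp only [r]
            rw [← Real.exp_add]
            congr 1
            ring
          rw [e]
          field_simp
          ring
        have h6 := mul_le_mul_of_nonneg_left h4 hr0.le
        linarith
  obtain ⟨n, hn⟩ := exists_nat_ge (t / T)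
  exact key n t ht ((div_le_iff₀ hT).mp hn)

/-! ### The energy identity -/

variable (L) in
/-- A Fourier coefficient, as a continuous linear functional. -/
def coeffCLM (K : Wave) (i : Fin 3) : L2 L →L[ℝ] ℂ :=
  LinearMap.mkContinuous
    { toFun := fun u => coeff u K i
      map_add' := fun u v => by rw [coeff_add]; rfl
      map_smul' := fun r u => by rw [coeff_smul]; rfl }
    (√((L ^ 3)⁻¹)) fun u => by
      have h1 : ‖coeff u K i‖ ≤ ‖coeff u K‖ := PiLp.norm_apply_le _ i
      have h2 : ‖coeff u K‖ ^ 2 ≤ (L ^ 3)⁻¹ * ‖u‖ ^ 2 :=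
        le_hasSum (hasSum_norm_coeff u) K fun _ _ => sq_nonneg _
      refine h1.trans (le_of_sq_le_sq ?_ (by positivity))
      rw [mul_pow, Real.sq_sqrt (inv_nonneg.mpr cube_pos.le)]
      exact h2

theorem coeffCLM_apply (K : Wave) (i : Fin 3) (u : L2 L) : coeffCLM L K i u = coeff u K i := rfl

/-- `y ∈ L²_loc(Ḣ²)` with values in `Ḣ¹` and time derivative `y' ∈ L²_loc(L²)`. -/
structure IsStrong (y y' : ℝ → L2 L) : Prop where
  mem_one : ∀ t, 0 ≤ t → y t ∈ Hdot L 1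
  mem_two : ∀ᵐ t ∂(volume.restrict (Set.Ici (0 : ℝ))), y t ∈ Hdot L 2
  memLp_stokes : ∀ T : ℝ, 0 < T →
    MemLp (fun t => stokes (y t)) 2 (volume.restrict (Set.Icc 0 T))
  memLp_deriv : ∀ T : ℝ, 0 < T → MemLp y' 2 (volume.restrict (Set.Icc 0 T))
  eq_integral : ∀ t, 0 ≤ t → y t = y 0 + ∫ s in (0 : ℝ)..t, y' s

theorem IsRegular.isStrong {y y' : ℝ → L2 L} (h : IsRegular y y') : IsStrong y y' where
  mem_one t ht := (h.mem_V t ht).1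
  mem_two := h.mem_DA.mono fun _ ht => ht.1
  memLp_stokes := h.memLp_stokes
  memLp_deriv := h.memLp_deriv
  eq_integral := h.eq_integral

theorem ae_restrict_of_Ici {P : ℝ → Prop} (h : ∀ᵐ t ∂(volume.restrict (Set.Ici (0 : ℝ))), P t)
    {s : Set ℝ} (hs : s ⊆ Set.Ici 0) : ∀ᵐ t ∂(volume.restrict s), P t :=
  ae_restrict_of_ae_restrict_of_subset hs h

theorem memLp_restrict_Icc {E : Type*} [NormedAddCommGroup E] {y : ℝ → E}
    (h : ∀ T : ℝ, 0 < T → MemLp y 2 (volume.restrict (Set.Icc 0 T))) {a b : ℝ} (ha : 0 ≤ a)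
    (hab : a ≤ b) : MemLp y 2 (volume.restrict (Set.Icc a b)) :=
  (h (b + 1) (by linarith)).mono_measure
    (Measure.restrict_mono (Set.Icc_subset_Icc ha (by linarith)) le_rfl)

theorem intervalIntegrable_of_integrable_Icc {E : Type*} [NormedAddCommGroup E] {y : ℝ → E}
    {a b : ℝ} (hab : a ≤ b) (h : Integrable y (volume.restrict (Set.Icc a b))) :
    IntervalIntegrable y volume a b :=
  (intervalIntegrable_iff_integrableOn_Icc_of_le hab).mpr h

namespace IsStrong

variable {y y' z z' : ℝ → L2 L}

theorem intervalIntegrable_deriv (h : IsStrong y y') {a b : ℝ} (ha : 0 ≤ a) (hab : a ≤ b) :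
    IntervalIntegrable y' volume a b :=
  intervalIntegrable_of_integrable_Icc hab
    ((memLp_restrict_Icc h.memLp_deriv ha hab).integrable (by norm_num))

theorem eq_integral_from (h : IsStrong y y') {a t : ℝ} (ha : 0 ≤ a) (hat : a ≤ t) :
    y t = y a + ∫ s in a..t, y' s := by
  rw [h.eq_integral t (ha.trans hat), h.eq_integral a ha, add_assoc,
    intervalIntegral.integral_add_adjacent_intervals (h.intervalIntegrable_deriv le_rfl ha)
      (h.intervalIntegrable_deriv ha hat)]

theorem sub (hy : IsStrong y y') (hz : IsStrong z z') :
    IsStrong (fun t => y t - z t) (fun t => y' t - z' t) where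
  mem_one t ht := sub_mem (hy.mem_one t ht) (hz.mem_one t ht)
  mem_two := by
    filter_upwards [hy.mem_two, hz.mem_two] with t h1 h2
    exact sub_mem h1 h2
  memLp_stokes T hT := by
    refine ((hy.memLp_stokes T hT).sub (hz.memLp_stokes T hT)).ae_eq ?_
    -- Additivity of `stokes` is available only on Ḣ², hence only for almost every time.
    filter_upwards [ae_restrict_of_Ici hy.mem_two Set.Icc_subset_Ici_self,
      ae_restrict_of_Ici hz.mem_two Set.Icc_subset_Ici_self] with t h1 h2
    rw [Pi.sub_apply, stokes_sub h1 h2]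
  memLp_deriv T hT := (hy.memLp_deriv T hT).sub (hz.memLp_deriv T hT)
  eq_integral t ht := by
    rw [intervalIntegral.integral_sub (hy.intervalIntegrable_deriv le_rfl ht)
      (hz.intervalIntegrable_deriv le_rfl ht), hy.eq_integral t ht, hz.eq_integral t ht]
    abel

theorem continuousOn (h : IsStrong y y') {T : ℝ} (hT : 0 < T) :
    ContinuousOn y (Set.Icc 0 T) := by
  have h1 : ContinuousOn (fun t => y 0 + ∫ s in (0 : ℝ)..t, y' s) (Set.Icc 0 T) := by
    have h2 := intervalIntegral.continuousOn_primitive_interval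
      (μ := volume) (f := y') (a := 0) (b := T)
    rw [Set.uIcc_of_le hT.le] at h2
    exact continuousOn_const.add (h2 ((h.memLp_deriv T hT).integrable (by norm_num)))
  exact h1.congr fun t ht => h.eq_integral t ht.1

theorem memLp (h : IsStrong y y') (T : ℝ) (hT : 0 < T) :
    MemLp y 2 (volume.restrict (Set.Icc 0 T)) := by
  obtain ⟨C, hC⟩ := isCompact_Icc.exists_bound_of_continuousOn (h.continuousOn hT)
  exact MemLp.of_bound ((h.continuousOn hT).aestronglyMeasurable measurableSet_Icc) C
    ((ae_restrict_iff' measurableSet_Icc).mpr (ae_of_all _ hC))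

theorem memLp_helmholtz (h : IsStrong y y') (b : ℝ) (T : ℝ) (hT : 0 < T) :
    MemLp (fun t => helmholtz b (y t)) 2 (volume.restrict (Set.Icc 0 T)) :=
  (h.memLp T hT).add ((h.memLp_stokes T hT).const_smul (b ^ 2))

end IsStrong

/-- The energy `|u|² + b²‖u‖²`. -/
def energy (b : ℝ) (u : L2 L) : ℝ := ‖u‖ ^ 2 + b ^ 2 * gradNorm u ^ 2

theorem hasSum_energy (b : ℝ) {u : L2 L} (hu : u ∈ Hdot L 1) :
    HasSum (fun K => (1 + b ^ 2 * eigen L K) * ‖coeff u K‖ ^ 2) ((L ^ 3)⁻¹ * energy b u) := by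
  have h := (hasSum_norm_coeff u).add ((hasSum_gradNorm hu).mul_left (b ^ 2))
  have e : (L ^ 3)⁻¹ * ‖u‖ ^ 2 + b ^ 2 * ((L ^ 3)⁻¹ * gradNorm u ^ 2) =
      (L ^ 3)⁻¹ * energy b u := by
    unfold energy
    ring
  rw [e] at h
  exact h.congr_fun fun K => by ring

theorem coeff_helmholtz (b : ℝ) {u : L2 L} (hu : u ∈ Hdot L 2) (K : Wave) :
    coeff (helmholtz b u) K = ((1 + b ^ 2 * eigen L K : ℝ) : ℂ) • coeff u K := by
  rw [helmholtz, coeff_add, coeff_smul, coeff_stokes hu, smul_smul]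
  push_cast
  rw [add_smul, one_smul]

theorem norm_sq_coeff_eq (u : L2 L) (K : Wave) :
    ‖coeff u K‖ ^ 2 = ∑ i, ((coeffCLM L K i u).re ^ 2 + (coeffCLM L K i u).im ^ 2) := by
  rw [EuclideanSpace.norm_sq_eq]
  refine Finset.sum_congr rfl fun i _ => ?_
  rw [Complex.sq_norm, Complex.normSq_apply, coeffCLM_apply]
  ring

theorem re_inner_coeff_eq (u v : L2 L) (K : Wave) :
    (inner ℂ (coeff u K) (coeff v K)).re = ∑ i, ((coeffCLM L K i u).re * (coeffCLM L K i v).re +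
      (coeffCLM L K i u).im * (coeffCLM L K i v).im) := by
  rw [PiLp.inner_apply, Complex.re_sum]
  refine Finset.sum_congr rfl fun i _ => ?_
  simp only [RCLike.inner_apply, Complex.mul_re, Complex.conj_re, Complex.conj_im, coeffCLM_apply]
  ring

namespace IsStrong

variable {y y' : ℝ → L2 L}

/-- A continuous functional turns the Bochner integral equation into a scalar one, to which the
product rule applies. It is used for the real and imaginary parts of each coefficient. -/
theorem functional_sq (h : IsStrong y y') (ℓ : L2 L →L[ℝ] ℝ) {a b : ℝ} (ha : 0 ≤ a)
    (hab : a ≤ b) : IntervalIntegrable (fun s => ℓ (y' s) * ℓ (y s)) volume a b ∧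
      2 * ∫ s in a..b, ℓ (y' s) * ℓ (y s) = ℓ (y b) ^ 2 - ℓ (y a) ^ 2 := by
  have hi : IntervalIntegrable (fun s => ℓ (y' s)) volume a b :=
    intervalIntegrable_of_integrable_Icc hab
      (ℓ.integrable_comp ((memLp_restrict_Icc h.memLp_deriv ha hab).integrable (by norm_num)))
  have hp : ∀ t ∈ Set.Icc a b, ℓ (y t) = ℓ (y a) + ∫ s in a..t, ℓ (y' s) := fun t ht => by
    rw [h.eq_integral_from ha ht.1, map_add,
      ℓ.intervalIntegral_comp_comm (h.intervalIntegrable_deriv ha ht.1)]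
  obtain ⟨h1, h2⟩ := integral_product_rule (p := fun t => ℓ (y t)) (q := fun t => ℓ (y t))
    hab hi hi hp hp
  have e : (fun s => ℓ (y' s) * ℓ (y s) + ℓ (y s) * ℓ (y' s)) =
      fun s => 2 * (ℓ (y' s) * ℓ (y s)) := by
    ext s
    ring
  rw [e] at h1 h2
  refine ⟨?_, ?_⟩
  · have h3 := h1.const_mul (1 / 2)
    refine h3.congr_ae (ae_of_all _ fun s => ?_)
    ring
  · rw [← intervalIntegral.integral_const_mul, h2]
    ring

theorem norm_sq_coeff (h : IsStrong y y') (K : Wave) {a b : ℝ} (ha : 0 ≤ a) (hab : a ≤ b) :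
    IntervalIntegrable (fun s => (inner ℂ (coeff (y' s) K) (coeff (y s) K)).re) volume a b ∧
    2 * ∫ s in a..b, (inner ℂ (coeff (y' s) K) (coeff (y s) K)).re =
      ‖coeff (y b) K‖ ^ 2 - ‖coeff (y a) K‖ ^ 2 := by
  simp only [re_inner_coeff_eq, norm_sq_coeff_eq]
  have h1 := fun i => h.functional_sq (Complex.reCLM.comp (coeffCLM L K i)) ha hab
  have h2 := fun i => h.functional_sq (Complex.imCLM.comp (coeffCLM L K i)) ha hab
  simp only [ContinuousLinearMap.comp_apply, Complex.reCLM_apply, Complex.imCLM_apply] at h1 h2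
  refine ⟨intervalIntegrable_iff.mpr (integrable_finsetSum _ fun i _ =>
    intervalIntegrable_iff.mp ((h1 i).1.add (h2 i).1)), ?_⟩
  rw [intervalIntegral.integral_finsetSum fun i _ => (h1 i).1.add (h2 i).1, Finset.mul_sum,
    ← Finset.sum_sub_distrib]
  refine Finset.sum_congr rfl fun i _ => ?_
  rw [intervalIntegral.integral_add (h1 i).1 (h2 i).1, mul_add, (h1 i).2, (h2 i).2]
  ring

/-- The energy identity. -/
theorem energy_identity (h : IsStrong y y') (b : ℝ) {a t : ℝ} (ha : 0 ≤ a) (hat : a ≤ t) :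
    IntervalIntegrable (fun s => 2 * inner ℝ (y' s) (helmholtz b (y s))) volume a t ∧
      energy b (y t) = energy b (y a) + ∫ s in a..t, 2 * inner ℝ (y' s) (helmholtz b (y s)) := by
  have hm' := memLp_restrict_Icc h.memLp_deriv ha hat
  have hmh := memLp_restrict_Icc (h.memLp_helmholtz b) ha hat
  have hint : IntervalIntegrable (fun s => 2 * inner ℝ (y' s) (helmholtz b (y s))) volume a t := by
    refine intervalIntegrable_of_integrable_Icc hat (Integrable.const_mul ?_ 2)
    refine ((hm'.norm.integrable_sq).add (hmh.norm.integrable_sq)).mono' (hm'.1.inner hmh.1)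
      (ae_of_all _ fun s => ?_)
    refine (norm_inner_le_norm _ _).trans ?_
    simp only [Pi.add_apply]
    nlinarith [sq_nonneg (‖y' s‖ - ‖helmholtz b (y s)‖), sq_nonneg ‖y' s‖,
      sq_nonneg ‖helmholtz b (y s)‖]
  refine ⟨hint, ?_⟩
  have hae : ∀ᵐ s ∂volume, s ∈ Set.uIoc a t → y s ∈ Hdot L 2 := by
    rw [Set.uIoc_of_le hat, ← ae_restrict_iff' measurableSet_Ioc]
    exact ae_restrict_of_Ici h.mem_two fun s hs => ha.trans hs.1.le
  have hlam : ∀ K, 0 ≤ 1 + b ^ 2 * eigen L K := fun K => by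
    have := eigen_nonneg (L := L) K
    positivity
  -- The scalar identities are summed over K. The dominating terms come from 2ab ≤ a² + b², with the
  -- weight 1 + b²λ_K put entirely on y. By Parseval they add up to L⁻³(|y'|² + |(I + b²A)y|²),
  -- which is integrable in time.
  have hsum := intervalIntegral.hasSum_integral_of_dominated_convergence (μ := volume)
    (a := a) (b := t)
    (F := fun K s => 2 * ((1 + b ^ 2 * eigen L K) *
      (inner ℂ (coeff (y' s) K) (coeff (y s) K)).re))
    (f := fun s => (L ^ 3)⁻¹ * (2 * inner ℝ (y' s) (helmholtz b (y s))))
    (fun K s => ‖coeff (y' s) K‖ ^ 2 + ‖coeff (helmholtz b (y s)) K‖ ^ 2)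
    (fun K => (intervalIntegrable_iff.mp (((h.norm_sq_coeff K ha hat).1.const_mul
        (1 + b ^ 2 * eigen L K)).const_mul 2)).aestronglyMeasurable)
    (fun K => by
      filter_upwards [hae] with s hs hs'
      rw [coeff_helmholtz b (hs hs'), norm_smul, Complex.norm_real, Real.norm_eq_abs,
        Real.norm_eq_abs, abs_mul, abs_mul, abs_two]
      have h1 := Complex.abs_re_le_norm (inner ℂ (coeff (y' s) K) (coeff (y s) K))
      have h2 := norm_inner_le_norm (𝕜 := ℂ) (coeff (y' s) K) (coeff (y s) K)
      have h3 := h1.trans h2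
      rw [abs_of_nonneg (hlam K)]
      have h4 := mul_le_mul_of_nonneg_left h3 (hlam K)
      nlinarith [sq_nonneg (‖coeff (y' s) K‖ - (1 + b ^ 2 * eigen L K) * ‖coeff (y s) K‖)])
    (ae_of_all _ fun s _ => (hasSum_norm_coeff (y' s)).summable.add
      (hasSum_norm_coeff (helmholtz b (y s))).summable)
    (by
      have h1 : ∀ s, ∑' K, (‖coeff (y' s) K‖ ^ 2 + ‖coeff (helmholtz b (y s)) K‖ ^ 2) =
          (L ^ 3)⁻¹ * ‖y' s‖ ^ 2 + (L ^ 3)⁻¹ * ‖helmholtz b (y s)‖ ^ 2 := fun s =>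
        ((hasSum_norm_coeff (y' s)).add (hasSum_norm_coeff (helmholtz b (y s)))).tsum_eq
      simp only [h1]
      exact intervalIntegrable_of_integrable_Icc hat
        ((hm'.norm.integrable_sq.const_mul _).add (hmh.norm.integrable_sq.const_mul _)))
    (by
      filter_upwards [hae] with s hs hs'
      have h1 := (hasSum_re_inner_coeff (y' s) (helmholtz b (y s))).mul_left 2
      rw [mul_left_comm] at h1
      refine h1.congr_fun fun K => ?_
      rw [coeff_helmholtz b (hs hs'), inner_smul_right, Complex.re_ofReal_mul])
  rw [intervalIntegral.integral_const_mul] at hsum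
  have hdiff := (hasSum_energy b (h.mem_one t (ha.trans hat))).sub
    (hasSum_energy b (h.mem_one a ha))
  have hF : ∀ K, ∫ s in a..t, 2 * ((1 + b ^ 2 * eigen L K) *
      (inner ℂ (coeff (y' s) K) (coeff (y s) K)).re) =
      (1 + b ^ 2 * eigen L K) * ‖coeff (y t) K‖ ^ 2 -
        (1 + b ^ 2 * eigen L K) * ‖coeff (y a) K‖ ^ 2 := fun K => by
    rw [intervalIntegral.integral_const_mul, intervalIntegral.integral_const_mul,
      mul_left_comm, (h.norm_sq_coeff K ha hat).2]
    ring
  simp only [hF] at hsum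
  have h1 := hsum.unique hdiff
  rw [← mul_sub] at h1
  have h2 := mul_left_cancel₀ (inv_ne_zero (cube_pos (L := L)).ne') h1
  linarith

end IsStrong

/-! ### The equations tested with smooth fields -/

theorem stokes_mem {u : L2 L} (hu : u ∈ Vdot L 2) : stokes u ∈ Vdot L 0 := by
  have hc := coeff_stokes hu.1
  refine ⟨mem_Hdot_of_summable ?_ ?_, fun K => ?_⟩
  · rw [hc, hu.1.1, smul_zero]
  · simpa using (hasSum_norm_coeff (stokes u)).summable
  · simp only [hc, PiLp.smul_apply, smul_eq_mul, mul_left_comm _ (eigen L K : ℂ),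
      ← Finset.mul_sum, hu.2 K, mul_zero]

theorem helmholtz_mem (b : ℝ) {u : L2 L} (hu : u ∈ Vdot L 2) : helmholtz b u ∈ Vdot L 0 :=
  add_mem (Vdot_mono (by norm_num) hu) (Submodule.smul_mem _ _ (stokes_mem hu))

theorem inner_stokes_helmholtz (b : ℝ) {u : L2 L} (hu : u ∈ Hdot L 2) :
    inner ℝ (stokes u) (helmholtz b u) = gradNorm u ^ 2 + b ^ 2 * ‖stokes u‖ ^ 2 := by
  rw [helmholtz, inner_add_right, inner_smul_right, inner_stokes_self hu,
    real_inner_self_eq_norm_sq]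

theorem inner_stokes_comm {u v : L2 L} (hu : u ∈ Hdot L 2) (hv : v ∈ Hdot L 2) :
    inner ℝ (stokes u) v = inner ℝ u (stokes v) := by
  have h1 := hasSum_re_inner_coeff (stokes u) v
  have h2 := hasSum_re_inner_coeff u (stokes v)
  have h3 : ∀ K, (inner ℂ (coeff (stokes u) K) (coeff v K)).re =
      (inner ℂ (coeff u K) (coeff (stokes v) K)).re := fun K => by
    rw [coeff_stokes hu, coeff_stokes hv, inner_smul_left, inner_smul_right, Complex.conj_ofReal]
  simp only [h3] at h1
  exact mul_left_cancel₀ (inv_ne_zero (cube_pos (L := L)).ne') (h1.unique h2)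

/-- A momentum balance in Fourier space, tested with `φ ∈ D(A)`. -/
theorem tested_equation {ν b R : ℝ} {u u' v φ : L2 L} {G : Wave → C3}
    (hφ : φ ∈ Vdot L 2)
    (heq : ∀ K, ((1 + b ^ 2 * eigen L K : ℝ) : ℂ) • coeff u' K
        + ((ν * eigen L K : ℝ) : ℂ) • coeff (helmholtz b u) K + bilin v u K = G K)
    (hG : HasSum (fun K => (inner ℂ (coeff φ K) (G K)).re) ((L ^ 3)⁻¹ * R)) :
    inner ℝ (helmholtz b φ) u' + ν * inner ℝ (stokes φ) (helmholtz b u) + triForm v u φ = R := by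
  have h1 := hasSum_re_inner_coeff (helmholtz b φ) u'
  have h2 := (hasSum_re_inner_coeff (stokes φ) (helmholtz b u)).mul_left ν
  have h3 := hasSum_inner_bilin v u hφ
  have h4 := (h1.add h2).add h3
  have h5 : ∀ K, (inner ℂ (coeff (helmholtz b φ) K) (coeff u' K)).re +
      ν * (inner ℂ (coeff (stokes φ) K) (coeff (helmholtz b u) K)).re +
      (inner ℂ (coeff φ K) (bilin v u K)).re = (inner ℂ (coeff φ K) (G K)).re := fun K => by
    rw [← heq K, inner_add_right, inner_add_right, inner_smul_right, inner_smul_right,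
      coeff_helmholtz b hφ.1, coeff_stokes hφ.1, inner_smul_left, inner_smul_left,
      Complex.conj_ofReal, Complex.conj_ofReal, Complex.add_re, Complex.add_re,
      Complex.re_ofReal_mul, Complex.re_ofReal_mul, Complex.re_ofReal_mul]
    ring
  simp only [h5] at h4
  have h6 := h4.unique hG
  have h7 := (cube_pos (L := L)).ne'
  have h8 : (L ^ 3)⁻¹ * (inner ℝ (helmholtz b φ) u' +
      ν * inner ℝ (stokes φ) (helmholtz b u) + triForm v u φ) = (L ^ 3)⁻¹ * R := by
    rw [← h6]
    ring
  exact mul_left_cancel₀ (inv_ne_zero h7) h8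

/-! ### A priori estimates for the modified Leray-`α` system -/

theorem ae_sq_norm_le_supSq {f : ℝ → L2 L}
    (hf : MemLp f ∞ (volume.restrict (Set.Ici (0 : ℝ)))) :
    ∀ᵐ t ∂(volume.restrict (Set.Ici (0 : ℝ))), ‖f t‖ ^ 2 ≤ supSq f := by
  have h1 := ae_le_eLpNormEssSup (f := f) (μ := volume.restrict (Set.Ici (0 : ℝ)))
  have h2 := hf.2
  rw [eLpNorm_exponent_top] at h2
  filter_upwards [h1] with t ht
  rw [supSq, eLpNorm_exponent_top]
  gcongr
  rw [← toReal_enorm]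
  exact ENNReal.toReal_mono h2.ne ht

theorem supSq_nonneg (f : ℝ → L2 L) : 0 ≤ supSq f := sq_nonneg _

theorem M1_nonneg (ν α : ℝ) (f : ℝ → L2 L) (u₀ : L2 L) : 0 ≤ M1 ν α f u₀ := by
  have := supSq_nonneg f
  unfold M1
  positivity

theorem lam1_mul_energy_le (b : ℝ) {u : L2 L} (hu : u ∈ Hdot L 2) :
    lam1 L * energy b u ≤ gradNorm u ^ 2 + b ^ 2 * ‖stokes u‖ ^ 2 := by
  have h1 := lam1_mul_sq_norm_le (Hdot_mono one_le_two hu)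
  have h2 := mul_le_mul_of_nonneg_left (lam1_mul_sq_gradNorm_le hu) (sq_nonneg b)
  unfold energy
  linarith

section Leray

variable {ν α : ℝ} {f u u' : ℝ → L2 L}

/-- The momentum balance of the modified Leray-`α` system. -/
def LerayBalance (ν α : ℝ) (f u u' : ℝ → L2 L) : Prop :=
  ∀ᵐ t ∂(volume.restrict (Set.Ici (0 : ℝ))), ∀ K,
    ((1 + α ^ 2 * eigen L K : ℝ) : ℂ) • coeff (u' t) K
      + ((ν * eigen L K : ℝ) : ℂ) • coeff (helmholtz α (u t)) K
      + bilin (helmholtz α (u t)) (u t) K = coeff (f t) K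

/-- The equation is tested with u, and the nonlinearity cancels. Young's inequality and Poincaré's
inequality pay for the force with half of the dissipation. -/
theorem leray_energy_inequality (hν : 0 < ν) (hreg : IsRegular u u')
    (heq : LerayBalance ν α f u u') (hf : MemLp f ∞ (volume.restrict (Set.Ici (0 : ℝ)))) :
    ∀ᵐ t ∂(volume.restrict (Set.Ici (0 : ℝ))),
      2 * inner ℝ (u' t) (helmholtz α (u t)) ≤
        -ν * (gradNorm (u t) ^ 2 + α ^ 2 * ‖stokes (u t)‖ ^ 2) + supSq f / (ν * lam1 L) := by
  filter_upwards [hreg.mem_DA, heq, ae_sq_norm_le_supSq hf] with t hu he hS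
  have h1 := tested_equation hu he (hasSum_re_inner_coeff (u t) (f t))
  rw [triForm_self_eq_zero (helmholtz_mem α hu) hu.1, inner_stokes_helmholtz α hu.1, add_zero,
    real_inner_comm] at h1
  have hk := lam1_pos (L := L)
  have h2 := real_inner_le_norm (u t) (f t)
  have h3 := lam1_mul_sq_norm_le (Hdot_mono one_le_two hu.1)
  have h4 : 2 * (‖u t‖ * ‖f t‖) ≤ ν * lam1 L * ‖u t‖ ^ 2 + ‖f t‖ ^ 2 / (ν * lam1 L) := by
    have h5 : 0 < ν * lam1 L := by positivity
    rw [← sub_nonneg]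
    have e : ν * lam1 L * ‖u t‖ ^ 2 + ‖f t‖ ^ 2 / (ν * lam1 L) - 2 * (‖u t‖ * ‖f t‖) =
        (ν * lam1 L * ‖u t‖ - ‖f t‖) ^ 2 / (ν * lam1 L) := by
      field_simp
      ring
    rw [e]
    positivity
  have h6 : ‖f t‖ ^ 2 / (ν * lam1 L) ≤ supSq f / (ν * lam1 L) := by gcongr
  have h7 : ν * (lam1 L * ‖u t‖ ^ 2) ≤ ν * gradNorm (u t) ^ 2 := by gcongr
  have h8 : 0 ≤ ν * (α ^ 2 * ‖stokes (u t)‖ ^ 2) := by positivity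
  nlinarith

theorem leray_energy_le (hν : 0 < ν) (hreg : IsRegular u u') (heq : LerayBalance ν α f u u')
    (hf : MemLp f ∞ (volume.restrict (Set.Ici (0 : ℝ)))) {t : ℝ} (ht : 0 ≤ t) :
    energy α (u t) ≤ M1 ν α f (u 0) := by
  have hk := lam1_pos (L := L)
  have hs := hreg.isStrong
  -- The stationary level of the energy inequality after Poincaré. The excess over c satisfies an
  -- unforced inequality, and the initial energy plus c is exactly M₁.
  set c := supSq f / (ν * lam1 L) / (ν * lam1 L) with hc
  have hc0 : 0 ≤ c := by
    have := supSq_nonneg f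
    positivity
  have h := gronwall_ac (E := fun t => energy α (u t) - c)
    (ψ := fun s => 2 * inner ℝ (u' s) (helmholtz α (u s))) (Φ := fun _ => 0)
    (κ := ν * lam1 L) (a := 0) (b := t) (by positivity) ht (hs.energy_identity α le_rfl ht).1
    (by simp) (fun r hr => by
      rw [(hs.energy_identity α le_rfl hr.1).2]
      ring) (by
      filter_upwards [ae_restrict_of_Ici (leray_energy_inequality hν hreg heq hf)
        (fun s hs => hs.1 : Set.Icc 0 t ⊆ Set.Ici 0), ae_restrict_of_Ici hreg.mem_DA
        (fun s hs => hs.1 : Set.Icc 0 t ⊆ Set.Ici 0)] with s h1 h2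
      have h3 := lam1_mul_energy_le α h2.1
      have h4 : ν * lam1 L * c = supSq f / (ν * lam1 L) := by
        rw [hc]
        field_simp
      nlinarith) (by simp)
  simp only [intervalIntegral.integral_zero, add_zero] at h
  have he0 : 0 ≤ energy α (u 0) := by
    unfold energy
    positivity
  have he1 : Real.exp (-(ν * lam1 L) * (t - 0)) ≤ 1 := by
    rw [Real.exp_le_one_iff]
    nlinarith [mul_pos hν hk]
  have he2 := Real.exp_pos (-(ν * lam1 L) * (t - 0))
  have h5 : M1 ν α f (u 0) = energy α (u 0) + c := by
    rw [hc]
    unfold M1 energy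
    field_simp
  rw [h5]
  nlinarith

theorem leray_gradNorm_sq_le (hν : 0 < ν) (hα : 0 < α) (hreg : IsRegular u u')
    (heq : LerayBalance ν α f u u')
    (hf : MemLp f ∞ (volume.restrict (Set.Ici (0 : ℝ)))) {t : ℝ} (ht : 0 ≤ t) :
    gradNorm (u t) ^ 2 ≤ M1 ν α f (u 0) / α ^ 2 := by
  rw [le_div_iff₀ (by positivity)]
  have h := leray_energy_le hν hreg heq hf ht
  unfold energy at h
  nlinarith [sq_nonneg ‖u t‖]

theorem IsStrong.intervalIntegrable_sq_stokes {y y' : ℝ → L2 L} (h : IsStrong y y') {a b : ℝ}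
    (ha : 0 ≤ a) (hab : a ≤ b) :
    IntervalIntegrable (fun s => ‖stokes (y s)‖ ^ 2) volume a b :=
  intervalIntegrable_of_integrable_Icc hab
    (memLp_restrict_Icc h.memLp_stokes ha hab).norm.integrable_sq

theorem IsStrong.intervalIntegrable_sq_deriv {y y' : ℝ → L2 L} (h : IsStrong y y') {a b : ℝ}
    (ha : 0 ≤ a) (hab : a ≤ b) :
    IntervalIntegrable (fun s => ‖y' s‖ ^ 2) volume a b :=
  intervalIntegrable_of_integrable_Icc hab
    (memLp_restrict_Icc h.memLp_deriv ha hab).norm.integrable_sq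

/-- The energy inequality integrated over one relaxation time 1/(νλ₁): the energy at the start is at
most M₁, that at the end is discarded, and the force contributes S/(νλ₁)². -/
theorem leray_integral_sq_stokes_le (hν : 0 < ν) (hα : 0 < α) (hreg : IsRegular u u')
    (heq : LerayBalance ν α f u u')
    (hf : MemLp f ∞ (volume.restrict (Set.Ici (0 : ℝ)))) {a : ℝ} (ha : 0 ≤ a) :
    ∫ s in a..(a + 1 / (ν * lam1 L)), ‖stokes (u s)‖ ^ 2 ≤
      M1 ν α f (u 0) / (ν * α ^ 2) + 1 / (ν ^ 3 * α ^ 2 * lam1 L ^ 2) * supSq f := by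
  have hk := lam1_pos (L := L)
  have hs := hreg.isStrong
  set T := 1 / (ν * lam1 L) with hT
  have hTpos : 0 < T := by positivity
  have hab : a ≤ a + T := by linarith
  obtain ⟨hi, he⟩ := hs.energy_identity α ha hab
  have hA := hs.intervalIntegrable_sq_stokes ha hab
  have hle : ∫ s in a..(a + T), 2 * inner ℝ (u' s) (helmholtz α (u s)) ≤
      ∫ s in a..(a + T), (-(ν * α ^ 2) * ‖stokes (u s)‖ ^ 2 + supSq f / (ν * lam1 L)) := by
    refine intervalIntegral.integral_mono_ae_restrict hab hi
      ((hA.const_mul _).add intervalIntegrable_const) ?_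
    filter_upwards [ae_restrict_of_Ici (leray_energy_inequality hν hreg heq hf)
      (fun s hs => ha.trans hs.1 : Set.Icc a (a + T) ⊆ Set.Ici 0)] with s h1
    have h2 : 0 ≤ ν * gradNorm (u s) ^ 2 := by positivity
    linarith
  have e : ∫ s in a..(a + T), (-(ν * α ^ 2) * ‖stokes (u s)‖ ^ 2 + supSq f / (ν * lam1 L)) =
      -(ν * α ^ 2) * (∫ s in a..(a + T), ‖stokes (u s)‖ ^ 2) + T * (supSq f / (ν * lam1 L)) := by
    rw [intervalIntegral.integral_add (hA.const_mul _) intervalIntegrable_const,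
      intervalIntegral.integral_const_mul, intervalIntegral.integral_const, smul_eq_mul,
      add_sub_cancel_left]
  rw [e] at hle
  have h0 : 0 ≤ energy α (u (a + T)) := by
    unfold energy
    positivity
  have h1 := leray_energy_le hν hreg heq hf ha
  have h2 : ν * α ^ 2 * ∫ s in a..(a + T), ‖stokes (u s)‖ ^ 2 ≤
      M1 ν α f (u 0) + T * (supSq f / (ν * lam1 L)) := by linarith
  rw [mul_comm, ← le_div_iff₀ (by positivity)] at h2
  refine h2.trans (le_of_eq ?_)
  rw [hT]
  field_simp

end Leray

/-! ### The time derivative of a Leray-`α` solution -/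

/-- The multiplier (1 + b²λ_K)⁻¹ gains two derivatives, because λ_K/(1 + b²λ_K) ≤ b⁻². -/
theorem exists_helmholtz_eq {b : ℝ} (hb : b ≠ 0) {y : L2 L} (hy : y ∈ Vdot L 0) :
    ∃ φ ∈ Vdot L 2, helmholtz b φ = y := by
  have hpos : ∀ K, 0 < 1 + b ^ 2 * eigen L K := fun K => by
    have := eigen_nonneg (L := L) K
    positivity
  have hs := (hasSum_norm_coeff y).summable
  have hle : ∀ K, ‖(((1 + b ^ 2 * eigen L K)⁻¹ : ℝ) : ℂ)‖ ^ 2 * ‖coeff y K‖ ^ 2 ≤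
      ‖coeff y K‖ ^ 2 := fun K => by
    refine mul_le_of_le_one_left (sq_nonneg _) ?_
    rw [Complex.norm_real, Real.norm_of_nonneg (inv_nonneg.mpr (hpos K).le)]
    refine pow_le_one₀ (inv_nonneg.mpr (hpos K).le) (inv_le_one_of_one_le₀ ?_)
    have := eigen_nonneg (L := L) K
    nlinarith [mul_nonneg (sq_nonneg b) this]
  have hc := fun K => coeff_multiplier (L := L) (u := y)
    (m := fun K => (((1 + b ^ 2 * eigen L K)⁻¹ : ℝ) : ℂ))
    (fun K => by rw [eigen_neg, Complex.conj_ofReal])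
    (Summable.of_nonneg_of_le (fun K => by positivity) hle hs) K
  set φ : L2 L := ofCoeff fun K => (((1 + b ^ 2 * eigen L K)⁻¹ : ℝ) : ℂ) • coeff y K
  have hφ : φ ∈ Vdot L 2 := by
    refine ⟨mem_Hdot_of_summable (by rw [hc, hy.1.1, smul_zero]) ?_, fun K => ?_⟩
    · refine Summable.of_nonneg_of_le (fun K => by
        have := eigen_nonneg (L := L) K
        positivity) (fun K => ?_) (hs.mul_left ((b ^ 2)⁻¹ ^ 2))
      have h0 := eigen_nonneg (L := L) K
      have hb2 : 0 < b ^ 2 := by positivity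
      rw [hc, norm_smul, Complex.norm_real, Real.norm_of_nonneg (inv_nonneg.mpr (hpos K).le),
        mul_pow, ← mul_assoc, ← mul_pow]
      gcongr
      rw [← div_eq_mul_inv, div_le_iff₀ (hpos K), inv_mul_eq_div, le_div_iff₀ hb2]
      linarith
    · simp only [hc, PiLp.smul_apply, smul_eq_mul, mul_left_comm _ (Complex.ofReal _),
        ← Finset.mul_sum, hy.2 K, mul_zero]
  refine ⟨φ, hφ, eq_of_coeff_eq fun K => ?_⟩
  rw [coeff_helmholtz b hφ.1, hc, smul_smul, ← Complex.ofReal_mul, mul_inv_cancel₀ (hpos K).ne',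
    Complex.ofReal_one, one_smul]

theorem norm_sq_helmholtz (b : ℝ) {u : L2 L} (hu : u ∈ Hdot L 2) :
    ‖helmholtz b u‖ ^ 2 = ‖u‖ ^ 2 + 2 * b ^ 2 * gradNorm u ^ 2 + (b ^ 2 * ‖stokes u‖) ^ 2 := by
  rw [helmholtz, norm_add_sq_real, inner_smul_right, real_inner_comm, inner_stokes_self hu,
    norm_smul, Real.norm_of_nonneg (sq_nonneg b)]
  ring

theorem norm_le_norm_helmholtz (b : ℝ) {u : L2 L} (hu : u ∈ Hdot L 2) :
    ‖u‖ ≤ ‖helmholtz b u‖ := by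
  refine le_of_sq_le_sq ?_ (norm_nonneg _)
  rw [norm_sq_helmholtz b hu]
  nlinarith [sq_nonneg (b * gradNorm u), sq_nonneg (b ^ 2 * ‖stokes u‖)]

theorem sq_mul_norm_stokes_le (b : ℝ) {u : L2 L} (hu : u ∈ Hdot L 2) :
    b ^ 2 * ‖stokes u‖ ≤ ‖helmholtz b u‖ := by
  refine le_of_sq_le_sq ?_ (norm_nonneg _)
  rw [norm_sq_helmholtz b hu]
  nlinarith [sq_nonneg (b * gradNorm u), sq_nonneg ‖u‖]

theorem inner_stokes_helmholtz_comm (b : ℝ) {u φ : L2 L} (hu : u ∈ Hdot L 2)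
    (hφ : φ ∈ Hdot L 2) :
    inner ℝ (stokes φ) (helmholtz b u) = inner ℝ (helmholtz b φ) (stokes u) := by
  simp only [helmholtz, inner_add_left, inner_add_right, inner_smul_left, inner_smul_right,
    inner_stokes_comm hφ hu]
  rfl

/-- Agmon's inequality with ‖u‖ replaced by λ₁^{-1/2}|Au|; the constant is λ₁^{-1/4}. -/
theorem ae_norm_le_stokes {u : L2 L} (hu : u ∈ Hdot L 2) :
    ∀ᵐ x, ‖u x‖ ≤ √((√(lam1 L))⁻¹) * ‖stokes u‖ := by
  have hk := Real.sqrt_pos.mpr (lam1_pos (L := L))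
  have h1 := Real.sqrt_le_sqrt (lam1_mul_sq_gradNorm_le hu)
  rw [Real.sqrt_mul lam1_pos.le, Real.sqrt_sq (gradNorm_nonneg u),
    Real.sqrt_sq (norm_nonneg _)] at h1
  filter_upwards [ae_norm_le_agmon hu] with x hx
  refine hx.trans ?_
  have h2 : gradNorm u * ‖stokes u‖ ≤ (√(lam1 L))⁻¹ * ‖stokes u‖ ^ 2 := by
    rw [pow_two, ← mul_assoc]
    gcongr
    rw [inv_mul_eq_div, le_div_iff₀ hk]
    linarith
  refine (Real.sqrt_le_sqrt h2).trans (le_of_eq ?_)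
  rw [Real.sqrt_mul (inv_nonneg.mpr hk.le), Real.sqrt_sq (norm_nonneg _)]

theorem abs_triForm_le_of_ae_le {v : L2 L} (u φ : L2 L) {C : ℝ} (hC : ∀ᵐ x, ‖v x‖ ≤ C) :
    |triForm v u φ| ≤ C * (‖φ‖ * gradNorm u) := by
  have hC0 : 0 ≤ C := by
    obtain ⟨x, hx⟩ := hC.exists
    exact (norm_nonneg _).trans hx
  have h1 := integral_mul_le_sqrt (Lp.memLp φ).norm (memLp_gradSize u) (fun _ => norm_nonneg _)
    (gradSize_nonneg u)
  rw [integral_norm_sq, integral_gradSize_sq, Real.sqrt_sq (norm_nonneg _),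
    Real.sqrt_sq (gradNorm_nonneg _)] at h1
  have hi : Integrable fun x => ‖φ x‖ * gradSize u x :=
    (Lp.memLp φ).norm.integrable_mul (memLp_gradSize u)
  rw [← Real.norm_eq_abs]
  calc ‖triForm v u φ‖ ≤ ∫ x, C * (‖φ x‖ * gradSize u x) := by
        refine norm_integral_le_of_norm_le (hi.const_mul C) ?_
        filter_upwards [hC] with x hx
        refine (norm_inner_le_norm _ _).trans ?_
        have h2 := gradSize_nonneg u x
        calc ‖advect v u x‖ * ‖φ x‖ ≤ C * gradSize u x * ‖φ x‖ := by
              gcongr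
              exact (norm_advect_le v u x).trans (by gcongr)
          _ = C * (‖φ x‖ * gradSize u x) := by ring
    _ = C * ∫ x, ‖φ x‖ * gradSize u x := integral_const_mul _ _
    _ ≤ _ := by gcongr

/-- The test field is φ = (I + α²A)⁻¹u', which turns the time derivative term into |u'|² and
satisfies |φ| ≤ |u'| and α²|Aφ| ≤ |u'|. In the nonlinearity the sup norm falls on u for the part
advected by u, and on φ for the part advected by α²Au; the factor α² is then used up by Aφ, so both
parts have the same bound. -/
theorem norm_deriv_le {ν α : ℝ} (hν : 0 < ν) (hα : 0 < α) {f u u' : L2 L} (hu : u ∈ Vdot L 2)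
    (hu' : u' ∈ Vdot L 0)
    (heq : ∀ K, ((1 + α ^ 2 * eigen L K : ℝ) : ℂ) • coeff u' K
      + ((ν * eigen L K : ℝ) : ℂ) • coeff (helmholtz α u) K
      + bilin (helmholtz α u) u K = coeff f K) :
    ‖u'‖ ≤ ‖f‖ + ν * ‖stokes u‖ + 2 * (√((√(lam1 L))⁻¹) * ‖stokes u‖ * gradNorm u) := by
  obtain ⟨φ, hφ, he⟩ := exists_helmholtz_eq hα.ne' hu'
  have h1 := tested_equation hφ heq (hasSum_re_inner_coeff φ f)
  rw [inner_stokes_helmholtz_comm α hu.1 hφ.1, he, real_inner_self_eq_norm_sq] at h1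
  have h2 : triForm (helmholtz α u) u φ = triForm u u φ + α ^ 2 * triForm (stokes u) u φ := by
    rw [helmholtz, triForm_add_left _ _ _ hφ.1, triForm_smul_left]
  have hφ1 := norm_le_norm_helmholtz α hφ.1
  have hφ2 := sq_mul_norm_stokes_le α hφ.1
  rw [he] at hφ1 hφ2
  have hU := gradNorm_nonneg u
  set q := √((√(lam1 L))⁻¹)
  have h3 : |triForm u u φ| ≤ q * ‖stokes u‖ * gradNorm u * ‖u'‖ := by
    refine (abs_triForm_le_of_ae_le u φ (ae_norm_le_stokes hu.1)).trans ?_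
    rw [mul_comm ‖φ‖, ← mul_assoc]
    gcongr
  have h4 : α ^ 2 * |triForm (stokes u) u φ| ≤ q * ‖stokes u‖ * gradNorm u * ‖u'‖ := by
    have h5 := abs_triForm_le (stokes u) u (ae_norm_le_stokes hφ.1)
    calc α ^ 2 * |triForm (stokes u) u φ|
        ≤ α ^ 2 * (q * ‖stokes φ‖ * (‖stokes u‖ * gradNorm u)) := by gcongr
      _ = q * ‖stokes u‖ * gradNorm u * (α ^ 2 * ‖stokes φ‖) := by ring
      _ ≤ _ := by gcongr
  have h6 : inner ℝ φ f ≤ ‖f‖ * ‖u'‖ := by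
    refine (real_inner_le_norm _ _).trans ?_
    rw [mul_comm]
    gcongr
  have h7 : -(ν * inner ℝ u' (stokes u)) ≤ ν * ‖stokes u‖ * ‖u'‖ := by
    have := neg_le_of_abs_le (abs_real_inner_le_norm u' (stokes u))
    nlinarith
  have h8 : -(α ^ 2 * triForm (stokes u) u φ) ≤ α ^ 2 * |triForm (stokes u) u φ| := by
    rw [← mul_neg]
    gcongr
    exact neg_le_abs _
  have h9 := neg_le_abs (triForm u u φ)
  rcases (norm_nonneg u').eq_or_lt with h0 | h0
  · rw [← h0]
    positivity
  · refine le_of_mul_le_mul_right ?_ h0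
    nlinarith

section Leray

variable {ν α : ℝ} {f u u' : ℝ → L2 L}

theorem leray_integral_sq_deriv_le (hν : 0 < ν) (hα : 0 < α) (hreg : IsRegular u u')
    (heq : LerayBalance ν α f u u')
    (hf : MemLp f ∞ (volume.restrict (Set.Ici (0 : ℝ)))) {a : ℝ} (ha : 0 ≤ a) :
    ∫ s in a..(a + 1 / (ν * lam1 L)), ‖u' s‖ ^ 2 ≤ 3 * supSq f / (ν * lam1 L) +
      (3 * ν ^ 2 + 12 * M1 ν α f (u 0) / (√(lam1 L) * α ^ 2)) *
        (M1 ν α f (u 0) / (ν * α ^ 2) + 1 / (ν ^ 3 * α ^ 2 * lam1 L ^ 2) * supSq f) := by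
  have hk := lam1_pos (L := L)
  have hM := M1_nonneg ν α f (u 0)
  have hs := hreg.isStrong
  have hY := leray_integral_sq_stokes_le hν hα hreg heq hf ha
  set T := 1 / (ν * lam1 L) with hT
  have hTpos : 0 < T := by positivity
  have hab : a ≤ a + T := by linarith
  have hA := hs.intervalIntegrable_sq_stokes ha hab
  set C := 3 * ν ^ 2 + 12 * M1 ν α f (u 0) / (√(lam1 L) * α ^ 2) with hC
  have hC0 : 0 ≤ C := by positivity
  have hsub : Set.Icc a (a + T) ⊆ Set.Ici 0 := fun s hs => ha.trans hs.1
  have hle : ∫ s in a..(a + T), ‖u' s‖ ^ 2 ≤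
      ∫ s in a..(a + T), (C * ‖stokes (u s)‖ ^ 2 + 3 * supSq f) := by
    refine intervalIntegral.integral_mono_ae_restrict hab (hs.intervalIntegrable_sq_deriv ha hab)
      ((hA.const_mul _).add intervalIntegrable_const) ?_
    filter_upwards [ae_restrict_of_Ici heq hsub, ae_restrict_of_Ici hreg.mem_DA hsub,
      ae_restrict_of_Ici hreg.deriv_mem_H hsub, ae_restrict_of_Ici (ae_sq_norm_le_supSq hf) hsub,
      ae_restrict_mem measurableSet_Icc] with s h1 h2 h3 h4 h5
    have h6 := norm_deriv_le hν hα h2 h3 h1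
    have h7 := leray_gradNorm_sq_le hν hα hreg heq hf (hsub h5)
    -- The square of a three-term sum is at most three times the sum of the squares; the doubled
    -- nonlinear term gives 3·4 = 12.
    set q := √((√(lam1 L))⁻¹)
    have hq : q ^ 2 = (√(lam1 L))⁻¹ := Real.sq_sqrt (by positivity)
    set A := ‖stokes (u s)‖
    have h8 : ‖u' s‖ ^ 2 ≤ (‖f s‖ + ν * A + 2 * (q * A * gradNorm (u s))) ^ 2 := by gcongr
    have h9 : (q * A * gradNorm (u s)) ^ 2 ≤ (√(lam1 L))⁻¹ * A ^ 2 *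
        (M1 ν α f (u 0) / α ^ 2) := by
      rw [mul_pow, mul_pow, hq]
      gcongr
    have e : C * A ^ 2 = 3 * (ν * A) ^ 2 +
        12 * ((√(lam1 L))⁻¹ * A ^ 2 * (M1 ν α f (u 0) / α ^ 2)) := by
      rw [hC]
      field_simp
    rw [e]
    nlinarith [sq_nonneg (‖f s‖ - ν * A), sq_nonneg (‖f s‖ - 2 * (q * A * gradNorm (u s))),
      sq_nonneg (ν * A - 2 * (q * A * gradNorm (u s)))]
  have e : ∫ s in a..(a + T), (C * ‖stokes (u s)‖ ^ 2 + 3 * supSq f) =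
      C * (∫ s in a..(a + T), ‖stokes (u s)‖ ^ 2) + T * (3 * supSq f) := by
    rw [intervalIntegral.integral_add (hA.const_mul _) intervalIntegrable_const,
      intervalIntegral.integral_const_mul, intervalIntegral.integral_const, smul_eq_mul,
      add_sub_cancel_left]
  rw [e] at hle
  have h1 := mul_le_mul_of_nonneg_left hY hC0
  have h2 : T * (3 * supSq f) = 3 * supSq f / (ν * lam1 L) := by
    rw [hT]
    ring
  linarith

end Leray

/-! ### The difference of the two solutions -/

theorem hasSum_nudging (β η : ℝ) (f i : L2 L) {g : L2 L} (hg : g ∈ Vdot L 2) :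
    HasSum (fun K => (inner ℂ (coeff g K)
      (coeff f K - ((η * (1 + β ^ 2 * eigen L K) : ℝ) : ℂ) • leray (coeff i) K)).re)
      ((L ^ 3)⁻¹ * (inner ℝ g f - η * inner ℝ (helmholtz β g) i)) := by
  have h := (hasSum_re_inner_coeff g f).sub
    ((hasSum_re_inner_coeff (helmholtz β g) i).mul_left η)
  have e : (L ^ 3)⁻¹ * inner ℝ g f - η * ((L ^ 3)⁻¹ * inner ℝ (helmholtz β g) i) =
      (L ^ 3)⁻¹ * (inner ℝ g f - η * inner ℝ (helmholtz β g) i) := by ring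
  rw [e] at h
  refine h.congr_fun fun K => ?_
  rw [inner_sub_right, inner_smul_right, inner_leray_of_mem (Vdot_mono (by norm_num) hg),
    coeff_helmholtz β hg.1, inner_smul_left, Complex.conj_ofReal, Complex.sub_re,
    Complex.re_ofReal_mul, Complex.re_ofReal_mul]
  ring

/-- Two operators I + α²A and I + β²A are present. All terms are arranged around I + β²A acting on
g, and each mismatch leaves a term with the factor β² - α². The force cancels, and so does B(z, g)
after pairing with g. -/
theorem difference_balance {ν α β η : ℝ} {f u u' w w' i : L2 L}
    (hu : u ∈ Vdot L 2) (hw : w ∈ Vdot L 2)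
    (hequ : ∀ K, ((1 + α ^ 2 * eigen L K : ℝ) : ℂ) • coeff u' K
      + ((ν * eigen L K : ℝ) : ℂ) • coeff (helmholtz α u) K
      + bilin (helmholtz α u) u K = coeff f K)
    (heqw : ∀ K, ((1 + β ^ 2 * eigen L K : ℝ) : ℂ) • coeff w' K
      + ((ν * eigen L K : ℝ) : ℂ) • coeff (helmholtz β w) K
      + bilin (helmholtz β w) w K =
        coeff f K - ((η * (1 + β ^ 2 * eigen L K) : ℝ) : ℂ) • leray (coeff i) K) :
    inner ℝ (w' - u') (helmholtz β (w - u)) + (β ^ 2 - α ^ 2) * inner ℝ u' (stokes (w - u)) +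
      ν * (gradNorm (w - u) ^ 2 + β ^ 2 * ‖stokes (w - u)‖ ^ 2) +
      ν * (β ^ 2 - α ^ 2) * inner ℝ (stokes u) (stokes (w - u)) +
      triForm (w - u) u (w - u) + β ^ 2 * triForm (stokes (w - u)) u (w - u) +
      (β ^ 2 - α ^ 2) * triForm (stokes u) u (w - u) =
      -η * inner ℝ (helmholtz β (w - u)) i := by
  have hg : w - u ∈ Vdot L 2 := sub_mem hw hu
  have h1 := tested_equation hg hequ (hasSum_re_inner_coeff (w - u) f)
  have h2 := tested_equation hg heqw (hasSum_nudging β η f i hg)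
  have h3 := triForm_sub_middle (helmholtz β w) (Hdot_mono one_le_two hw.1)
    (Hdot_mono one_le_two hu.1) hg.1
  rw [triForm_self_eq_zero (helmholtz_mem β hw) hg.1] at h3
  have hA : stokes w = stokes (w - u) + stokes u := by
    rw [stokes_sub hw.1 hu.1, sub_add_cancel]
  have e1 : helmholtz β w =
      helmholtz α u + (w - u) + β ^ 2 • stokes (w - u) + (β ^ 2 - α ^ 2) • stokes u := by
    rw [helmholtz, helmholtz, hA]
    module
  have e2 : helmholtz β w = helmholtz α u + helmholtz β (w - u) + (β ^ 2 - α ^ 2) • stokes u := by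
    rw [e1, helmholtz, helmholtz]
    module
  have e3 : helmholtz α (w - u) = helmholtz β (w - u) - (β ^ 2 - α ^ 2) • stokes (w - u) := by
    rw [helmholtz, helmholtz]
    module
  have h4 : triForm (helmholtz β w) u (w - u) = triForm (helmholtz α u) u (w - u) +
      triForm (w - u) u (w - u) + β ^ 2 * triForm (stokes (w - u)) u (w - u) +
      (β ^ 2 - α ^ 2) * triForm (stokes u) u (w - u) := by
    rw [e1, triForm_add_left _ _ _ hg.1, triForm_add_left _ _ _ hg.1,
      triForm_add_left _ _ _ hg.1, triForm_smul_left, triForm_smul_left]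
  have h5 : inner ℝ (stokes (w - u)) (helmholtz β w) =
      inner ℝ (stokes (w - u)) (helmholtz α u) +
      (gradNorm (w - u) ^ 2 + β ^ 2 * ‖stokes (w - u)‖ ^ 2) +
      (β ^ 2 - α ^ 2) * inner ℝ (stokes u) (stokes (w - u)) := by
    rw [e2, inner_add_right, inner_add_right, inner_smul_right, inner_stokes_helmholtz β hg.1,
      real_inner_comm (stokes u)]
  have h6 : inner ℝ (helmholtz α (w - u)) u' = inner ℝ (helmholtz β (w - u)) u' -
      (β ^ 2 - α ^ 2) * inner ℝ u' (stokes (w - u)) := by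
    rw [e3, inner_sub_left, real_inner_smul_left, real_inner_comm u' (stokes (w - u))]
  rw [inner_sub_left, real_inner_comm (helmholtz β (w - u)) w',
    real_inner_comm (helmholtz β (w - u)) u']
  rw [h5] at h2
  rw [h6] at h1
  linear_combination h2 - h1 + h3 - h4

/-! ### Absorption of the perturbation terms -/

theorem mul_le_weighted_sq {s : ℝ} (hs : 0 < s) (a b : ℝ) :
    a * b ≤ s * a ^ 2 + b ^ 2 / (4 * s) := by
  have e : s * a ^ 2 + b ^ 2 / (4 * s) - a * b = (2 * s * a - b) ^ 2 / (4 * s) := by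
    field_simp
    ring
  rw [← sub_nonneg, e]
  positivity

/-- Young's inequality with exponents 4/3 and 4 for m^{1/2}X^{3/2}U, obtained from the quadratic one
used twice: first on X·√(mX)U, then on X·mU². -/
theorem mul_sqrt_mul_cube_le {s : ℝ} (hs : 0 < s) {m X : ℝ} (hm : 0 ≤ m) (hX : 0 ≤ X) (U : ℝ) :
    √(m * X ^ 3) * U ≤ 2 * s * X ^ 2 + U ^ 4 * m ^ 2 / (64 * s ^ 3) := by
  have e : √(m * X ^ 3) = X * √(m * X) := by
    rw [show m * X ^ 3 = X ^ 2 * (m * X) by ring, Real.sqrt_mul (sq_nonneg X), Real.sqrt_sq hX]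
  have h1 := mul_le_weighted_sq hs X (√(m * X) * U)
  have h2 := mul_le_weighted_sq (s := 4 * s ^ 2) (by positivity) X (m * U ^ 2)
  rw [mul_pow, Real.sq_sqrt (by positivity)] at h1
  have h3 : m * X * U ^ 2 / (4 * s) ≤
      (4 * s ^ 2 * X ^ 2 + (m * U ^ 2) ^ 2 / (4 * (4 * s ^ 2))) / (4 * s) := by
    gcongr
    linarith
  have e2 : (4 * s ^ 2 * X ^ 2 + (m * U ^ 2) ^ 2 / (4 * (4 * s ^ 2))) / (4 * s) =
      s * X ^ 2 + U ^ 4 * m ^ 2 / (64 * s ^ 3) := by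
    field_simp
    ring
  rw [e]
  linarith

/-- Here m, x, y stand for |g|, ‖g‖, |Ag|; p, a, U for |u'|, |Au|, ‖u‖; d for the interpolation
error and D for |β² - α²|. The Young weights are budgeted on νβ²y²: 1/10 for each of the first two
source terms and for the third, 1/8 for the trilinear term with Ag, 1/5 for the nudging error paired
with β²Ag, and 1/8 from half of `hd`. They add up to exactly 3/4. -/
theorem perturbation_le {ν β η D m x y p a U d : ℝ} (hν : 0 < ν) (hβ : 0 < β) (hη : 0 < η)
    (hm : 0 ≤ m) (hx : 0 ≤ x) (hy : 0 ≤ y)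
    (hU : 128 * 18 ^ 6 * (U ^ 4 / ν ^ 3) ≤ η)
    (hd : (η + 5 * η ^ 2 * β ^ 2 / (2 * ν)) * d ^ 2 ≤
      (ν / 4 + η * β ^ 2) * x ^ 2 + ν * β ^ 2 / 4 * y ^ 2) :
    D * (p * y) + ν * D * (a * y) + √(m * (18 * x) ^ 3) * U +
      β ^ 2 * (√(x * y) * (y * U)) + D * (√(x * y) * (a * U)) + η * ((m + β ^ 2 * y) * d) ≤
      3 / 4 * ν * (x ^ 2 + β ^ 2 * y ^ 2) + η * (m ^ 2 + β ^ 2 * x ^ 2) +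
      (5 / 2 * D ^ 2 / (ν * β ^ 2) * p ^ 2 +
        (5 / 2 * ν * D ^ 2 / β ^ 2 + 5 / 4 * D ^ 2 * U ^ 2 / (ν * β)) * a ^ 2) := by
  have h1 := mul_le_weighted_sq (s := ν * β ^ 2 / 10) (by positivity) y (D * p)
  have h2 := mul_le_weighted_sq (s := ν * β ^ 2 / 10) (by positivity) y (ν * D * a)
  have h3 := mul_le_weighted_sq (s := ν * β / 5) (by positivity) (√(x * y)) (D * a * U)
  rw [Real.sq_sqrt (by positivity)] at h3
  -- With X = 18x and 5184 = 16·18², the term 2sX² is νx²/8.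
  have h4 := mul_sqrt_mul_cube_le (s := ν / 5184) (by positivity) hm
    (mul_nonneg (by norm_num : (0 : ℝ) ≤ 18) hx) U
  have h5 := mul_le_mul_of_nonneg_left
    (mul_sqrt_mul_cube_le (s := ν / 16) (by positivity) hx hy U) (sq_nonneg β)
  have h6 := mul_le_weighted_sq (s := ν * β ^ 2 / 5) (by positivity) y (η * β ^ 2 * d)
  have e1 : (D * p) ^ 2 / (4 * (ν * β ^ 2 / 10)) = 5 / 2 * D ^ 2 / (ν * β ^ 2) * p ^ 2 := by
    field_simp
    ring
  have e2 : (ν * D * a) ^ 2 / (4 * (ν * β ^ 2 / 10)) = 5 / 2 * ν * D ^ 2 / β ^ 2 * a ^ 2 := by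
    field_simp
    ring
  have e3 : (D * a * U) ^ 2 / (4 * (ν * β / 5)) = 5 / 4 * D ^ 2 * U ^ 2 / (ν * β) * a ^ 2 := by
    field_simp
  have e4 : U ^ 4 * m ^ 2 / (64 * (ν / 5184) ^ 3) = 64 * 18 ^ 6 * (U ^ 4 / ν ^ 3) * m ^ 2 := by
    field_simp
    ring
  have e5 : U ^ 4 * x ^ 2 / (64 * (ν / 16) ^ 3) = 64 * (U ^ 4 / ν ^ 3) * x ^ 2 := by
    field_simp
    norm_num
  have e6 : (η * β ^ 2 * d) ^ 2 / (4 * (ν * β ^ 2 / 5)) = 5 * η ^ 2 * β ^ 2 / (4 * ν) * d ^ 2 := by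
    field_simp
  have e7 : √(x * y) * y = √(x * y ^ 3) := by
    rw [show x * y ^ 3 = x * y * y ^ 2 by ring, Real.sqrt_mul (mul_nonneg hx hy),
      Real.sqrt_sq hy]
  have e8 : (η + 5 * η ^ 2 * β ^ 2 / (2 * ν)) * d ^ 2 =
      η * d ^ 2 + 2 * (5 * η ^ 2 * β ^ 2 / (4 * ν) * d ^ 2) := by
    field_simp
    ring
  rw [e1] at h1
  rw [e2] at h2
  rw [e3] at h3
  rw [e4] at h4
  rw [e5, ← e7] at h5
  rw [e6] at h6
  rw [e8] at hd
  have h7 : ν * β / 5 * (x * y) ≤ ν / 10 * (x ^ 2 + β ^ 2 * y ^ 2) := by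
    linear_combination mul_nonneg hν.le (sq_nonneg (x - β * y)) / 10
  have h10 : 0 ≤ U ^ 4 / ν ^ 3 := by positivity
  have h8 : 64 * 18 ^ 6 * (U ^ 4 / ν ^ 3) * m ^ 2 ≤ η / 2 * m ^ 2 :=
    mul_le_mul_of_nonneg_right (by linarith) (sq_nonneg m)
  have h9 : 64 * (U ^ 4 / ν ^ 3) * x ^ 2 ≤ η / 2 * x ^ 2 :=
    mul_le_mul_of_nonneg_right (by linarith) (sq_nonneg x)
  have h11 := mul_le_mul_of_nonneg_left h9 (sq_nonneg β)
  have h12 : η * (m * d) ≤ η / 2 * m ^ 2 + η / 2 * d ^ 2 := by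
    linear_combination mul_nonneg hη.le (sq_nonneg (m - d)) / 2
  have h13 : 0 ≤ ν * x ^ 2 := by positivity
  -- On νx² only 1/10 + 1/8 + 1/8 = 7/20 is spent, and `h13` fills the gap to 3/4. The terms ηm² and
  -- ηβ²x² are each used up in two halves.
  linear_combination h1 + h2 + h3 + h4 + h5 + h6 + h7 + h8 + h11 + h12 + hd / 2 + 2 / 5 * h13

/-- Splitting i = g + (i - g) extracts the damping η(|g|² + β²‖g‖²) from the nudging. Absorption
uses all of it and three quarters of the viscosity. Doubling the remaining quarter and applying
Poincaré's inequality gives the rate νλ₁/2. -/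
theorem difference_inequality {ν α β η : ℝ} (hν : 0 < ν) (hβ : 0 < β) (hη : 0 < η)
    {f u u' w w' i : L2 L} (hu : u ∈ Vdot L 2) (hw : w ∈ Vdot L 2)
    (hequ : ∀ K, ((1 + α ^ 2 * eigen L K : ℝ) : ℂ) • coeff u' K
      + ((ν * eigen L K : ℝ) : ℂ) • coeff (helmholtz α u) K
      + bilin (helmholtz α u) u K = coeff f K)
    (heqw : ∀ K, ((1 + β ^ 2 * eigen L K : ℝ) : ℂ) • coeff w' K
      + ((ν * eigen L K : ℝ) : ℂ) • coeff (helmholtz β w) K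
      + bilin (helmholtz β w) w K =
        coeff f K - ((η * (1 + β ^ 2 * eigen L K) : ℝ) : ℂ) • leray (coeff i) K)
    (hU : 128 * 18 ^ 6 * (gradNorm u ^ 4 / ν ^ 3) ≤ η)
    (hd : (η + 5 * η ^ 2 * β ^ 2 / (2 * ν)) * ‖i - (w - u)‖ ^ 2 ≤
      (ν / 4 + η * β ^ 2) * gradNorm (w - u) ^ 2 + ν * β ^ 2 / 4 * ‖stokes (w - u)‖ ^ 2) :
    2 * inner ℝ (w' - u') (helmholtz β (w - u)) ≤ -(ν * lam1 L / 2) * energy β (w - u) +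
      (5 * |β ^ 2 - α ^ 2| ^ 2 / (ν * β ^ 2) * ‖u'‖ ^ 2 +
        (5 * ν * |β ^ 2 - α ^ 2| ^ 2 / β ^ 2 +
          5 / 2 * |β ^ 2 - α ^ 2| ^ 2 * gradNorm u ^ 2 / (ν * β)) * ‖stokes u‖ ^ 2) := by
  have hg : w - u ∈ Vdot L 2 := sub_mem hw hu
  have h0 := difference_balance hu hw hequ heqw
  have hκ := lam1_mul_energy_le β hg.1
  set g := w - u
  have h1 := perturbation_le (D := |β ^ 2 - α ^ 2|) (p := ‖u'‖) (a := ‖stokes u‖) hν hβ hη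
    (norm_nonneg g) (gradNorm_nonneg g) (norm_nonneg (stokes g)) hU hd
  set D := β ^ 2 - α ^ 2
  have hD : 0 ≤ |D| := abs_nonneg D
  have neg_mul_le : ∀ {r X : ℝ}, |r| ≤ X → -(D * r) ≤ |D| * X := fun {r X} hr => by
    refine (neg_le_abs _).trans ?_
    rw [abs_mul]
    gcongr
  have t1 := neg_mul_le (abs_real_inner_le_norm u' (stokes g))
  have t2 := mul_le_mul_of_nonneg_left
    (neg_mul_le (abs_real_inner_le_norm (stokes u) (stokes g))) hν.le
  have t3 := (neg_le_abs _).trans (abs_triForm_diag_le hg.1 u)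
  have t4 := mul_le_mul_of_nonneg_left ((neg_le_abs _).trans
    (abs_triForm_le (stokes g) u (ae_norm_le_agmon hg.1))) (sq_nonneg β)
  have t5 := neg_mul_le (abs_triForm_le (stokes u) u (ae_norm_le_agmon hg.1))
  have e6 : inner ℝ (helmholtz β g) i =
      ‖g‖ ^ 2 + β ^ 2 * gradNorm g ^ 2 + inner ℝ (helmholtz β g) (i - g) := by
    rw [inner_sub_right, helmholtz, inner_add_left (x := g) (z := g), real_inner_self_eq_norm_sq,
      real_inner_smul_left, inner_stokes_self hg.1]
    ring
  have t6 : -inner ℝ (helmholtz β g) (i - g) ≤ (‖g‖ + β ^ 2 * ‖stokes g‖) * ‖i - g‖ := by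
    refine (neg_le_abs _).trans ((abs_real_inner_le_norm _ _).trans ?_)
    gcongr
    refine (norm_add_le _ _).trans (le_of_eq ?_)
    rw [norm_smul, Real.norm_of_nonneg (sq_nonneg β)]
  have t7 := mul_le_mul_of_nonneg_left t6 hη.le
  have t8 := mul_le_mul_of_nonneg_left hκ hν.le
  rw [e6] at h0
  have e7 : 5 * |D| ^ 2 / (ν * β ^ 2) = 2 * (5 / 2 * |D| ^ 2 / (ν * β ^ 2)) := by ring
  have e8 : 5 * ν * |D| ^ 2 / β ^ 2 + 5 / 2 * |D| ^ 2 * gradNorm u ^ 2 / (ν * β) =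
      2 * (5 / 2 * ν * |D| ^ 2 / β ^ 2 + 5 / 4 * |D| ^ 2 * gradNorm u ^ 2 / (ν * β)) := by ring
  rw [e7, e8]
  linear_combination 2 * h0 + 2 * t1 + 2 * t2 + 2 * t3 + 2 * t4 + 2 * t5 + 2 * t7 +
    t8 / 2 + 2 * h1

/-- The left side is the window integral of the forcing. It matches M_α term by term once 2 ≤
c²/(16π⁴), guaranteed by π ≤ 4 and the size of c. Half of the viscous 6Y contribution and the term
in M² are spare. -/
theorem Malpha_bound {c ν α β κ M S : ℝ} (hc : 1000 ≤ c) (hν : 0 < ν) (hα : 0 < α) (hβ : 0 < β)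
    (hκ : 0 < κ) (hM : 0 ≤ M) (hS : 0 ≤ S) :
    5 * |β ^ 2 - α ^ 2| ^ 2 / (ν * β ^ 2) * (3 * S / (ν * κ) +
        (3 * ν ^ 2 + 12 * M / (√κ * α ^ 2)) *
          (M / (ν * α ^ 2) + 1 / (ν ^ 3 * α ^ 2 * κ ^ 2) * S)) +
      (5 * ν * |β ^ 2 - α ^ 2| ^ 2 / β ^ 2 +
        5 / 2 * |β ^ 2 - α ^ 2| ^ 2 * (M / α ^ 2) / (ν * β)) *
          (M / (ν * α ^ 2) + 1 / (ν ^ 3 * α ^ 2 * κ ^ 2) * S) ≤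
      Malpha c ν α β κ M S := by
  set D := |β ^ 2 - α ^ 2| ^ 2
  have hD : 0 ≤ D := sq_nonneg _
  have hk := Real.sqrt_pos.mpr hκ
  have hpi := Real.pi_pos
  unfold Malpha
  set Y := M / (ν * α ^ 2) + 1 / (ν ^ 3 * α ^ 2 * κ ^ 2) * S with hY
  have hY0 : 0 ≤ Y := by positivity
  have e1 : 6 * M / (ν * α ^ 2) + 6 / (ν ^ 3 * κ ^ 2 * α ^ 2) * S = 6 * Y := by
    rw [hY]
    ring
  have e2 : M / (ν * α ^ 2) + 1 / (κ ^ 2 * ν ^ 3 * α ^ 2) * S = Y := by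
    rw [hY]
    ring
  rw [e1, e2]
  have h1 : 2 * M / (√κ * α ^ 2) ≤ c ^ 2 * M / (16 * Real.pi ^ 4 * √κ * α ^ 2) := by
    have h2 : Real.pi ^ 4 ≤ 4 ^ 4 := by
      gcongr
      exact Real.pi_le_four
    have e : c ^ 2 * M / (16 * Real.pi ^ 4 * √κ * α ^ 2) =
        c ^ 2 / (16 * Real.pi ^ 4) * M / (√κ * α ^ 2) := by
      field_simp
    rw [e]
    gcongr
    rw [le_div_iff₀ (by positivity)]
    nlinarith
  have h3 : M / (2 * ν * α ^ 2) ≤ c ^ 2 * M / (2 * ν * α ^ 2) := by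
    gcongr
    exact le_mul_of_one_le_left hM (by nlinarith)
  have h4 : 0 ≤ 3 * c ^ 2 * M ^ 2 / (16 * ν ^ 2 * β * Real.pi ^ 4 * α ^ 6 * (κ * √κ)) := by
    positivity
  have h5 : 1 / (ν * β) * (6 * Y) * (ν ^ 2 + 2 * M / (√κ * α ^ 2)) ≤
      1 / (ν * β) * (6 * Y) * (ν ^ 2 + c ^ 2 * M / (16 * Real.pi ^ 4 * √κ * α ^ 2)) := by
    gcongr
  have h6 := mul_le_mul_of_nonneg_right h3 hY0
  have h7 : 0 ≤ 1 / (ν * β) * (3 * Y) * ν ^ 2 := by positivity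
  calc _ = 5 * D / β * (1 / (ν * β) * (6 * Y) * (ν ^ 2 + 2 * M / (√κ * α ^ 2)) -
        1 / (ν * β) * (3 * Y) * ν ^ 2 + 3 / (ν ^ 2 * κ * β) * S + ν / β * Y +
        M / (2 * ν * α ^ 2) * Y) := by
        field_simp
        ring
    _ ≤ _ := by
        gcongr
        linarith

end MLAlpha

end

/-! ### The main theorem. -/

open MLAlpha

theorem theorem3p2 :
    ∃ c : ℝ, 0 < c ∧
      (∀ (L : ℝ) [Fact (0 < L)], GagliardoNirenberg L c) ∧
      ∀ (L : ℝ) [Fact (0 < L)] (ν α β η h c₁ c₂ : ℝ),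
        0 < ν → 0 < α → 0 < β → 0 < η → 0 < h → 0 < c₁ → 0 < c₂ →
        ∀ (Ih : Hdot L 2 →ₗ[ℝ] Hdot L 0), IsInterpolant h c₁ c₂ Ih →
        ∀ (f : ℝ → L2 L), MemLp f ∞ (volume.restrict (Set.Ici (0 : ℝ))) →
          (∀ᵐ t ∂(volume.restrict (Set.Ici (0 : ℝ))), f t ∈ Vdot L 0) →
        ∀ (u₀ w₀ : L2 L), u₀ ∈ Vdot L 1 → w₀ ∈ Vdot L 1 →
        ∀ (u w : ℝ → L2 L), IsMLSolution ν α f u₀ u → IsCDASolution ν β η Ih f u w₀ w →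
          3 * η / 4 - 15 ^ 3 * M1 ν α f u₀ ^ 2 * c ^ 4 / (2 ^ 11 * ν ^ 3 * α ^ 4) > 0 →
          η * c₁ ^ 2 * h ^ 2 + 5 * η ^ 2 * β ^ 2 / (2 * ν) * c₁ ^ 2 * h ^ 2
            + 30 ^ 3 * c ^ 4 * M1 ν α f u₀ ^ 2 / (4 ^ 4 * ν ^ 3 * α ^ 4) - η * β ^ 2 < ν / 4 →
          η * c₂ ^ 2 * h ^ 4 + 5 * c₂ ^ 2 * η ^ 2 * β ^ 2 * h ^ 4 / (2 * ν) < ν * β ^ 2 / 4 →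
          ∀ t : ℝ, 0 ≤ t →
            ‖w t - u t‖ ^ 2 + β ^ 2 * gradNorm (w t - u t) ^ 2 ≤
              Real.exp (-(lam1 L * ν * t) / 2) *
                  (‖w 0 - u 0‖ ^ 2 + β ^ 2 * gradNorm (w 0 - u 0) ^ 2)
                + Malpha c ν α β (lam1 L) (M1 ν α f u₀) (supSq f) *
                  (Real.exp 1 / (Real.exp (1 / 2) - 1)) := by
  refine ⟨1000, by norm_num, fun L _ => gagliardoNirenberg (by norm_num), ?_⟩
  intro L _ ν α β η h c₁ c₂ hν hα hβ hη _ _ _ Ih hIh f hf _ u₀ w₀ _ _ u w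
    ⟨hu0, u', hureg, hueq⟩ ⟨_, w', hwreg, hweq⟩ hyp1 hyp2 hyp3 t ht
  subst hu0
  have hκ := lam1_pos (L := L)
  have hM := M1_nonneg ν α f (u 0)
  have hS := supSq_nonneg f
  have hg := hwreg.isStrong.sub hureg.isStrong
  set D := |β ^ 2 - α ^ 2| ^ 2 with hD
  have hD0 : 0 ≤ D := sq_nonneg _
  set p₁ := 5 * D / (ν * β ^ 2) with hp₁
  set p₂ := 5 * ν * D / β ^ 2 + 5 / 2 * D * (M1 ν α f (u 0) / α ^ 2) / (ν * β) with hp₂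
  have hp₁0 : 0 ≤ p₁ := by positivity
  have hp₂0 : 0 ≤ p₂ := by positivity
  have hbound := Malpha_bound (c := 1000) (S := supSq f) le_rfl hν hα hβ hκ hM hS
  have hMα : 0 ≤ Malpha 1000 ν α β (lam1 L) (M1 ν α f (u 0)) (supSq f) :=
    le_trans (by positivity) hbound
  have hΦ : ∀ a b, 0 ≤ a → a ≤ b →
      IntervalIntegrable (fun s => p₁ * ‖u' s‖ ^ 2 + p₂ * ‖stokes (u s)‖ ^ 2) volume a b :=
    fun a b ha hab => ((hureg.isStrong.intervalIntegrable_sq_deriv ha hab).const_mul _).add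
      ((hureg.isStrong.intervalIntegrable_sq_stokes ha hab).const_mul _)
  -- Rate νλ₁/2 and window 1/(νλ₁) have product 1/2, whatever the data.
  have key := gronwall_window (E := fun s => energy β (w s - u s))
    (ψ := fun s => 2 * inner ℝ (w' s - u' s) (helmholtz β (w s - u s)))
    (Φ := fun s => p₁ * ‖u' s‖ ^ 2 + p₂ * ‖stokes (u s)‖ ^ 2)
    (κ := ν * lam1 L / 2) (T := 1 / (ν * lam1 L)) (by positivity) (by positivity) hMα
    (fun a b ha hab => (hg.energy_identity β ha hab).1) hΦ
    (fun a b ha hab => (hg.energy_identity β ha hab).2) ?_ (fun s => by positivity) ?_ ht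
  · have e1 : Real.exp (-(ν * lam1 L / 2) * t) = Real.exp (-(lam1 L * ν * t) / 2) := by
      congr 1
      ring
    have e2 : -(ν * lam1 L / 2) * (1 / (ν * lam1 L)) = -(1 / 2) := by
      field_simp
    have h1 : 1 < Real.exp (1 / 2) := Real.one_lt_exp_iff.mpr (by norm_num)
    have h2 : Real.exp (1 / 2) ≤ Real.exp 1 := Real.exp_le_exp.mpr (by norm_num)
    -- The left side equals e^{1/2}/(e^{1/2} - 1); the stated bound is larger by a factor e^{1/2}.
    have h3 : 1 / (1 - Real.exp (-(1 / 2))) ≤ Real.exp 1 / (Real.exp (1 / 2) - 1) := by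
      rw [Real.exp_neg, ← one_div, one_sub_div (by positivity), one_div_div]
      gcongr
    rw [e1, e2, div_eq_mul_one_div (Malpha _ _ _ _ _ _ _)] at key
    exact key.trans (by gcongr; exact le_rfl)
  · filter_upwards [hureg.mem_DA, hwreg.mem_DA, hueq, hweq,
      ae_restrict_mem measurableSet_Ici] with s h1 h2 h3 ⟨hw2, hu2, h4⟩ hs
    have hG := leray_gradNorm_sq_le hν hα hureg hueq hf hs
    -- Linearity of the interpolant turns its error bound for g into one for I_h w - I_h u - g.
    have hi := hIh (⟨w s, hw2⟩ - ⟨u s, hu2⟩)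
    rw [map_sub] at hi
    -- Hypothesis 1 with ‖u‖² ≤ M₁/α²; c = 1000 is large enough that 15³c⁴/2¹¹ exceeds
    -- (3/4)·128·18⁶.
    have hU : 128 * 18 ^ 6 * (gradNorm (u s) ^ 4 / ν ^ 3) ≤ η := by
      have h5 : gradNorm (u s) ^ 4 ≤ (M1 ν α f (u 0) / α ^ 2) ^ 2 := by
        rw [show gradNorm (u s) ^ 4 = (gradNorm (u s) ^ 2) ^ 2 by ring]
        gcongr
      have h6 : gradNorm (u s) ^ 4 / ν ^ 3 ≤ (M1 ν α f (u 0) / α ^ 2) ^ 2 / ν ^ 3 := by gcongr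
      have e : 15 ^ 3 * M1 ν α f (u 0) ^ 2 * 1000 ^ 4 / (2 ^ 11 * ν ^ 3 * α ^ 4) =
          15 ^ 3 * 1000 ^ 4 / 2 ^ 11 * ((M1 ν α f (u 0) / α ^ 2) ^ 2 / ν ^ 3) := by
        field_simp
      have h7 : 0 ≤ (M1 ν α f (u 0) / α ^ 2) ^ 2 / ν ^ 3 := by positivity
      rw [e] at hyp1
      linarith
    have hd : (η + 5 * η ^ 2 * β ^ 2 / (2 * ν)) *
        ‖((Ih ⟨w s, hw2⟩ : L2 L) - (Ih ⟨u s, hu2⟩ : L2 L)) - (w s - u s)‖ ^ 2 ≤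
        (ν / 4 + η * β ^ 2) * gradNorm (w s - u s) ^ 2 +
          ν * β ^ 2 / 4 * ‖stokes (w s - u s)‖ ^ 2 := by
      refine (mul_le_mul_of_nonneg_left hi (by positivity)).trans ?_
      -- The M₁ term of hypothesis 2 is nonnegative and is discarded; the trilinear terms have been
      -- charged to hypothesis 1.
      have h5 : 0 ≤ 30 ^ 3 * 1000 ^ 4 * M1 ν α f (u 0) ^ 2 / (4 ^ 4 * ν ^ 3 * α ^ 4) := by
        positivity
      have h6 : (η + 5 * η ^ 2 * β ^ 2 / (2 * ν)) * (c₁ ^ 2 * h ^ 2) ≤ ν / 4 + η * β ^ 2 := by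
        linarith
      have h7 : (η + 5 * η ^ 2 * β ^ 2 / (2 * ν)) * (c₂ ^ 2 * h ^ 4) ≤ ν * β ^ 2 / 4 := by
        refine le_trans (le_of_eq ?_) hyp3.le
        ring
      rw [mul_add, ← mul_assoc _ (c₁ ^ 2 * h ^ 2), ← mul_assoc _ (c₂ ^ 2 * h ^ 4)]
      exact add_le_add (mul_le_mul_of_nonneg_right h6 (sq_nonneg _))
        (mul_le_mul_of_nonneg_right h7 (sq_nonneg _))
    refine (difference_inequality hν hβ hη h1 h2 h3 h4 hU hd).trans ?_
    rw [← hD, ← hp₁, hp₂]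
    gcongr
  · intro a ha
    have hT : 0 < 1 / (ν * lam1 L) := by positivity
    have hab : a ≤ a + 1 / (ν * lam1 L) := by linarith
    rw [intervalIntegral.integral_add
      ((hureg.isStrong.intervalIntegrable_sq_deriv ha hab).const_mul _)
      ((hureg.isStrong.intervalIntegrable_sq_stokes ha hab).const_mul _),
      intervalIntegral.integral_const_mul, intervalIntegral.integral_const_mul]
    refine le_trans (add_le_add ?_ ?_) hbound
    · exact mul_le_mul_of_nonneg_left (leray_integral_sq_deriv_le hν hα hureg hueq hf ha) hp₁0
    · exact mul_le_mul_of_nonneg_left (leray_integral_sq_stokes_le hν hα hureg hueq hf ha) hp₂0
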